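/- **Conventions.** Let $k$ be a field. A variety is a reduced separated $k$-scheme of finite type. $\mathcal M=K_0(\mathrm{Var}_k)$ is the Grothendieck ring of varieties: it is generated as an abelian group by isomorphism classes $[X]$ of finite type $k$-schemes with the relations $[X]=[U]+[Y]$ for $Y\subset X$ closed with open complement $U$, and $[X][Y]=[X\times_k Y]$. Put $\mathbf L=[\mathbb A^1]$, and let $\widehat{\mathcal M_{\mathbf L}}$ be the completion of $\mathcal M[\mathbf L^{-1}]$ for the dimensional filtration, whose $m$-th step ($m\in\mathbb Z$) is the subgroup generated by the elements $[X]\mathbf L^{-i}$ with $\dim X-i\le m$ (neighbourhoods of $0$ are given by $m\to-\infty$). $[\mathrm{Sym}^n X]$ is the class of $X^n/\mathfrak S_n$; when this algebraic space is not a scheme, its class is $\sum_{n_1+\dots+n_r=n}\prod_i[\mathrm{Sym}^{n_i}X_i]$ for any decomposition of $X$ into finitely many locally closed subschemes $X_i$ all of whose symmetric powers are schemes. The motivic zeta function of $X$ is $\mathbf Z_X(t)=\sum_{n\ge0}[\mathrm{Sym}^nX]t^n$. *Motivic stabilization of symmetric powers* holds for $X$, of dimension $d$, if $\lim_{n\to\infty}[\mathrm{Sym}^nX]/\mathbf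 L^{dn}$ exists in $\widehat{\mathcal M_{\mathbf L}}$. **Proposition.** Let $X$ be a geometrically irreducible variety over $k$ of dimension $d$, let $U\subset X$ be a dense open subset, and let $Y\subset X$ be its closed complement (with its reduced structure). Then the series $\mathbf Z_Y(\mathbf L^{-d})=\sum_{n\ge 0}[\mathrm{Sym}^nY]\,\mathbf L^{-dn}$ converges in $\widehat{\mathcal M_{\mathbf L}}$. The limit $\lim_{n}[\mathrm{Sym}^nX]/\mathbf L^{dn}$ exists in $\widehat{\mathcal M_{\mathbf L}}$ (motivic stabilization of symmetric powers holds for $X$) if and only if $\lim_{n}[\mathrm{Sym}^nU]/\mathbf L^{dn}$ exists (motivic stabilization of symmetric powers holds for $U$), and in this case $$\lim_{n\to\infty}\frac{[\mathrm{Sym}^nX]}{\mathbf L^{dn}}=\mathbf Z_Y(\mathbf L^{-d})\,\lim_{n\to\infty}\frac{[\mathrm{Sym}^nU]}{\mathbf L^{dn}}.$$ In particular, if $X_1$ and $X_2$ are geometrically irreducible varieties over $k$ that are birational over $k$, then motivic stabilization of symmetric powers holds for $X_1$ if and only if it holds for $X_2$. -/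

import Mathlib

open CategoryTheory AlgebraicGeometry Limits Filter Topology
open scoped TensorProduct

universe u

noncomputable section

namespace Motivic

/-! ### Dimension of products -/

theorem ringKrullDim_le_of_isIntegral' {A B : Type*} [CommRing A] [CommRing B] (f : A →+* B)
    (hf : f.IsIntegral) : ringKrullDim B ≤ ringKrullDim A := by
  algebraize [f]
  refine Order.krullDim_le_of_strictMono (PrimeSpectrum.comap f) ?_
  intro p q h
  exact Ideal.IsIntegral.comap_lt_comap (R := A) h

theorem ringKrullDim_ge_of_isIntegral' {A B : Type*} [CommRing A] [CommRing B] (f : A →+* B)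
    (hf : f.IsIntegral) (hi : Function.Injective f) : ringKrullDim A ≤ ringKrullDim B := by
  algebraize [f]
  refine iSup_le fun l => ?_
  have hi' : Function.Injective (algebraMap A B) := hi
  have : FaithfulSMul A B := (faithfulSMul_iff_algebraMap_injective A B).mpr hi'
  obtain ⟨Q, -, hQ, hQl⟩ := Ideal.exists_ideal_over_prime_of_isIntegral l.head.asIdeal (⊥ : Ideal B)
    (by rw [← RingHom.ker_eq_comap_bot, (RingHom.injective_iff_ker_eq_bot _).mp hi']; exact bot_le)
  have : Q.LiesOver l.head.asIdeal := ⟨hQl.symm⟩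
  obtain ⟨L, hL, -, -⟩ := Ideal.exists_ltSeries_of_hasGoingUp (S := B) l Q 
  rw [← hL]
  exact le_iSup (fun p : LTSeries (PrimeSpectrum B) => ((p.length : ℕ∞) : WithBot ℕ∞)) L

theorem isIntegralElem_of_comp {P A Q C : Type*} [CommRing P] [CommRing A] [CommRing Q] [CommRing C]
    (f : P →+* A) (i : P →+* Q) (r : A →+* C) (h : Q →+* C) (e : h.comp i = r.comp f) {x : A}
    (hx : f.IsIntegralElem x) : h.IsIntegralElem (r x) := by
  obtain ⟨p, hp, hp'⟩ := hx
  refine ⟨p.map i, hp.map _, ?_⟩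
  rw [Polynomial.eval₂_map, e, ← Polynomial.hom_eval₂, hp', map_zero]

theorem ringKrullDim_tensor_le {k A B : Type*} [Field k] [CommRing A] [CommRing B]
    [Algebra k A] [Algebra k B] [Algebra.FiniteType k A] [Algebra.FiniteType k B] 
    {a b : ℕ} (ha : ringKrullDim A ≤ a) (hb : ringKrullDim B ≤ b) :
    ringKrullDim (A ⊗[k] B) ≤ (a + b : ℕ) := by
  cases subsingleton_or_nontrivial A
  · have : Subsingleton (A ⊗[k] B) :=
      (Algebra.TensorProduct.includeLeft (R := k) (S := k) (A := A) (B := B)).toRingHom.codomain_trivial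
    rw [ringKrullDim_eq_bot_of_subsingleton]
    exact bot_le
  cases subsingleton_or_nontrivial B
  · have : Subsingleton (A ⊗[k] B) :=
      (Algebra.TensorProduct.includeRight (R := k) (A := A) (B := B)).toRingHom.codomain_trivial
    rw [ringKrullDim_eq_bot_of_subsingleton]
    exact bot_le
  obtain ⟨s, f, hf, hf'⟩ := exists_integral_inj_algHom_of_fg k A
  obtain ⟨t, g, hg, hg'⟩ := exists_integral_inj_algHom_of_fg k B
  have h1 := (ringKrullDim_ge_of_isIntegral' f.toRingHom hf' hf).trans ha
  have h2 := (ringKrullDim_ge_of_isIntegral' g.toRingHom hg' hg).trans hb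
  simp only [MvPolynomial.ringKrullDim_of_isNoetherianRing, ringKrullDim_eq_zero_of_field,
    zero_add, Nat.card_fin] at h1 h2
  let h : MvPolynomial (Fin s ⊕ Fin t) k →ₐ[k] A ⊗[k] B :=
    MvPolynomial.aeval (Sum.elim (fun i => f (.X i) ⊗ₜ 1) (fun i => 1 ⊗ₜ g (.X i)))
  have hl : h.comp (MvPolynomial.rename Sum.inl) = Algebra.TensorProduct.includeLeft.comp f := by
    ext; simp [h]
  have hr : h.comp (MvPolynomial.rename Sum.inr) = Algebra.TensorProduct.includeRight.comp g := by
    ext; simp [h]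
  have hh : h.toRingHom.IsIntegral := by
    intro x
    induction x with
    | zero => exact RingHom.isIntegralElem_zero _
    | add x y hx hy => exact RingHom.IsIntegralElem.add _ hx hy
    | tmul x y =>
      rw [← mul_one x, ← one_mul y, ← Algebra.TensorProduct.tmul_mul_tmul]
      refine RingHom.IsIntegralElem.mul _ ?_ ?_
      · exact isIntegralElem_of_comp f.toRingHom (MvPolynomial.rename Sum.inl).toRingHom
          (Algebra.TensorProduct.includeLeft (R := k) (S := k) (A := A) (B := B)).toRingHom h.toRingHom
          (RingHom.ext fun z => DFunLike.congr_fun hl z) (hf' x)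
      · exact isIntegralElem_of_comp g.toRingHom (MvPolynomial.rename Sum.inr).toRingHom
          (Algebra.TensorProduct.includeRight (R := k) (A := A) (B := B)).toRingHom h.toRingHom
          (RingHom.ext fun z => DFunLike.congr_fun hr z) (hg' y)
  refine (ringKrullDim_le_of_isIntegral' _ hh).trans ?_
  simp only [MvPolynomial.ringKrullDim_of_isNoetherianRing, ringKrullDim_eq_zero_of_field,
    zero_add, Nat.card_eq_fintype_card, Fintype.card_sum, Fintype.card_fin] 
  norm_cast at h1 h2 ⊢
  omega

theorem topologicalKrullDim_le_of_cover {X : Type*} [TopologicalSpace X] {ι : Type*} {Y : ι → Type*}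
    [∀ i, TopologicalSpace (Y i)] (f : ∀ i, Y i → X) (hf : ∀ i, Topology.IsOpenEmbedding (f i))
    (hc : ∀ x, ∃ i y, f i y = x) (d : WithBot ℕ∞) (hd : ∀ i, topologicalKrullDim (Y i) ≤ d) :
    topologicalKrullDim X ≤ d := by
  rw [topologicalKrullDim, Order.krullDim_eq_iSup_coheight]
  refine iSup_le fun Z => ?_
  obtain ⟨x, hx⟩ := Z.2.nonempty
  obtain ⟨i, y, rfl⟩ := hc x
  let e := TopologicalSpace.IrreducibleCloseds.orderIsoOfIsOpenEmbedding (f i) (hf i)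
  have := Topology.IsOpenEmbedding.coheight_map (hf i) (e.symm ⟨Z, ⟨y, hx⟩⟩)
  have h2 : TopologicalSpace.IrreducibleCloseds.map (f i) (hf i).continuous (e.symm ⟨Z, ⟨y, hx⟩⟩) = Z :=
    congrArg Subtype.val (e.apply_symm_apply ⟨Z, ⟨y, hx⟩⟩)
  rw [h2] at this
  rw [this]
  exact (Order.coheight_le_krullDim _).trans (hd i)

theorem finiteType_of_locallyOfFiniteType {A B : CommRingCat.{u}} (φ : A ⟶ B)
    [LocallyOfFiniteType (Spec.map φ)] : φ.hom.FiniteType :=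
  (HasRingHomProperty.Spec_iff (P := @LocallyOfFiniteType)).mp ‹_›

theorem dim_pullback_affine {k : Type u} [Field k] {A B : CommRingCat.{u}}
    (f : Spec A ⟶ Spec (.of k)) (g : Spec B ⟶ Spec (.of k)) [LocallyOfFiniteType f]
    [LocallyOfFiniteType g] {a b : ℕ} (ha : topologicalKrullDim (Spec A) ≤ a) 
    (hb : topologicalKrullDim (Spec B) ≤ b) :
    topologicalKrullDim (pullback f g : Scheme.{u}) ≤ (a + b : ℕ) := by
  obtain ⟨φ, rfl⟩ := Spec.map_surjective f
  obtain ⟨ψ, rfl⟩ := Spec.map_surjective g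
  have hφ := finiteType_of_locallyOfFiniteType φ
  have hψ := finiteType_of_locallyOfFiniteType ψ
  let := φ.hom.toAlgebra
  let := ψ.hom.toAlgebra
  have h1 : Algebra.FiniteType k A := hφ
  have h2 : Algebra.FiniteType k B := hψ
  let e := pullbackSpecIso k A B
  have := e.hom.homeomorph.isHomeomorph.topologicalKrullDim_eq
  refine this.trans_le ?_
  erw [PrimeSpectrum.topologicalKrullDim_eq_ringKrullDim] at ha hb ⊢
  exact ringKrullDim_tensor_le ha hb

theorem dim_pullback {k : Type u} [Field k] {X Y : Scheme.{u}}
    (f : X ⟶ Spec (.of k)) (g : Y ⟶ Spec (.of k)) [LocallyOfFiniteType f]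
    [LocallyOfFiniteType g] {a b : ℕ} (ha : topologicalKrullDim X ≤ a) 
    (hb : topologicalKrullDim Y ≤ b) :
    topologicalKrullDim (pullback f g : Scheme.{u}) ≤ (a + b : ℕ) := by
  let 𝒰 := Scheme.Pullback.openCoverOfLeftRight X.affineCover Y.affineCover f g
  refine topologicalKrullDim_le_of_cover (fun i => 𝒰.f i) (fun i => (𝒰.f i).isOpenEmbedding)
    (fun x => ⟨_, 𝒰.covers x⟩) _ ?_
  rintro ⟨i, j⟩
  have h1 : LocallyOfFiniteType (X.affineCover.f i ≫ f) :=
    locallyOfFiniteType_comp (X.affineCover.f i) f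
  have h2 : LocallyOfFiniteType (Y.affineCover.f j ≫ g) :=
    locallyOfFiniteType_comp (Y.affineCover.f j) g
  exact @dim_pullback_affine k _ _ _ (X.affineCover.f i ≫ f) (Y.affineCover.f j ≫ g) h1 h2 a b
    ((X.affineCover.f i).isOpenEmbedding.isInducing.topologicalKrullDim_le.trans ha)
    ((Y.affineCover.f j).isOpenEmbedding.isInducing.topologicalKrullDim_le.trans hb)

theorem exists_dim_le {k : Type u} [Field k] {X : Scheme.{u}}
    (f : X ⟶ Spec (.of k)) [LocallyOfFiniteType f] [QuasiCompact f] :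
    ∃ d : ℕ, topologicalKrullDim X ≤ d := by
  have : CompactSpace X := QuasiCompact.compactSpace_of_compactSpace f
  let 𝒰 := X.affineCover.finiteSubcover
  have key (i : 𝒰.I₀) : ∃ d : ℕ, topologicalKrullDim (𝒰.X i) ≤ d := by
    obtain ⟨φ, hφ⟩ := Spec.map_surjective (show Spec _ ⟶ _ from (𝒰.f i ≫ f))
    have : LocallyOfFiniteType (Spec.map φ) := by
      rw [hφ]; exact locallyOfFiniteType_comp (𝒰.f i) f
    have hφ := finiteType_of_locallyOfFiniteType φ
    let := φ.hom.toAlgebra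
    have h1 : Algebra.FiniteType k _ := hφ
    obtain ⟨n, p, hp⟩ := Algebra.FiniteType.iff_quotient_mvPolynomial''.mp h1
    refine ⟨n, ?_⟩
    erw [PrimeSpectrum.topologicalKrullDim_eq_ringKrullDim]
    refine (ringKrullDim_le_of_surjective p.toRingHom hp).trans ?_
    simp
  choose d hd using key
  refine ⟨Finset.univ.sup d, topologicalKrullDim_le_of_cover (fun i => 𝒰.f i) 
    (fun i => (𝒰.f i).isOpenEmbedding) (fun x => ⟨_, 𝒰.covers x⟩) _ fun i => (hd i).trans ?_⟩
  exact_mod_cast Finset.le_sup (f := d) (Finset.mem_univ i)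

/-! ### The Grothendieck ring of varieties -/

section Ring

variable (k : Type u) [Field k]

/-- Schemes of finite type over the field `k`. -/
structure FTScheme where
  /-- the underlying `k`-scheme -/
  obj : Over (Spec (.of k))
  [lft : LocallyOfFiniteType obj.hom]
  [qc : QuasiCompact obj.hom]

attribute [instance] FTScheme.lft FTScheme.qc

instance FTScheme.isoSetoid : Setoid (FTScheme k) where
  r X Y := Nonempty (X.obj ≅ Y.obj)
  iseqv := ⟨fun _ => ⟨Iso.refl _⟩, fun ⟨e⟩ => ⟨e.symm⟩, fun ⟨e⟩ ⟨f⟩ => ⟨e ≪≫ f⟩⟩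

/-- Isomorphism classes of `k`-schemes of finite type. -/
def IsoClass : Type (u + 1) := _root_.Quotient (FTScheme.isoSetoid k)

variable {k}

/-- The product `X ×ₖ Y`. -/
def FTScheme.prod (X Y : FTScheme k) : FTScheme k where
  obj := Over.mk (pullback.fst X.obj.hom Y.obj.hom ≫ X.obj.hom)
  lft := by dsimp; infer_instance
  qc := by dsimp; infer_instance

variable (k) in
/-- The point `Spec k`. -/
def FTScheme.point : FTScheme k where
  obj := Over.mk (𝟙 _)
  lft := by dsimp; infer_instance
  qc := by dsimp; infer_instance

variable (k) in
/-- The affine line `Spec k[T]`. -/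
def FTScheme.affineLine : FTScheme k where
  obj := Over.mk (Spec.map (CommRingCat.ofHom (Polynomial.C : k →+* Polynomial k)))
  lft := by
    dsimp
    rw [HasRingHomProperty.Spec_iff (P := @LocallyOfFiniteType)]
    exact (RingHom.finiteType_algebraMap (A := k) (B := Polynomial k)).mpr inferInstance
  qc := by dsimp; infer_instance

section
attribute [local instance] Over.cartesianMonoidalCategory Over.braidedCategory
open MonoidalCategory

/-- Isomorphism classes of `k`-schemes of finite type form a commutative monoid under `×ₖ`. -/
instance : CommMonoid (IsoClass k) where
  mul := _root_.Quotient.map₂ FTScheme.prod fun _ _ ⟨e⟩ _ _ ⟨f⟩ => ⟨(e ⊗ᵢ f :)⟩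
  one := _root_.Quotient.mk _ (FTScheme.point k)
  mul_assoc := by
    rintro ⟨X⟩ ⟨Y⟩ ⟨Z⟩
    exact _root_.Quotient.sound ⟨α_ X.obj Y.obj Z.obj⟩
  one_mul := by
    rintro ⟨X⟩
    exact _root_.Quotient.sound ⟨λ_ X.obj⟩
  mul_one := by
    rintro ⟨X⟩
    exact _root_.Quotient.sound ⟨ρ_ X.obj⟩
  mul_comm := by
    rintro ⟨X⟩ ⟨Y⟩
    exact _root_.Quotient.sound ⟨β_ X.obj Y.obj⟩

end

/-- The generator attached to `X`, in the free abelian group on isomorphism classes. -/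
def freeCls (X : FTScheme k) : FreeAbelianGroup (IsoClass k) :=
  FreeAbelianGroup.of (_root_.Quotient.mk _ X)

variable (k) in
/-- The cut-and-paste elements `[X] - [U] - [Y]`, with `Y` a closed subscheme of `X`
and `U` its open complement. -/
def scissor : Set (FreeAbelianGroup (IsoClass k)) :=
  {r | ∃ (X U Y : FTScheme k) (i : Y.obj ⟶ X.obj) (j : U.obj ⟶ X.obj),
    IsClosedImmersion i.left ∧ IsOpenImmersion j.left ∧
    Set.range j.left = (Set.range i.left)ᶜ ∧ r = freeCls X - freeCls U - freeCls Y}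

variable (k) in
/-- The Grothendieck ring of varieties `K₀(Var_k)`. The subgroup generated by `scissor k` is
stable under multiplication by generators, so it is the ideal generated by `scissor k`. -/
def K0 : Type (u + 1) := FreeAbelianGroup (IsoClass k) ⧸ Ideal.span (scissor k)

instance : CommRing (K0 k) :=
  inferInstanceAs (CommRing (FreeAbelianGroup (IsoClass k) ⧸ Ideal.span (scissor k)))

/-- The class `[X]` of a finite type `k`-scheme in the Grothendieck ring. -/
def cls (X : FTScheme k) : K0 k := Ideal.Quotient.mk (Ideal.span (scissor k)) (freeCls X)

theorem cls_prod (X Y : FTScheme k) : cls (X.prod Y) = cls X * cls Y := by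
  have : freeCls (X.prod Y) = freeCls X * freeCls Y :=
    (FreeAbelianGroup.of_mul (α := IsoClass k) (_root_.Quotient.mk _ X) (_root_.Quotient.mk _ Y)).symm
  exact (congrArg _ this).trans (map_mul (Ideal.Quotient.mk (Ideal.span (scissor k))) _ _)

theorem K0_induction {p : K0 k → Prop} (zero : p 0) (of : ∀ X, p (cls X))
    (neg : ∀ x, p x → p (-x)) (add : ∀ x y, p x → p y → p (x + y)) (x : K0 k) : p x := by
  obtain ⟨x, rfl⟩ := Ideal.Quotient.mk_surjective (I := Ideal.span (scissor k)) x
  induction x using FreeAbelianGroup.induction_on with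
  | zero => exact zero
  | of X => 
    obtain ⟨X⟩ := X
    exact of X
  | neg X h => exact neg _ h
  | add x y hx hy => exact add _ _ hx hy

variable (k) in
/-- The Lefschetz motive `𝐋 = [𝔸¹]`. -/
def lefschetz : K0 k := cls (FTScheme.affineLine k)

variable (k) in
/-- The localization of the Grothendieck ring at the Lefschetz motive. -/
def K0Loc : Type (u + 1) := Localization.Away (lefschetz k)

instance : CommRing (K0Loc k) := inferInstanceAs (CommRing (Localization.Away (lefschetz k)))

instance : Algebra (K0 k) (K0Loc k) :=
  inferInstanceAs (Algebra (K0 k) (Localization.Away (lefschetz k)))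

instance : IsLocalization.Away (lefschetz k) (K0Loc k) :=
  inferInstanceAs (IsLocalization.Away (lefschetz k) (Localization.Away (lefschetz k)))

variable (k) in
/-- The element `𝐋⁻¹`. -/
def invL : K0Loc k := IsLocalization.Away.invSelf (lefschetz k)

theorem lefschetz_mul_invL : algebraMap (K0 k) (K0Loc k) (lefschetz k) * invL k = 1 :=
  IsLocalization.Away.mul_invSelf _

variable (k) in
/-- The dimensional filtration: `dimFil k m` is the subgroup generated by the elements
`[X] 𝐋⁻ⁱ` with `dim X - i ≤ m`. -/
def dimFil (m : ℤ) : AddSubgroup (K0Loc k) :=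
  AddSubgroup.closure {x | ∃ (X : FTScheme k) (d i : ℕ), topologicalKrullDim X.obj.left ≤ d ∧
    (d : ℤ) - i ≤ m ∧ x = algebraMap (K0 k) (K0Loc k) (cls X) * invL k ^ i}

theorem dimFil_mono {m n : ℤ} (h : m ≤ n) : dimFil k m ≤ dimFil k n :=
  AddSubgroup.closure_mono fun _ ⟨X, d, i, h1, h2, h3⟩ => ⟨X, d, i, h1, h2.trans h, h3⟩

theorem dimFil_mul {m n : ℤ} {x y : K0Loc k} (hx : x ∈ dimFil k m) (hy : y ∈ dimFil k n) :
    x * y ∈ dimFil k (m + n) := by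
  induction hx using AddSubgroup.closure_induction with
  | zero => simp [zero_mem]
  | add a b _ _ ha hb => rw [add_mul]; exact add_mem ha hb
  | neg a _ ha => rw [neg_mul]; exact neg_mem ha
  | mem x hx =>
    obtain ⟨X, d, i, h1, h2, rfl⟩ := hx
    induction hy using AddSubgroup.closure_induction with
    | zero => simp [zero_mem]
    | add a b _ _ ha hb => rw [mul_add]; exact add_mem ha hb
    | neg a _ ha => rw [mul_neg]; exact neg_mem ha
    | mem y hy =>
      obtain ⟨Y, e, j, h3, h4, rfl⟩ := hy
      refine AddSubgroup.subset_closure ⟨X.prod Y, d + e, i + j, ?_, ?_, ?_⟩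
      · exact dim_pullback X.obj.hom Y.obj.hom h1 h3
      · push_cast; linarith
      · rw [cls_prod, map_mul, pow_add]; ring

theorem exists_mem_dimFil (x : K0Loc k) : ∃ m, x ∈ dimFil k m := by
  obtain ⟨n, a, hx⟩ := IsLocalization.Away.surj (lefschetz k) x
  have hx' : x = algebraMap _ _ a * invL k ^ n := by
    rw [← hx, mul_assoc, ← mul_pow, lefschetz_mul_invL, one_pow, mul_one]
  subst hx'
  clear hx
  induction a using K0_induction with
  | zero => exact ⟨0, by simp [zero_mem]⟩
  | of X =>
    obtain ⟨d, hd⟩ := exists_dim_le X.obj.hom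
    exact ⟨d - n, AddSubgroup.subset_closure ⟨X, d, n, hd, le_rfl, rfl⟩⟩
  | neg a h =>
    obtain ⟨m, hm⟩ := h
    exact ⟨m, by rw [map_neg, neg_mul]; exact neg_mem hm⟩
  | add a b ha hb =>
    obtain ⟨m, hm⟩ := ha
    obtain ⟨n, hn⟩ := hb
    refine ⟨max m n, ?_⟩
    rw [map_add, add_mul]
    exact add_mem (dimFil_mono (le_max_left _ _) hm) (dimFil_mono (le_max_right _ _) hn)

variable (k) in
theorem dimFil_basis : RingSubgroupsBasis (dimFil k) := by
  refine RingSubgroupsBasis.of_comm _ (fun i j => ⟨min i j, le_inf (dimFil_mono (min_le_left _ _))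
    (dimFil_mono (min_le_right _ _))⟩) (fun i => ⟨min i 0, ?_⟩) (fun x i => ?_)
  · rintro _ ⟨x, hx, y, hy, rfl⟩
    exact dimFil_mono (by omega) (dimFil_mul (n := 0) hx (dimFil_mono (min_le_right _ _) hy))
  · obtain ⟨m, hm⟩ := exists_mem_dimFil x
    refine ⟨i - m, fun y hy => ?_⟩
    simpa using dimFil_mul hm hy

/-- The topology given by the dimensional filtration. -/
instance : TopologicalSpace (K0Loc k) := (dimFil_basis k).topology

instance : IsTopologicalRing (K0Loc k) :=
  (dimFil_basis k).toRingFilterBasis.isTopologicalRing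

instance : UniformSpace (K0Loc k) := IsTopologicalAddGroup.rightUniformSpace (K0Loc k)

instance : IsUniformAddGroup (K0Loc k) := isUniformAddGroup_of_addCommGroup

variable (k) in
/-- The completion of the localized Grothendieck ring with respect to the dimensional
filtration, a topological ring. -/
abbrev K0Hat : Type (u + 1) := UniformSpace.Completion (K0Loc k)

/-- The natural ring homomorphism from the Grothendieck ring to the completion. -/
def toHat : K0 k →+* K0Hat k :=
  (UniformSpace.Completion.coeRingHom : K0Loc k →+* K0Hat k).comp (algebraMap (K0 k) (K0Loc k))

variable (k) in
/-- The element `𝐋⁻¹` of the completion. -/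
def invLHat : K0Hat k := (invL k : K0Loc k)

end Ring

/-! ### Symmetric powers -/

section Sym

variable {k : Type u} [Field k]

/-- A variety over `k`: a reduced separated scheme of finite type. -/
class IsVariety (X : Over (Spec (.of k))) : Prop where
  reduced : IsReduced X.left
  separated : IsSeparated X.hom
  locallyOfFiniteType : LocallyOfFiniteType X.hom
  quasiCompact : QuasiCompact X.hom

/-- The `n`-fold fibre power of `X` over `k`. -/
abbrev fibrePower (X : Over (Spec (.of k))) (n : ℕ) : Over (Spec (.of k)) :=
  ∏ᶜ fun _ : Fin n => X

/-- The action of a permutation on the fibre power by permuting the factors. -/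
def permute (X : Over (Spec (.of k))) {n : ℕ} (σ : Equiv.Perm (Fin n)) :
    fibrePower X n ⟶ fibrePower X n :=
  Pi.lift fun i => Pi.π (fun _ : Fin n => X) (σ i)

/-- `π : Xⁿ ⟶ Q` exhibits the scheme `Q` as the quotient of `Xⁿ` by the symmetric group:
`π` is affine and invariant, and the functions on an open `V ⊆ Q` are, through `π`,
the invariant functions on `π⁻¹ V`. -/
structure IsSymQuotient (X : Over (Spec (.of k))) (n : ℕ) {Q : Over (Spec (.of k))}
    (π : fibrePower X n ⟶ Q) : Prop where
  isAffineHom : IsAffineHom π.left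
  invariant : ∀ σ : Equiv.Perm (Fin n), permute X σ ≫ π = π
  functions : ∀ (V : Q.left.Opens) (f : Γ((fibrePower X n).left, π.left ⁻¹ᵁ V)),
    (∀ (σ : Equiv.Perm (Fin n))
      (h : π.left ⁻¹ᵁ V ≤ (permute X σ).left ⁻¹ᵁ (π.left ⁻¹ᵁ V)),
      (permute X σ).left.appLE (π.left ⁻¹ᵁ V) (π.left ⁻¹ᵁ V) h f = f) →
    ∃! g : Γ(Q.left, V), π.left.app V g = f

/-- `Q` is the symmetric power `Symⁿ X = Xⁿ / 𝔖ₙ`, formed as a scheme. -/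
def IsSymPower (X : Over (Spec (.of k))) (n : ℕ) (Q : Over (Spec (.of k))) : Prop :=
  ∃ π : fibrePower X n ⟶ Q, IsSymQuotient X n π

/-- `c` is the sum of the classes `∏ᵢ [Sym^{aᵢ} Zᵢ]`, `∑ᵢ aᵢ = n`, for a decomposition of `X`
into finitely many locally closed subschemes `Zᵢ` all of whose symmetric powers are schemes.
(The products `∏ᵢ Sym^{aᵢ} Zᵢ` are the strata of the algebraic space `Symⁿ X`.) -/
def IsStratifiedSymClass (X : Over (Spec (.of k))) (n : ℕ) (c : K0 k) : Prop :=
  ∃ (r : ℕ) (Z : Fin r → Over (Spec (.of k))) (j : ∀ i, Z i ⟶ X) (Q : Fin r → ℕ → FTScheme k),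
    (∀ i, IsImmersion (j i).left) ∧
    (∀ x : X.left, ∃! i, x ∈ Set.range (j i).left) ∧
    (∀ i m, IsSymPower (Z i) m (Q i m).obj) ∧
    c = ∑ a ∈ Finset.piAntidiag Finset.univ n, ∏ i, cls (Q i (a i))

open Classical in
/-- The class `[Symⁿ X]` in the Grothendieck ring. If `Symⁿ X` is a scheme (for example if `X` is
quasi-projective), this is the class of that scheme. In general `Symⁿ X` is an algebraic space,
and its class is the sum of the classes of the strata of a decomposition into schemes. -/
def symClass (X : Over (Spec (.of k))) (n : ℕ) : K0 k :=
  if h : ∃ Q : FTScheme k, IsSymPower X n Q.obj then cls h.choose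
  else if h : ∃ c, IsStratifiedSymClass X n c then h.choose
  else 0

/-- The motivic zeta function `𝐙_X(t) = ∑ₙ [Symⁿ X] tⁿ`. -/
def motivicZeta (X : Over (Spec (.of k))) : PowerSeries (K0 k) :=
  PowerSeries.mk (symClass X)

/-- The `n`-th term `Fₙ · (𝐋⁻ᵈ)ⁿ` of the series `F(𝐋⁻ᵈ)` in the completion. -/
def zetaTerm (F : PowerSeries (K0 k)) (d n : ℕ) : K0Hat k :=
  toHat (PowerSeries.coeff n F) * (invLHat k ^ d) ^ n

/-- The value `F(𝐋⁻ᵈ)` of a power series in the completion (used where the series converges). -/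
def zetaValue (F : PowerSeries (K0 k)) (d : ℕ) : K0Hat k := ∑' n, zetaTerm F d n

/-- The sequence `[Symⁿ X] / 𝐋^{dn}` in the completion. -/
def symRatio (X : Over (Spec (.of k))) (d n : ℕ) : K0Hat k :=
  toHat (symClass X n) * invLHat k ^ (d * n)

/-- Motivic stabilization of symmetric powers holds for `X`: with `d = dim X`,
the limit of `[Symⁿ X] / 𝐋^{dn}` exists in the completion. -/
def MSSP (X : Over (Spec (.of k))) : Prop :=
  ∃ d : ℕ, topologicalKrullDim X.left = d ∧ ∃ ℓ, Tendsto (symRatio X d) atTop (𝓝 ℓ)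

/-- An open subscheme as a `k`-scheme. -/
abbrev openSub (X : Over (Spec (.of k))) (U : X.left.Opens) : Over (Spec (.of k)) :=
  Over.mk (U.ι ≫ X.hom)

end Sym

end Motivic

end

open Motivic

/-!
The zeta function of a separated scheme `X` can be computed by any affine scheme `Spec B` mapping to
`X` bijectively by a morphism which is an immersion locally on the source, such as the disjoint union
of the pieces of a stratification by affine schemes (`motivicZeta_eq`). The reason is that the induced
morphism from `Spec` of the symmetric tensors `TSⁿ(B)` to the `n`-th symmetric power of `X` is bijective
and induces isomorphisms of residue fields (`symSpec_cls_eq`), and that such a morphism identifies the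
classes in the Grothendieck ring, by Noetherian induction from a section over a dense open subset
(`FieldBijective.cls_eq`). For the residue fields, a symmetric tensor is lifted near a point of the
fibre power of `X` to a function invariant under the stabilizer of the point, as symmetric tensors over
a field lift along surjections (`SymTensor.exists_map_eq`, `exists_invariant_lift`). An element which
separates the points of the orbit and a sum over cosets turn this function into a fraction of invariant
functions with the same value (`IsGroupQuotient.exists_app_sub_mem`).

Independence of the chosen affine scheme follows by refining two of them by their fibre product
(`HasPiecewiseZeta.unique`), and covers the symmetric powers which are schemes as well as those defined
by decompositions. Since `TSⁿ(B × C)` is the product of the algebras `TSⁱ(B) ⊗ TSʲ(C)` for `i + j = n`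
(`SymTensor.nonempty_algEquiv_prod`), zeta functions multiply: `𝐙_X = 𝐙_Y 𝐙_U` for `U` open in `X` with
closed complement `Y` (`motivicZeta_eq_mul`).

If `X` is integral of dimension `d` and `U` is nonempty, then `dim U = d` and `dim Y < d`. As
`dim Symⁿ Y ≤ n dim Y`, the `n`-th coefficient of `𝐙_Y(𝐋⁻ᵈ t)` lies in the step `-n` of the dimensional
filtration (`zetaTerm_mem_dimFilHat`), so `𝐙_Y(𝐋⁻ᵈ)` converges. The ratios of the theorem are the
coefficients of `𝐙_X(𝐋⁻ᵈ t)` and `𝐙_U(𝐋⁻ᵈ t)`. Multiplying a series with convergent coefficients by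
`𝐙_Y(𝐋⁻ᵈ t)` multiplies the limit by `𝐙_Y(𝐋⁻ᵈ)` (`IsRingFiltration.tendsto_coeff_mul`). The inverse of
`𝐙_Y(𝐋⁻ᵈ t)`, whose constant coefficient is `1`, has coefficients in the same steps of the filtration,
which gives the converse. Birational varieties are compared through a common dense open subscheme.
-/

noncomputable section

namespace Motivic

/-! ### Finite group actions on rings -/

open scoped Pointwise in
/-- Let `H` be a subgroup containing the stabilizer of a prime `p`. An ideal `J` contained in no
translate `h • p` with `h ∈ H` has an `H`-invariant element which does not vanish at `p` but vanishes
at the points of the orbit of `p` outside its `H`-orbit. -/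
theorem exists_invariant_separating {S G : Type*} [CommRing S] [Group G] [Finite G]
    [MulSemiringAction G S] (H : Subgroup G) (p : Ideal S) [p.IsPrime]
    (hH : ∀ g : G, g • p = p → g ∈ H) (J : Ideal S) (hJ : ∀ h ∈ H, ¬ J ≤ h • p) :
    ∃ t : S, (∀ h ∈ H, h • t = t) ∧ t ∈ J ∧ t ∉ p ∧ ∀ g ∉ H, g • t ∈ p := by
  classical
  have := Fintype.ofFinite G
  -- the points of an orbit do not specialize to each other, as `g` has finite order
  have inc (g : G) (hg : g • p ≤ p) : g • p = p := by
    refine le_antisymm hg ?_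
    have key (n : ℕ) : g ^ n • p ≤ p := by
      induction n with
      | zero => simp
      | succ n ih =>
        rw [pow_succ, mul_smul]
        exact (Ideal.pointwise_smul_le_pointwise_smul_iff.mpr hg).trans ih
    have h1 := key (orderOf g - 1)
    rw [← Ideal.pointwise_smul_le_pointwise_smul_iff (a := g), ← mul_smul, ← pow_succ',
      Nat.sub_add_cancel (orderOf_pos g), pow_orderOf_eq_one, one_smul] at h1
    exact h1
  let K : Ideal S := J ⊓ (Finset.univ.filter (fun g : G => g ∉ H)).inf fun g => g • p
  have prime (g : G) : (g • p).IsPrime := inferInstance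
  have hK (h : G) (hh : h ∈ H) : ¬ K ≤ h • p := by
    intro hle
    rcases (prime h).inf_le.mp hle with h1 | h1
    · exact hJ h hh h1
    · obtain ⟨g, hg, hgp⟩ := ((prime h).inf_le' ).mp h1
      simp only [Finset.mem_filter, Finset.mem_univ, true_and] at hg
      have h2 : (h⁻¹ * g) • p ≤ p := by
        rw [mul_smul, ← Ideal.pointwise_smul_le_pointwise_smul_iff (a := h), smul_inv_smul]
        exact hgp
      have := H.mul_mem hh (hH _ (inc _ h2))
      rw [mul_inv_cancel_left] at this
      exact hg this
  -- prime avoidance; the norm from `H` of the element `s` obtained is as required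
  obtain ⟨s, hsK, hs⟩ : ∃ s ∈ K, ∀ h ∈ H, s ∉ h • p := by
    by_contra! hcon
    have : (K : Set S) ⊆ ⋃ h ∈ ((Finset.univ.filter (fun g : G => g ∈ H) : Finset G) : Set G),
        ((h • p : Ideal S) : Set S) := by
      intro x hx
      obtain ⟨h, hh, hx⟩ := hcon x hx
      simp only [Set.mem_iUnion]
      exact ⟨h, by simpa using hh, hx⟩
    obtain ⟨h, hh, hle⟩ := (Ideal.subset_union_prime (1 : G) 1 fun g _ _ _ => prime g).mp this
    exact hK h (by simpa using hh) hle
  refine ⟨∏ h : H, (h : G) • s, ?_, ?_, ?_, ?_⟩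
  · intro h hh
    rw [Finset.smul_prod']
    refine Fintype.prod_equiv (Equiv.mulLeft ⟨h, hh⟩) _ _ fun x => ?_
    simp [mul_smul]
  · rw [← Finset.mul_prod_erase _ _ (Finset.mem_univ (1 : H))]
    exact J.mul_mem_right _ (by simpa using hsK.1)
  · rw [‹p.IsPrime›.prod_mem_iff]
    rintro ⟨h, -, hh⟩
    refine hs (h : G)⁻¹ (H.inv_mem h.2) ?_
    rwa [Ideal.mem_inv_pointwise_smul_iff]
  · intro g hg
    rw [Finset.smul_prod', ← Finset.mul_prod_erase _ _ (Finset.mem_univ (1 : H))]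
    refine p.mul_mem_right _ ?_
    have := hsK.2
    have := Finset.inf_le (f := fun g : G => g • p) (show g⁻¹ ∈ _ by simpa using hg) this
    rw [Ideal.mem_inv_pointwise_smul_iff] at this
    simpa using this

/-- Summing over the cosets of `H` turns an `H`-invariant element `w` whose translates by the
elements outside `H` lie in `p` into an invariant element with the same class modulo `p`. -/
theorem exists_invariant_sub_mem {S G : Type*} [AddCommGroup S] [Group G] [Finite G]
    [DistribMulAction G S] (H : Subgroup G) (p : AddSubgroup S) {w : S} (hw : ∀ h ∈ H, h • w = w)
    (hp : ∀ g ∉ H, g • w ∈ p) : ∃ v : S, (∀ g : G, g • v = v) ∧ v - w ∈ p ∧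
      ∀ q : AddSubgroup S, (∀ g : G, g • w ∈ q) → v ∈ q := by
  classical
  have := Fintype.ofFinite (G ⧸ H)
  let F : G ⧸ H → S := Quotient.lift (fun g : G => g • w) (by
    intro a b hab
    replace hab := QuotientGroup.leftRel_apply.mp hab
    have := hw _ hab
    rw [mul_smul, inv_smul_eq_iff] at this
    exact this.symm)
  have hF (g x : G) : F (g • (x : G ⧸ H)) = g • F x := mul_smul g x w
  refine ⟨∑ x, F x, fun g => ?_, ?_, fun q hq => ?_⟩
  · rw [Finset.smul_sum]
    refine Fintype.sum_equiv (MulAction.toPerm g) _ _ fun x => ?_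
    induction x using QuotientGroup.induction_on with
    | H x => exact (hF g x).symm
  · have h1 : F ((1 : G) : G ⧸ H) = w := one_smul _ w
    rw [← Finset.add_sum_erase _ _ (Finset.mem_univ ((1 : G) : G ⧸ H)), h1, add_sub_cancel_left]
    refine sum_mem fun x hx => ?_
    induction x using QuotientGroup.induction_on with
    | H x =>
      refine hp x fun hxH => (Finset.mem_erase.mp hx).1 ?_
      rw [QuotientGroup.eq]
      simpa using hxH
  · refine sum_mem fun x _ => ?_
    induction x using QuotientGroup.induction_on with
    | H x => exact hq x

/-- The ring of invariants of a finite group acting on a finitely generated algebra over a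
Noetherian ring is finitely generated. -/
theorem finiteType_of_isInvariant {k R S G : Type*} [CommRing k] [IsNoetherianRing k] [CommRing R]
    [CommRing S] [Algebra k R] [Algebra k S] [Algebra R S] [IsScalarTower k R S]
    [Algebra.FiniteType k S] [Group G] [Finite G] [MulSemiringAction G S]
    [Algebra.IsInvariant R S G] (hi : Function.Injective (algebraMap R S)) :
    Algebra.FiniteType k R := by
  have : Algebra.IsIntegral R S := Algebra.IsInvariant.isIntegral R S G
  have : Algebra.FiniteType R S := Algebra.FiniteType.of_restrictScalars_finiteType k R S
  have : Module.Finite R S := Algebra.IsIntegral.finite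
  exact ⟨fg_of_fg_of_fg k R S Algebra.FiniteType.out Module.Finite.fg_top hi⟩

/-! ### Tensor powers and symmetric tensors -/

section TensorPowers

variable (k : Type u) [CommRing k] (ι : Type) (B : Type u) [CommRing B] [Algebra k B]

/-- The tensor power `B^{⊗ ι}` of a `k`-algebra, indexed by the type `ι`. -/
abbrev TPow : Type u := ⨂[k] _ : ι, B

variable {ι B}

/-- A bijection of the index sets induces an isomorphism of the tensor powers:
it moves the factor at `i` to the factor at `e i`. -/
def TPow.reindex {κ : Type} (e : ι ≃ κ) : TPow k ι B →ₐ[k] TPow k κ B :=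
  PiTensorProduct.liftAlgHom
    ((PiTensorProduct.tprod k).domDomCongr e.symm : MultilinearMap k (fun _ : ι => B) (TPow k κ B))
    rfl (fun x y => (PiTensorProduct.tprod_mul_tprod (R := k) (fun i => x (e.symm i))
      (fun i => y (e.symm i))).symm)

theorem TPow.reindex_tprod {κ : Type} (e : ι ≃ κ) (f : ι → B) :
    TPow.reindex k e (PiTensorProduct.tprod k f) = PiTensorProduct.tprod k (fun i => f (e.symm i)) :=
  PiTensorProduct.lift.tprod (φ := ((PiTensorProduct.tprod k).domDomCongr e.symm :
    MultilinearMap k (fun _ : ι => B) (TPow k κ B))) f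

theorem TPow.ext_linear {M : Type*} [AddCommGroup M] [Module k M] {f g : TPow k ι B →ₗ[k] M}
    (h : ∀ x, f (PiTensorProduct.tprod k x) = g (PiTensorProduct.tprod k x)) (x) : f x = g x :=
  DFunLike.congr_fun (PiTensorProduct.ext (MultilinearMap.ext h)) x

/-- The symmetric group permutes the factors of a tensor power. -/
instance TPow.instAction : MulSemiringAction (Equiv.Perm ι) (TPow k ι B) where
  smul σ x := TPow.reindex k σ x
  one_smul x := TPow.ext_linear k (f := (TPow.reindex k (1 : Equiv.Perm ι)).toLinearMap)
    (g := LinearMap.id) (fun x => TPow.reindex_tprod k _ x) x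
  mul_smul σ τ x := TPow.ext_linear k (f := (TPow.reindex k (σ * τ)).toLinearMap)
    (g := (TPow.reindex k σ).toLinearMap ∘ₗ (TPow.reindex k τ).toLinearMap) (fun x => by
      simp [TPow.reindex_tprod, Equiv.Perm.mul_def]) x
  smul_zero σ := map_zero (TPow.reindex k σ)
  smul_add σ := map_add (TPow.reindex k σ)
  smul_one σ := map_one (TPow.reindex k σ)
  smul_mul σ := map_mul (TPow.reindex k σ)

theorem TPow.smul_tprod (σ : Equiv.Perm ι) (f : ι → B) :
    σ • (PiTensorProduct.tprod k f : TPow k ι B) = PiTensorProduct.tprod k (fun i => f (σ.symm i)) :=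
  TPow.reindex_tprod k σ f

instance : SMulCommClass (Equiv.Perm ι) k (TPow k ι B) where
  smul_comm σ c x := map_smul (TPow.reindex k σ) c x

variable (ι B) in
/-- The algebra of symmetric tensors: the invariants of the symmetric group in the tensor power. -/
abbrev SymTensor : Subalgebra k (TPow k ι B) :=
  FixedPoints.subalgebra k (TPow k ι B) (Equiv.Perm ι)

instance : Algebra.IsInvariant (SymTensor k ι B) (TPow k ι B) (Equiv.Perm ι) where
  isInvariant x hx := ⟨⟨x, hx⟩, rfl⟩

/-- The algebra map of tensor powers induced by an algebra map. -/
def TPow.map {C : Type u} [CommRing C] [Algebra k C] (f : B →ₐ[k] C) : TPow k ι B →ₐ[k] TPow k ι C :=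
  PiTensorProduct.liftAlgHom
    ((PiTensorProduct.tprod k).compLinearMap fun _ => f.toLinearMap)
    (by simp only [MultilinearMap.compLinearMap_apply, PiTensorProduct.one_def]; congr 1; ext; simp)
    (fun x y => by
      simp only [MultilinearMap.compLinearMap_apply, PiTensorProduct.tprod_mul_tprod]
      congr 1; ext; simp)

theorem TPow.map_tprod {C : Type u} [CommRing C] [Algebra k C] (f : B →ₐ[k] C) (x : ι → B) :
    TPow.map k f (PiTensorProduct.tprod k x) = PiTensorProduct.tprod k (fun i => f (x i)) :=
  PiTensorProduct.lift.tprod (φ := (PiTensorProduct.tprod k).compLinearMap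
    fun _ : ι => f.toLinearMap) x

theorem TPow.tprod_eq_prod [Fintype ι] [DecidableEq ι] (x : ι → B) :
    (PiTensorProduct.tprod k x : TPow k ι B) =
      ∏ i, PiTensorProduct.singleAlgHom (R := k) (A := fun _ : ι => B) i (x i) := by
  simp only [PiTensorProduct.singleAlgHom_apply, ← PiTensorProduct.tprod_prod,
    MonoidHom.mulSingle_apply, Finset.univ_prod_mulSingle]

theorem TPow.smul_single [DecidableEq ι] (σ : Equiv.Perm ι) (i : ι) (b : B) :
    σ • (PiTensorProduct.singleAlgHom (R := k) (A := fun _ : ι => B) i b) =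
      PiTensorProduct.singleAlgHom (R := k) (A := fun _ : ι => B) (σ i) b := by
  simp only [PiTensorProduct.singleAlgHom_apply, TPow.smul_tprod]
  congr 1
  ext j
  simp only [MonoidHom.mulSingle_apply, Pi.mulSingle_apply, Equiv.symm_apply_eq]

theorem TPow.induction_mul [Fintype ι] [DecidableEq ι] {p : TPow k ι B → Prop}
    (single : ∀ i b, p (PiTensorProduct.singleAlgHom (R := k) (A := fun _ : ι => B) i b))
    (algebraMap : ∀ c, p (algebraMap k _ c))
    (add : ∀ x y, p x → p y → p (x + y)) (mul : ∀ x y, p x → p y → p (x * y)) (x) : p x := by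
  induction x using PiTensorProduct.induction_on with
  | smul_tprod r f =>
    rw [Algebra.smul_def, TPow.tprod_eq_prod]
    refine mul _ _ (algebraMap r) (Finset.prod_induction _ p mul ?_ fun i _ => single i _)
    simpa using algebraMap 1
  | add x y hx hy => exact add _ _ hx hy

instance [Finite ι] [Algebra.FiniteType k B] : Algebra.FiniteType k (TPow k ι B) := by
  classical
  have := Fintype.ofFinite ι
  obtain ⟨s, hs⟩ := (inferInstance : Algebra.FiniteType k B).out
  refine ⟨Finset.univ.biUnion fun i => s.image
    (PiTensorProduct.singleAlgHom (R := k) (A := fun _ : ι => B) i), ?_⟩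
  rw [eq_top_iff]
  rintro x -
  induction x using TPow.induction_mul with
  | single i b =>
    have hb : b ∈ Algebra.adjoin k (s : Set B) := hs ▸ Algebra.mem_top
    have := (Subalgebra.mem_map
      (f := PiTensorProduct.singleAlgHom (R := k) (A := fun _ : ι => B) i)).mpr ⟨b, hb, rfl⟩
    rw [AlgHom.map_adjoin] at this
    refine Algebra.adjoin_mono ?_ this
    rintro _ ⟨y, hy, rfl⟩
    simp only [Finset.coe_biUnion, Set.mem_iUnion]
    exact ⟨i, by simp, by simpa using ⟨y, hy, rfl⟩⟩
  | algebraMap c => exact Subalgebra.algebraMap_mem _ c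
  | add x y hx hy => exact add_mem hx hy
  | mul x y hx hy => exact mul_mem hx hy

instance [IsNoetherianRing k] [Finite ι] [Algebra.FiniteType k B] :
    Algebra.FiniteType k (SymTensor k ι B) :=
  finiteType_of_isInvariant (S := TPow k ι B) (G := Equiv.Perm ι) Subtype.val_injective

theorem TPow.map_smul {C : Type u} [CommRing C] [Algebra k C] (f : B →ₐ[k] C)
    (σ : Equiv.Perm ι) (x : TPow k ι B) : TPow.map k f (σ • x) = σ • TPow.map k f x :=
  TPow.ext_linear k (f := (TPow.map k f).toLinearMap ∘ₗ (TPow.reindex k σ).toLinearMap)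
    (g := (TPow.reindex k σ).toLinearMap ∘ₗ (TPow.map k f).toLinearMap)
    (fun x => by simp [TPow.reindex_tprod, TPow.map_tprod]) x

end TensorPowers

/-- Over a field, a surjection of algebras has a linear section, whose tensor power is equivariant;
so symmetric tensors lift to symmetric tensors. -/
theorem SymTensor.exists_map_eq {k : Type u} [Field k] {ι : Type} {B C : Type u} [CommRing B]
    [CommRing C] [Algebra k B] [Algebra k C] (f : B →ₐ[k] C) (hf : Function.Surjective f)
    {y : TPow k ι C} (hy : y ∈ SymTensor k ι C) : ∃ x ∈ SymTensor k ι B, TPow.map k f x = y := by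
  obtain ⟨s, hs⟩ := f.toLinearMap.exists_rightInverse_of_surjective (LinearMap.range_eq_top.mpr hf)
  have hs' (c : C) : f (s c) = c := DFunLike.congr_fun hs c
  refine ⟨PiTensorProduct.map (fun _ => s) y, fun σ => ?_, ?_⟩
  · conv_rhs => rw [← hy σ]
    exact TPow.ext_linear k
      (f := (TPow.reindex k σ).toLinearMap ∘ₗ PiTensorProduct.map (fun _ => s))
      (g := PiTensorProduct.map (fun _ => s) ∘ₗ (TPow.reindex k σ).toLinearMap)
      (fun x => by simp [TPow.reindex_tprod]) y
  · exact TPow.ext_linear k (f := (TPow.map k f).toLinearMap ∘ₗ PiTensorProduct.map (fun _ => s))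
      (g := LinearMap.id) (fun x => by simp [TPow.map_tprod, hs']) y

theorem ringKrullDim_symTensor_le {k : Type u} [Field k] {B : Type u} [CommRing B] [Algebra k B]
    [Algebra.FiniteType k B] [Nontrivial B] {d : ℕ} (hd : ringKrullDim B ≤ d) (n : ℕ) :
    ringKrullDim (SymTensor k (Fin n) B) ≤ (n * d : ℕ) := by
  obtain ⟨s, f, hf, hf'⟩ := exists_integral_inj_algHom_of_fg k B
  have h1 := (ringKrullDim_ge_of_isIntegral' f.toRingHom hf' hf).trans hd
  simp only [MvPolynomial.ringKrullDim_of_isNoetherianRing, ringKrullDim_eq_zero_of_field,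
    zero_add, Nat.card_fin] at h1
  have : Algebra.IsIntegral (SymTensor k (Fin n) B) (TPow k (Fin n) B) :=
    Algebra.IsInvariant.isIntegral _ _ (Equiv.Perm (Fin n))
  refine (ringKrullDim_ge_of_isIntegral' (algebraMap (SymTensor k (Fin n) B) (TPow k (Fin n) B))
    (algebraMap_isIntegral_iff.mpr this) Subtype.val_injective).trans ?_
  let h : MvPolynomial (Fin n × Fin s) k →ₐ[k] TPow k (Fin n) B :=
    MvPolynomial.aeval fun i => PiTensorProduct.singleAlgHom (R := k) (A := fun _ => B) i.1 (f (.X i.2))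
  have hl (i : Fin n) : h.comp (MvPolynomial.rename (fun j => (i, j))) =
      (PiTensorProduct.singleAlgHom (R := k) (A := fun _ => B) i).comp f := by
    ext j
    simp [h]
  have hh : h.toRingHom.IsIntegral := by
    intro x
    induction x using TPow.induction_mul with
    | single i b => 
      exact isIntegralElem_of_comp f.toRingHom (MvPolynomial.rename (fun j => (i, j))).toRingHom
          (PiTensorProduct.singleAlgHom (R := k) (A := fun _ => B) i).toRingHom h.toRingHom
          (RingHom.ext fun z => DFunLike.congr_fun (hl i) z) (hf' b)
    | algebraMap c =>
      rw [← AlgHom.commutes h]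
      exact RingHom.isIntegralElem_map _
    | add x y hx hy => exact RingHom.IsIntegralElem.add _ hx hy
    | mul x y hx hy => exact RingHom.IsIntegralElem.mul _ hx hy
  refine (ringKrullDim_le_of_isIntegral' _ hh).trans ?_
  simp only [MvPolynomial.ringKrullDim_of_isNoetherianRing, ringKrullDim_eq_zero_of_field,
    zero_add, Nat.card_eq_fintype_card, Fintype.card_prod, Fintype.card_fin] 
  norm_cast at h1 ⊢
  exact Nat.mul_le_mul_left n h1

/-! ### Symmetric tensors over a product of algebras -/

/-- Invariants commute with tensor products over a field. -/
theorem mem_range_rTensor_of_forall_eq {k V W : Type*} [Field k] [AddCommGroup V] [Module k V]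
    [AddCommGroup W] [Module k W] (Φ : Set (V →ₗ[k] V)) (V' : Submodule k V)
    (hV : ∀ v, (∀ φ ∈ Φ, φ v = v) → v ∈ V') {x : V ⊗[k] W} (hx : ∀ φ ∈ Φ, φ.rTensor W x = x) :
    x ∈ (V'.subtype.rTensor W).range := by
  classical
  let 𝒞 := Module.Basis.ofVectorSpace k W
  let e := TensorProduct.equivFinsuppOfBasisRight (M := V) 𝒞
  have he (φ : V →ₗ[k] V) (y) : e (φ.rTensor W y) = Finsupp.mapRange φ (map_zero φ) (e y) := by
    induction y with
    | zero => simp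
    | add y z hy hz => 
      rw [map_add, map_add, hy, hz, map_add, Finsupp.mapRange_add (map_add φ)]
    | tmul v w =>
      ext i
      simp [e]
  have h1 (i) : e x i ∈ V' := hV _ fun φ hφ => by
    have := DFunLike.congr_fun (he φ x) i
    rw [hx φ hφ] at this
    simpa using this.symm
  rw [← e.symm_apply_apply x, TensorProduct.equivFinsuppOfBasisRight_symm_apply]
  exact Submodule.sum_mem _ fun i _ => ⟨(⟨_, h1 i⟩ : V') ⊗ₜ 𝒞 i, by simp⟩

/-- Over a field, an element of `V ⊗ W` invariant under operators on both factors comes from the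
tensor product of the invariants. -/
theorem mem_range_map_subtype_of_forall_eq {k V W : Type*} [Field k] [AddCommGroup V] [Module k V]
    [AddCommGroup W] [Module k W] (Φ : Set (V →ₗ[k] V)) (V' : Submodule k V)
    (hV : ∀ v, (∀ φ ∈ Φ, φ v = v) → v ∈ V') (Ψ : Set (W →ₗ[k] W)) (W' : Submodule k W)
    (hW : ∀ w, (∀ ψ ∈ Ψ, ψ w = w) → w ∈ W') {x : V ⊗[k] W} (hx : ∀ φ ∈ Φ, φ.rTensor W x = x)
    (hx' : ∀ ψ ∈ Ψ, ψ.lTensor V x = x) :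
    x ∈ (TensorProduct.map V'.subtype W'.subtype).range := by
  obtain ⟨y, rfl⟩ := mem_range_rTensor_of_forall_eq Φ V' hV hx
  have inj := Module.Flat.rTensor_preserves_injective_linearMap (M := W) V'.subtype
    V'.subtype_injective
  have hc (ψ : W →ₗ[k] W) (y : V' ⊗[k] W) : ψ.rTensor V' (TensorProduct.comm k V' W y) =
      TensorProduct.comm k V' W (ψ.lTensor V' y) := by
    rw [← LinearMap.comm_comp_lTensor_comp_comm_eq]
    simp
  have hy : TensorProduct.comm k V' W y ∈ (W'.subtype.rTensor V').range := by
    refine mem_range_rTensor_of_forall_eq Ψ W' hW fun ψ hψ => ?_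
    have : ψ.lTensor V' y = y := inj (by
      conv_rhs => rw [← hx' ψ hψ]
      rw [← LinearMap.comp_apply, ← LinearMap.comp_apply, LinearMap.rTensor_comp_lTensor,
        LinearMap.lTensor_comp_rTensor])
    rw [hc, this]
  obtain ⟨z, hz⟩ := hy
  refine ⟨(TensorProduct.comm k V' W').symm z, ?_⟩
  obtain ⟨z, rfl⟩ := (TensorProduct.comm k V' W').surjective z
  rw [LinearEquiv.symm_apply_apply]
  rw [← (TensorProduct.comm k V' W).symm_apply_eq] at hz
  rw [← hz]
  clear hz
  induction z with
  | zero => simp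
  | tmul v w => simp
  | add a b ha hb => simp only [map_add, ha, hb]

section Prod

variable {k : Type u} [Field k] {B C : Type u} [CommRing B] [CommRing C] [Algebra k B] [Algebra k C]
  {α β ι : Type}

variable (k B C) in
/-- The projection of `(B × C)^{⊗ ι}` to the factor `B^{⊗ α} ⊗ C^{⊗ β}`, where the index set `ι`
is split as `α ⊕ β`. -/
def TPow.split (e : α ⊕ β ≃ ι) : TPow k ι (B × C) →ₐ[k] TPow k α B ⊗[k] TPow k β C :=
  PiTensorProduct.liftAlgHom
    ((((PiTensorProduct.tprod k).compLinearMap fun _ : α => LinearMap.fst k B C).domCoprod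
      ((PiTensorProduct.tprod k).compLinearMap fun _ : β => LinearMap.snd k B C)).domDomCongr e)
    rfl (fun x y => by
      simp [MultilinearMap.domCoprod_apply, Algebra.TensorProduct.tmul_mul_tmul, Pi.mul_def])

theorem TPow.split_tprod (e : α ⊕ β ≃ ι) (f : ι → B × C) :
    TPow.split k B C e (PiTensorProduct.tprod k f) =
      PiTensorProduct.tprod k (fun a => (f (e (.inl a))).1) ⊗ₜ
        PiTensorProduct.tprod k (fun b => (f (e (.inr b))).2) :=
  PiTensorProduct.lift.tprod (φ := 
    ((((PiTensorProduct.tprod k).compLinearMap fun _ : α => LinearMap.fst k B C).domCoprod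
      ((PiTensorProduct.tprod k).compLinearMap fun _ : β => LinearMap.snd k B C)).domDomCongr e)) f

/-- Extension by zero from the factor `B^{⊗ α} ⊗ C^{⊗ β}` of `(B × C)^{⊗ ι}`. -/
def TPow.merge (e : α ⊕ β ≃ ι) : TPow k α B ⊗[k] TPow k β C →ₗ[k] TPow k ι (B × C) :=
  (TPow.reindex k e).toLinearMap ∘ₗ (PiTensorProduct.tmulEquiv k (B × C)).toLinearMap ∘ₗ
    TensorProduct.map (PiTensorProduct.map fun _ => LinearMap.inl k B C)
      (PiTensorProduct.map fun _ => LinearMap.inr k B C)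

theorem TPow.merge_tprod (e : α ⊕ β ≃ ι) (f : α → B) (g : β → C) :
    TPow.merge (k := k) e (PiTensorProduct.tprod k f ⊗ₜ PiTensorProduct.tprod k g) =
      PiTensorProduct.tprod k fun i => Sum.elim (fun a => (f a, 0)) (fun b => (0, g b)) (e.symm i) := by
  simp only [TPow.merge, LinearMap.comp_apply, TensorProduct.map_tmul, PiTensorProduct.map_tprod,
    LinearEquiv.coe_coe, PiTensorProduct.tmulEquiv_apply, AlgHom.toLinearMap_apply,
    TPow.reindex_tprod]
  rfl

theorem TPow.ext_tmul {M : Type*} [AddCommGroup M] [Module k M]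
    {F G : TPow k α B ⊗[k] TPow k β C →ₗ[k] M}
    (h : ∀ f g, F (PiTensorProduct.tprod k f ⊗ₜ PiTensorProduct.tprod k g) =
      G (PiTensorProduct.tprod k f ⊗ₜ PiTensorProduct.tprod k g)) (x) : F x = G x := by
  refine DFunLike.congr_fun (TensorProduct.ext ?_) x
  refine PiTensorProduct.ext (MultilinearMap.ext fun f => ?_)
  refine PiTensorProduct.ext (MultilinearMap.ext fun g => ?_)
  exact h f g

theorem TPow.split_merge (e : α ⊕ β ≃ ι) (x : TPow k α B ⊗[k] TPow k β C) :
    TPow.split k B C e (TPow.merge e x) = x :=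
  TPow.ext_tmul (F := (TPow.split k B C e).toLinearMap ∘ₗ TPow.merge e) (G := LinearMap.id)
    (fun f g => by simp [TPow.merge_tprod, TPow.split_tprod]) x

theorem TPow.split_merge_eq_zero {α' β' : Type} (e : α ⊕ β ≃ ι) (e' : α' ⊕ β' ≃ ι)
    (h : Set.range (e ∘ Sum.inl) ≠ Set.range (e' ∘ Sum.inl)) (x : TPow k α' B ⊗[k] TPow k β' C) :
    TPow.split k B C e (TPow.merge e' x) = 0 := by
  refine TPow.ext_tmul (F := (TPow.split k B C e).toLinearMap ∘ₗ TPow.merge e') (G := 0)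
    (fun f g => ?_) x
  simp only [LinearMap.comp_apply, AlgHom.toLinearMap_apply, TPow.merge_tprod, TPow.split_tprod,
    LinearMap.zero_apply]
  by_cases h1 : ∃ a b, e (.inl a) = e' (.inr b)
  · obtain ⟨a, b, hab⟩ := h1
    rw [(PiTensorProduct.tprod k).map_coord_zero a (by simp [hab]), TensorProduct.zero_tmul]
  by_cases h2 : ∃ a b, e (.inr b) = e' (.inl a)
  · obtain ⟨a, b, hab⟩ := h2
    rw [(PiTensorProduct.tprod k).map_coord_zero b (by simp [hab]), TensorProduct.tmul_zero]
  push Not at h1 h2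
  refine absurd (Set.Subset.antisymm ?_ ?_) h
  · rintro _ ⟨a, rfl⟩
    obtain ⟨a' | b', hx⟩ := e'.surjective (e (.inl a))
    · exact ⟨a', hx⟩
    · exact absurd hx.symm (h1 _ _)
  · rintro _ ⟨a', rfl⟩
    obtain ⟨a | b, hx⟩ := e.surjective (e' (.inl a'))
    · exact ⟨a, hx⟩
    · exact absurd hx (h2 _ _)

theorem TPow.merge_split (e : α ⊕ β ≃ ι) (x : TPow k ι (B × C)) :
    TPow.merge e (TPow.split k B C e x) = TPow.merge e 1 * x := by
  refine TPow.ext_linear k (f := TPow.merge e ∘ₗ (TPow.split k B C e).toLinearMap)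
    (g := LinearMap.mulLeft k (TPow.merge e 1)) (fun f => ?_) x
  simp only [LinearMap.comp_apply, AlgHom.toLinearMap_apply, TPow.merge_tprod, TPow.split_tprod,
    LinearMap.mulLeft_apply, Algebra.TensorProduct.one_def, PiTensorProduct.one_def,
    PiTensorProduct.tprod_mul_tprod]
  congr 1
  ext i
  all_goals
    obtain ⟨a | b, rfl⟩ := e.surjective i <;> simp

theorem TPow.smul_merge (σ : Equiv.Perm ι) (e : α ⊕ β ≃ ι) (x : TPow k α B ⊗[k] TPow k β C) :
    σ • TPow.merge e x = TPow.merge (e.trans σ) x :=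
  TPow.ext_tmul (F := (TPow.reindex k σ).toLinearMap ∘ₗ TPow.merge e) (G := TPow.merge (e.trans σ))
    (fun f g => by simp [TPow.merge_tprod, TPow.reindex_tprod]) x

/-- The inclusion of the tensor product of the algebras of symmetric tensors. -/
def SymTensor.tmulVal (k : Type u) [Field k] (α β : Type) (B C : Type u) [CommRing B] [CommRing C] [Algebra k B]
    [Algebra k C] : SymTensor k α B ⊗[k] SymTensor k β C →ₐ[k] TPow k α B ⊗[k] TPow k β C :=
  Algebra.TensorProduct.map (SymTensor k α B).val (SymTensor k β C).val

theorem SymTensor.tmulVal_injective :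
    Function.Injective (SymTensor.tmulVal k α β B C) :=
  TensorProduct.map_injective_of_flat_flat (SymTensor k α B).val.toLinearMap
    (SymTensor k β C).val.toLinearMap Subtype.val_injective Subtype.val_injective

theorem SymTensor.merge_eq_merge [Finite α] [Finite β] (e e' : α ⊕ β ≃ ι)
    (h : Set.range (e ∘ Sum.inl) = Set.range (e' ∘ Sum.inl))
    (y : SymTensor k α B ⊗[k] SymTensor k β C) :
    TPow.merge e (SymTensor.tmulVal k α β B C y) = TPow.merge e' (SymTensor.tmulVal k α β B C y) := by
  have hinl (a) : ∃ a', e (.inl a) = e' (.inl a') := by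
    obtain ⟨a', ha'⟩ := h.subset ⟨a, rfl⟩
    exact ⟨a', ha'.symm⟩
  obtain ⟨τ, hτ⟩ : ∃ τ : Equiv.Perm α × Equiv.Perm β,
      Equiv.Perm.sumCongrHom α β τ = e.trans e'.symm := by
    have : e.trans e'.symm ∈ (Equiv.Perm.sumCongrHom α β).range := by
      refine Equiv.Perm.mem_sumCongrHom_range_of_perm_mapsTo_inl (σ := e.trans e'.symm) ?_
      rintro _ ⟨a, rfl⟩
      obtain ⟨a', ha'⟩ := hinl a
      exact ⟨a', by simp [ha']⟩
    exact this
  induction y with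
  | zero => simp
  | add y z hy hz => simp only [map_add, hy, hz]
  | tmul y z =>
    have h1 := y.2 τ.1
    have h2 := z.2 τ.2
    have h3 : e = Equiv.trans (Equiv.Perm.sumCongr τ.1 τ.2) e' := by
      rw [show Equiv.Perm.sumCongr τ.1 τ.2 = e.trans e'.symm from hτ]
      ext; simp
    simp only [SymTensor.tmulVal, Algebra.TensorProduct.map_tmul, Subalgebra.coe_val]
    conv_rhs => rw [← h1, ← h2]
    rw [h3]
    have := TPow.ext_tmul
      (F := TPow.merge (k := k) (B := B) (C := C) (Equiv.trans (Equiv.Perm.sumCongr τ.1 τ.2) e'))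
      (G := TPow.merge e' ∘ₗ TensorProduct.map (TPow.reindex k τ.1).toLinearMap
        (TPow.reindex k τ.2).toLinearMap) (fun f g => ?_) ((y : TPow k α B) ⊗ₜ (z : TPow k β C))
    · exact this
    · simp only [LinearMap.comp_apply, TensorProduct.map_tmul, AlgHom.toLinearMap_apply,
        TPow.reindex_tprod, TPow.merge_tprod]
      congr 1
      ext i
      all_goals
        obtain ⟨a | b, rfl⟩ := e'.surjective i <;> simp [Equiv.Perm.sumCongr]

open scoped Pointwise in
/-- Every element of the factor `Sym B ⊗ Sym C` is the component of a symmetric tensor over `B × C`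
all of whose components of other shapes vanish. -/
theorem SymTensor.exists_split_eq [Finite ι] [Finite α] [Finite β] (e : α ⊕ β ≃ ι)
    (y : SymTensor k α B ⊗[k] SymTensor k β C) :
    ∃ x ∈ SymTensor k ι (B × C), TPow.split k B C e x = SymTensor.tmulVal k α β B C y ∧
      ∀ (α' β' : Type) (e' : α' ⊕ β' ≃ ι), Nat.card α' ≠ Nat.card α → TPow.split k B C e' x = 0 := by
  let R := Set.range (e ∘ Sum.inl)
  have hR (σ : Equiv.Perm ι) : Set.range (e.trans σ ∘ Sum.inl) = σ • R := by
    rw [← Set.image_smul, ← Set.range_comp]; rfl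
  -- symmetrize the extension by zero over the cosets of the stabilizer of the subset `α` of `ι`:
  -- the other translates have no component at `e`
  obtain ⟨x, hx, hx1, hx2⟩ := exists_invariant_sub_mem (G := Equiv.Perm ι)
    (MulAction.stabilizer (Equiv.Perm ι) R)
    (TPow.split k B C e).toAddMonoidHom.ker
    (w := TPow.merge e (SymTensor.tmulVal k α β B C y))
    (fun σ hσ => by
      rw [TPow.smul_merge]
      exact SymTensor.merge_eq_merge _ _ (by rw [hR]; exact hσ) _)
    (fun σ hσ => by
      rw [TPow.smul_merge]
      exact TPow.split_merge_eq_zero _ _ (fun h => hσ (by rw [hR] at h; exact h.symm)) _)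
  refine ⟨x, hx, ?_, fun α' β' e' h => ?_⟩
  · have : TPow.split k B C e (x - TPow.merge e (SymTensor.tmulVal k α β B C y)) = 0 := hx1
    rwa [map_sub, TPow.split_merge, sub_eq_zero] at this
  · refine hx2 (TPow.split k B C e').toAddMonoidHom.ker fun σ => ?_
    rw [TPow.smul_merge]
    refine TPow.split_merge_eq_zero _ _ (fun h' => h ?_) _
    rw [← Nat.card_range_of_injective (e'.injective.comp Sum.inl_injective), h',
      Nat.card_range_of_injective ((e.trans σ).injective.comp Sum.inl_injective)]

/-- The component of a symmetric tensor in `B^{⊗ α} ⊗ C^{⊗ β}` is invariant under the permutations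
of `α` and of `β`. -/
theorem SymTensor.split_mem_range (e : α ⊕ β ≃ ι) {x : TPow k ι (B × C)}
    (hx : x ∈ SymTensor k ι (B × C)) : TPow.split k B C e x ∈ (SymTensor.tmulVal k α β B C).range := by
  have key (τ : Equiv.Perm α) (τ' : Equiv.Perm β) :
      TensorProduct.map (TPow.reindex k τ).toLinearMap (TPow.reindex k τ').toLinearMap
        (TPow.split k B C e x) = TPow.split k B C e x := by
    conv_rhs => rw [← hx (e.symm.trans ((Equiv.Perm.sumCongr τ τ').trans e))]
    refine TPow.ext_linear k (f := TensorProduct.map (TPow.reindex k τ).toLinearMap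
      (TPow.reindex k τ').toLinearMap ∘ₗ (TPow.split k B C e).toLinearMap)
      (g := (TPow.split k B C e).toLinearMap ∘ₗ
        (TPow.reindex k (e.symm.trans ((Equiv.Perm.sumCongr τ τ').trans e))).toLinearMap)
      (fun f => ?_) x
    simp [TPow.split_tprod, TPow.reindex_tprod, Equiv.Perm.sumCongr]
  have h1 : (TPow.reindex k (1 : Equiv.Perm α) : TPow k α B →ₐ[k] TPow k α B).toLinearMap =
      LinearMap.id := LinearMap.ext (one_smul (Equiv.Perm α))
  have h2 : (TPow.reindex k (1 : Equiv.Perm β) : TPow k β C →ₐ[k] TPow k β C).toLinearMap =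
      LinearMap.id := LinearMap.ext (one_smul (Equiv.Perm β))
  obtain ⟨y, hy⟩ := mem_range_map_subtype_of_forall_eq (x := TPow.split k B C e x)
    (Set.range fun τ : Equiv.Perm α => (TPow.reindex k τ : TPow k α B →ₐ[k] TPow k α B).toLinearMap)
    (Subalgebra.toSubmodule (SymTensor k α B)) (fun v hv τ => hv _ ⟨τ, rfl⟩)
    (Set.range fun τ : Equiv.Perm β => (TPow.reindex k τ : TPow k β C →ₐ[k] TPow k β C).toLinearMap)
    (Subalgebra.toSubmodule (SymTensor k β C)) (fun v hv τ => hv _ ⟨τ, rfl⟩)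
    (by
      rintro _ ⟨τ, rfl⟩
      have := key τ 1
      rwa [h2] at this)
    (by
      rintro _ ⟨τ, rfl⟩
      have := key 1 τ
      rwa [h1] at this)
  exact ⟨y, hy⟩

/-- The symmetric group permutes transitively the components `B^{⊗ α} ⊗ C^{⊗ β}` with given
cardinalities of `α` and `β`, so a symmetric tensor over `B × C` is determined by one component for
each pair of cardinalities. -/
theorem SymTensor.eq_zero_of_split {n : ℕ} {x : TPow k (Fin n) (B × C)}
    (hx : x ∈ SymTensor k (Fin n) (B × C))
    (h : ∀ (i j : ℕ), i + j = n → ∃ e : Fin i ⊕ Fin j ≃ Fin n, TPow.split k B C e x = 0) : x = 0 := by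
  classical
  have h1 : (1 : TPow k (Fin n) (B × C)) = ∑ s : Finset (Fin n),
      PiTensorProduct.tprod k (s.piecewise (fun _ => ((1, 0) : B × C)) (fun _ => (0, 1))) := by
    rw [← MultilinearMap.map_add_univ, PiTensorProduct.one_def]
    congr 1
    ext <;> simp
  rw [← one_mul x, h1, Finset.sum_mul]
  refine Finset.sum_eq_zero fun s _ => ?_
  obtain ⟨e, he⟩ := h s.card sᶜ.card (by rw [Finset.card_add_card_compl, Fintype.card_fin])
  let e' : Fin s.card ⊕ Fin sᶜ.card ≃ Fin n :=
    (Equiv.sumCongr s.equivFin.symm (sᶜ.equivFin.symm.trans (Equiv.subtypeEquivRight (by simp)))).trans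
      (Equiv.sumCompl (· ∈ s))
  have h2 : TPow.merge (k := k) (B := B) (C := C) e' 1 =
      PiTensorProduct.tprod k (s.piecewise (fun _ => ((1, 0) : B × C)) (fun _ => (0, 1))) := by
    rw [Algebra.TensorProduct.one_def, PiTensorProduct.one_def, PiTensorProduct.one_def,
      TPow.merge_tprod]
    congr 1
    ext i
    all_goals
      obtain ⟨a | b, rfl⟩ := e'.surjective i
      · have : e' (.inl a) ∈ s := (s.equivFin.symm a).2
        simp [this]
      · have : e' (.inr b) ∉ s := Finset.mem_compl.mp (sᶜ.equivFin.symm b).2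
        simp [this]
  have h3 := TPow.smul_merge (k := k) (B := B) (C := C) (e.symm.trans e') e 1
  rw [show e.trans (e.symm.trans e') = e' by ext; simp, h2] at h3
  have h4 := TPow.merge_split e x
  rw [he, map_zero] at h4
  rw [← h3]
  conv_lhs => rw [← hx (e.symm.trans e')]
  rw [← smul_mul', ← h4, smul_zero]

/-- The decomposition `TSⁿ(B × C) = ∏_{i + j = n} TSⁱ(B) ⊗ TSʲ(C)`. -/
theorem SymTensor.nonempty_algEquiv_prod (k : Type u) [Field k] (B C : Type u) [CommRing B]
    [CommRing C] [Algebra k B] [Algebra k C] (n : ℕ) :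
    Nonempty (SymTensor k (Fin n) (B × C) ≃ₐ[k]
      ∀ p : Finset.HasAntidiagonal.antidiagonal n, SymTensor k (Fin p.1.1) B ⊗[k] SymTensor k (Fin p.1.2) C) := by
  let e (p : Finset.HasAntidiagonal.antidiagonal n) : Fin p.1.1 ⊕ Fin p.1.2 ≃ Fin n :=
    finSumFinEquiv.trans (finCongr (Finset.HasAntidiagonal.mem_antidiagonal.mp p.2))
  let ε (p : Finset.HasAntidiagonal.antidiagonal n) := AlgEquiv.ofInjective (SymTensor.tmulVal k
    (Fin p.1.1) (Fin p.1.2) B C) SymTensor.tmulVal_injective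
  let φ (p : Finset.HasAntidiagonal.antidiagonal n) : SymTensor k (Fin n) (B × C) →ₐ[k]
      SymTensor k (Fin p.1.1) B ⊗[k] SymTensor k (Fin p.1.2) C :=
    (ε p).symm.toAlgHom.comp (((TPow.split k B C (e p)).comp (SymTensor k (Fin n) (B × C)).val).codRestrict _
      fun x => SymTensor.split_mem_range (e p) x.2)
  have hφ (p x) : SymTensor.tmulVal k _ _ B C (φ p x) = TPow.split k B C (e p) x := by
    exact congrArg Subtype.val ((ε p).apply_symm_apply ⟨_, SymTensor.split_mem_range (e p) x.2⟩)
  refine ⟨AlgEquiv.ofBijective (AlgHom.pi φ) ⟨?_, fun y => ?_⟩⟩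
  · rw [injective_iff_map_eq_zero]
    intro x hx
    refine Subtype.ext (SymTensor.eq_zero_of_split x.2 fun i j hij =>
      ⟨e ⟨(i, j), Finset.HasAntidiagonal.mem_antidiagonal.mpr hij⟩, ?_⟩)
    rw [← hφ]
    have : φ ⟨(i, j), Finset.HasAntidiagonal.mem_antidiagonal.mpr hij⟩ x = 0 := congrFun hx _
    rw [this, map_zero]
  · choose x hx hx1 hx2 using fun p => SymTensor.exists_split_eq (e p) (y p)
    refine ⟨∑ p, ⟨x p, hx p⟩, funext fun p => SymTensor.tmulVal_injective ?_⟩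
    refine (hφ p _).trans ?_
    rw [← Subalgebra.coe_val, map_sum, map_sum, Finset.sum_eq_single p]
    · exact hx1 p
    · intro q _ hq
      refine hx2 q _ _ (e p) fun h => hq (Subtype.ext (Prod.ext ?_ ?_))
      · simpa using h.symm
      · have h1 := Finset.HasAntidiagonal.mem_antidiagonal.mp p.2
        have h2 := Finset.HasAntidiagonal.mem_antidiagonal.mp q.2
        simp only [Nat.card_eq_fintype_card, Fintype.card_fin] at h
        omega
    · simp

end Prod

/-! ### Classes in the Grothendieck ring -/

section Classes

variable {k : Type u} [Field k]

instance (X : FTScheme k) : IsLocallyNoetherian X.obj.left :=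
  LocallyOfFiniteType.isLocallyNoetherian X.obj.hom

instance (X : FTScheme k) : CompactSpace X.obj.left :=
  QuasiCompact.compactSpace_of_compactSpace X.obj.hom

instance (X : FTScheme k) : IsNoetherian X.obj.left where

/-- The `k`-scheme of finite type defined by a morphism of finite type to another one. -/
abbrev FTScheme.sub (X : FTScheme k) {Z : Scheme.{u}} (f : Z ⟶ X.obj.left) [LocallyOfFiniteType f]
    [QuasiCompact f] : FTScheme k where
  obj := Over.mk (f ≫ X.obj.hom)
  lft := by dsimp; infer_instance
  qc := by dsimp; infer_instance

/-- The structure morphism of a subscheme. -/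
def FTScheme.subι (X : FTScheme k) {Z : Scheme.{u}} (f : Z ⟶ X.obj.left) [LocallyOfFiniteType f]
    [QuasiCompact f] : (X.sub f).obj ⟶ X.obj := Over.homMk f

instance (X : FTScheme k) {Z : Scheme.{u}} (f : Z ⟶ X.obj.left) [IsOpenImmersion f] :
    IsOpenImmersion (X.subι f).left := ‹IsOpenImmersion f›

instance (X : FTScheme k) {Z : Scheme.{u}} (f : Z ⟶ X.obj.left) [IsClosedImmersion f] :
    IsClosedImmersion (X.subι f).left := ‹IsClosedImmersion f›

theorem cls_eq_of_iso {X Y : FTScheme k} (e : X.obj ≅ Y.obj) : cls X = cls Y :=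
  congrArg (fun x => Ideal.Quotient.mk (Ideal.span (scissor k)) (FreeAbelianGroup.of x))
    (Quotient.sound ⟨e⟩ : (Quotient.mk _ X : IsoClass k) = Quotient.mk _ Y)

theorem cls_eq_add {X U Y : FTScheme k} (i : Y.obj ⟶ X.obj) (j : U.obj ⟶ X.obj)
    [IsClosedImmersion i.left] [IsOpenImmersion j.left]
    (h : Set.range j.left = (Set.range i.left)ᶜ) : cls X = cls U + cls Y := by
  have : cls X - cls U - cls Y = 0 := by
    simp only [cls]
    exact Ideal.Quotient.eq_zero_iff_mem.mpr
      (Ideal.subset_span ⟨X, U, Y, i, j, inferInstance, inferInstance, h, rfl⟩)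
  linear_combination this

theorem cls_eq_zero (X : FTScheme k) [IsEmpty X.obj.left] : cls X = 0 := by
  have := cls_eq_add (𝟙 X.obj) (𝟙 X.obj) (X := X) (Subsingleton.elim _ _)
  linear_combination -this

theorem cls_eq_of_surjective {X Y : FTScheme k} (i : Y.obj ⟶ X.obj) [IsClosedImmersion i.left]
    [Surjective i.left] : cls Y = cls X := by
  have : IsEmpty (X.sub (⊥ : X.obj.left.Opens).ι).obj.left :=
    ⟨fun x => ((show (⊥ : X.obj.left.Opens) from x).2 : False)⟩
  rw [cls_eq_add i (X.subι (⊥ : X.obj.left.Opens).ι), cls_eq_zero (X.sub (⊥ : X.obj.left.Opens).ι),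
    zero_add]
  rw [i.left.surjective.range_eq, Set.compl_univ]
  exact (Scheme.Opens.range_ι _).trans rfl

instance isReduced_vanishingIdeal {X : Scheme.{u}} (Z : TopologicalSpace.Closeds X) :
    IsReduced (Scheme.IdealSheafData.vanishingIdeal Z).subscheme := by
  let 𝒰 := (Scheme.IdealSheafData.vanishingIdeal Z).subschemeCover
  have (i : 𝒰.I₀) : IsReduced (𝒰.openCover.X i) := by
    have : _root_.IsReduced (𝒰.X i) := by
      refine (Ideal.isRadical_iff_quotient_reduced _).mp ?_
      exact PrimeSpectrum.isRadical_vanishingIdeal _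
    exact inferInstanceAs (IsReduced (Spec (𝒰.X i)))
  exact @IsReduced.of_openCover _ 𝒰.openCover this

/-- A closed subset with its reduced scheme structure. -/
abbrev FTScheme.red (X : FTScheme k) (Z : TopologicalSpace.Closeds X.obj.left) : FTScheme k :=
  X.sub (Scheme.IdealSheafData.vanishingIdeal Z).subschemeι

/-- The inclusion of a closed subset with its reduced scheme structure. -/
abbrev FTScheme.redι (X : FTScheme k) (Z : TopologicalSpace.Closeds X.obj.left) :
    (X.red Z).obj ⟶ X.obj := X.subι (Scheme.IdealSheafData.vanishingIdeal Z).subschemeι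

instance (X : FTScheme k) (Z : TopologicalSpace.Closeds X.obj.left) : IsReduced (X.red Z).obj.left :=
  isReduced_vanishingIdeal Z

theorem FTScheme.range_redι (X : FTScheme k) (Z : TopologicalSpace.Closeds X.obj.left) :
    Set.range (X.redι Z).left = Z := by
  exact (Scheme.IdealSheafData.range_subschemeι _).trans (by simp)

theorem FTScheme.cls_eq_add (X : FTScheme k) (U : X.obj.left.Opens) :
    cls X = cls (X.sub U.ι) + cls (X.red (U.compl)) :=
  Motivic.cls_eq_add (X.redι U.compl) (X.subι U.ι) (by
    rw [X.range_redι]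
    exact (Scheme.Opens.range_ι _).trans (by simp))

/-- Noetherian induction for schemes of finite type. -/
theorem FTScheme.induction {p : FTScheme k → Prop}
    (red : ∀ X, p (X.red ⊤) → p X)
    (closed : ∀ X : FTScheme k, IsReduced X.obj.left →
      (∀ Z : TopologicalSpace.Closeds X.obj.left, Z ≠ ⊤ → p (X.red Z)) → p X) (X) : p X := by
  suffices H : ∀ (C : TopologicalSpace.Closeds X.obj.left) (Y : FTScheme k) (i : Y.obj ⟶ X.obj)
      [IsClosedImmersion i.left], Set.range i.left = C → p Y from
    @H ⊤ X (𝟙 X.obj) (inferInstanceAs (IsClosedImmersion (𝟙 X.obj.left))) (by simp)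
  intro C
  induction C using WellFoundedLT.induction with
  | ind C ih =>
    intro Y i _ hi
    refine red Y (closed _ inferInstance fun Z hZ => ?_)
    let i' := (Y.red ⊤).redι Z ≫ Y.redι ⊤ ≫ i
    have hc : IsClosedImmersion i'.left := by
      have h1 : IsClosedImmersion ((Y.redι ⊤).left ≫ i.left) := inferInstance
      have h2 : IsClosedImmersion (((Y.red ⊤).redι Z).left ≫ (Y.redι ⊤).left ≫ i.left) :=
        inferInstance
      exact h2
    refine ih ⟨Set.range i'.left, i'.left.isClosedEmbedding.isClosed_range⟩ ?_ _ i' rfl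
    have hr : Set.range i'.left = i.left '' ((Y.redι ⊤).left '' Z) := by
      rw [← FTScheme.range_redι, ← Set.range_comp, ← Set.range_comp]
      rfl
    have hle : Set.range i'.left ⊆ C := by
      rw [hr, ← hi]; exact Set.image_subset_range _ _
    refine lt_of_le_of_ne hle fun heq => hZ ?_
    have h2 : i.left '' ((Y.redι ⊤).left '' Z) = i.left '' ((Y.redι ⊤).left '' Set.univ) := by
      rw [← hr, show Set.range i'.left = C from congrArg SetLike.coe heq, ← hi, Set.image_univ (f := (Y.redι ⊤).left),
        FTScheme.range_redι]
      simp
    exact SetLike.coe_injective ((Y.redι ⊤).left.isClosedEmbedding.injective.image_injective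
      (i.left.isClosedEmbedding.injective.image_injective h2))

end Classes

/-! ### Morphisms which are bijective on points with values in fields -/

/-- A morphism which is bijective on `K`-points for all fields `K`; equivalently, it is bijective and
induces isomorphisms of the residue fields. -/
def FieldBijective {P Q : Scheme.{u}} (f : P ⟶ Q) : Prop :=
  ∀ (K : Type u) [Field K], Function.Bijective fun x : Spec (.of K) ⟶ P => x ≫ f

namespace FieldBijective

variable {P Q R : Scheme.{u}} {f : P ⟶ Q} {g : Q ⟶ R}

theorem of_isPullback {P' Q' : Scheme.{u}} {p : P' ⟶ P} {f' : P' ⟶ Q'} {q : Q' ⟶ Q}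
    (h : IsPullback p f' f q) (hf : FieldBijective f) : FieldBijective f' := by
  refine fun K _ => ⟨fun x y hxy => h.hom_ext ((hf K).1 ?_) hxy, fun y => ?_⟩
  · simp only [Category.assoc, h.w]
    simp only at hxy
    rw [reassoc_of% hxy]
  · obtain ⟨x, hx⟩ := (hf K).2 (y ≫ q)
    exact ⟨h.lift x y hx, h.lift_snd _ _ _⟩

theorem bijective (hf : FieldBijective f) : Function.Bijective f := by
  refine ⟨?_, fun y => ?_⟩
  · have := ((tfae_universallyInjective f).out 0 1 :
      UniversallyInjective f ↔ ∀ (K : Type u) [Field K],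
        Function.Injective (fun g : Spec (.of K) ⟶ P ↦ g ≫ f)).mpr fun K _ => (hf K).1
    exact f.injective
  · obtain ⟨x, hx⟩ := (hf _).2 (Q.fromSpecResidueField y)
    refine ⟨x (IsLocalRing.closedPoint (Q.residueField y)), ?_⟩
    have h1 : (x ≫ f) (IsLocalRing.closedPoint (Q.residueField y)) = y := by
      rw [show x ≫ f = Q.fromSpecResidueField y from hx]
      exact Scheme.fromSpecResidueField_apply _ _
    exact h1

theorem isEmpty (_hf : FieldBijective f) [IsEmpty Q] : IsEmpty P :=
  Function.isEmpty f

theorem of_bijective (hf : Function.Bijective f)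
    (hf' : ∀ x, Function.Surjective (f.residueFieldMap x)) : FieldBijective f := by
  intro K _
  refine ⟨?_, fun y => ?_⟩
  · refine ((tfae_universallyInjective f).out 2 1 :
      (Function.Injective f ∧ ∀ x, (f.residueFieldMap x).hom.IsPurelyInseparable) ↔
        ∀ (K : Type u) [Field K], Function.Injective (fun g : Spec (.of K) ⟶ P ↦ g ≫ f)).mp
      ⟨hf.1, fun x => ?_⟩ K
    algebraize [(f.residueFieldMap x).hom]
    refine ⟨⟨fun y => ?_⟩, fun y _ => hf' x y⟩
    obtain ⟨z, rfl⟩ := hf' x y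
    exact isIntegral_algebraMap (x := z)
  · obtain ⟨⟨q, φ⟩, rfl⟩ := (Q.SpecToEquivOfField K).symm.surjective y
    obtain ⟨x, rfl⟩ := hf.2 q
    have : IsIso (f.residueFieldMap x) := by
      rw [ConcreteCategory.isIso_iff_bijective]
      exact ⟨(f.residueFieldMap x).hom.injective, hf' x⟩
    refine ⟨Spec.map (inv (f.residueFieldMap x) ≫ φ) ≫ P.fromSpecResidueField x, ?_⟩
    simp only [Category.assoc, ← Scheme.Hom.SpecMap_residueFieldMap_fromSpecResidueField,
      ← Spec.map_comp_assoc, IsIso.hom_inv_id_assoc]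
    rfl

/-- A field bijection to a scheme with an integral open subscheme has a section over a smaller
open subscheme. -/
theorem exists_section (hf : FieldBijective f) [LocallyOfFiniteType f] (W : Q.Opens)
    [IsIntegral W] : ∃ (V : Q.Opens) (σ : V.toScheme ⟶ P), Nonempty V ∧ σ ≫ f = V.ι := by
  obtain ⟨φ, hφ⟩ := (hf W.toScheme.functionField).2
    (W.toScheme.fromSpecStalk (genericPoint W) ≫ W.ι)
  obtain ⟨U, hU, σ, -, hσ⟩ := spread_out_of_isGermInjective' (S := Q) W.ι f φ hφ
  refine ⟨W.ι ''ᵁ U, (W.ι.isoImage U).inv ≫ σ, ⟨⟨_, ⟨_, hU, rfl⟩⟩⟩, ?_⟩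
  rw [Category.assoc, hσ, Scheme.Hom.isoImage_inv_ι]

end FieldBijective

section

variable {k : Type u} [Field k]

/-- The projection to `Y` from the fibre product over `X`. -/
def FTScheme.pullbackSnd {Z Y X : FTScheme k} (f : Z.obj ⟶ X.obj) (g : Y.obj ⟶ X.obj)
    [LocallyOfFiniteType g.left] [QuasiCompact g.left] :
    (Z.sub (pullback.fst f.left g.left)).obj ⟶ Y.obj :=
  Over.homMk (pullback.snd f.left g.left) (by
    change pullback.snd f.left g.left ≫ Y.obj.hom = pullback.fst f.left g.left ≫ Z.obj.hom
    rw [← Over.w f, ← Over.w g, pullback.condition_assoc])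

instance {X Y : FTScheme k} (f : X.obj ⟶ Y.obj) : LocallyOfFiniteType f.left := by
  have : LocallyOfFiniteType (f.left ≫ Y.obj.hom) := by rw [Over.w f]; infer_instance
  exact locallyOfFiniteType_of_comp f.left Y.obj.hom

/-- A field bijection induces an equality of classes: it has a section over a dense open subscheme
of (an irreducible component of) the target, which is a surjective closed immersion. -/
theorem FieldBijective.cls_eq {P Q : FTScheme k} (f : P.obj ⟶ Q.obj) (hf : FieldBijective f.left) :
    cls P = cls Q := by
  induction Q using FTScheme.induction generalizing P with
  | red Q ih =>
    have : LocallyOfFiniteType (pullback.fst f.left (Q.redι ⊤).left) := inferInstance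
    let i := P.subι (pullback.fst f.left (Q.redι ⊤).left)
    have hi : IsClosedImmersion i.left :=
      inferInstanceAs (IsClosedImmersion (pullback.fst f.left (Q.redι ⊤).left))
    have : Surjective (Q.redι ⊤).left := ⟨by
      rw [← Set.range_eq_univ, FTScheme.range_redι]; simp⟩
    have : Surjective i.left :=
      inferInstanceAs (Surjective (pullback.fst f.left (Q.redι ⊤).left))
    rw [← cls_eq_of_surjective i, ← cls_eq_of_surjective (Q.redι ⊤)]
    exact ih (FTScheme.pullbackSnd f (Q.redι ⊤)) (.of_isPullback (.of_hasPullback _ _) hf)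
  | closed Q hQ ih =>
    rcases isEmpty_or_nonempty Q.obj.left with h | ⟨⟨x⟩⟩
    · have := hf.isEmpty
      rw [cls_eq_zero, cls_eq_zero]
    have hZ := irreducibleComponent_mem_irreducibleComponents x
    let W := Scheme.irreducibleComponentOpen Q.obj.left (irreducibleComponent x)
    have hcl : closure (W : Set Q.obj.left) = irreducibleComponent x :=
      closure_sUnion_irreducibleComponents_sdiff_singleton
        TopologicalSpace.NoetherianSpace.finite_irreducibleComponents _ hZ
    have : IrreducibleSpace W := Subtype.irreducibleSpace (isIrreducible_iff_closure.mp
      (hcl ▸ isIrreducible_irreducibleComponent))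
    have : IsIntegral W.toScheme := isIntegral_of_irreducibleSpace_of_isReduced _
    -- the `K`-point of the target given by the generic point of `W` lifts to the source, and the
    -- lift spreads out to a section over an open subset
    obtain ⟨V, σ, ⟨⟨v, hv⟩⟩, hσ⟩ := hf.exists_section W
    have hVne : V.compl ≠ ⊤ := fun h => by
      have : v ∈ V.compl := h ▸ trivial
      exact this hv
    have hsep : IsSeparated f.left := isSeparated_of_injective _ hf.bijective.1
    have h1 : cls (P.sub (f.left ⁻¹ᵁ V).ι) = cls (Q.sub V.ι) := by
      have hσ' (y : V.toScheme) : f.left (σ y) = V.ι y := by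
        rw [← hσ]; rfl
      have hr : Set.range σ ⊆ Set.range (f.left ⁻¹ᵁ V).ι := by
        rw [Scheme.Opens.range_ι]
        rintro _ ⟨y, rfl⟩
        change f.left (σ y) ∈ V
        rw [hσ']
        exact y.2
      let τ := IsOpenImmersion.lift (f.left ⁻¹ᵁ V).ι σ hr
      have hτι : τ ≫ (f.left ⁻¹ᵁ V).ι = σ := IsOpenImmersion.lift_fac _ _ _
      have hτ : τ ≫ (f.left ∣_ V) = 𝟙 _ := by
        rw [← cancel_mono V.ι, Category.assoc, morphismRestrict_ι, reassoc_of% hτι, hσ,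
          Category.id_comp]
      have : IsClosedImmersion (τ ≫ (f.left ∣_ V)) := by rw [hτ]; infer_instance
      have : IsClosedImmersion τ := .of_comp τ (f.left ∣_ V)
      have : Surjective τ := ⟨fun y => by
        refine ⟨⟨f.left y.1, y.2⟩, Subtype.ext (hf.bijective.1 ?_)⟩
        have : (τ ≫ (f.left ⁻¹ᵁ V).ι) ⟨f.left y.1, y.2⟩ = σ ⟨f.left y.1, y.2⟩ := by rw [hτι]
        exact (congrArg f.left this).trans (hσ' _)⟩
      let τ' : (Q.sub V.ι).obj ⟶ (P.sub (f.left ⁻¹ᵁ V).ι).obj := Over.homMk τ (by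
        change τ ≫ (f.left ⁻¹ᵁ V).ι ≫ P.obj.hom = V.ι ≫ Q.obj.hom
        rw [reassoc_of% hτι, ← hσ, Category.assoc, Over.w f])
      have : IsClosedImmersion τ'.left := ‹IsClosedImmersion τ›
      have : Surjective τ'.left := ‹Surjective τ›
      exact (cls_eq_of_surjective τ').symm
    have h2 := ih _ hVne (FTScheme.pullbackSnd f (Q.redι V.compl))
      (.of_isPullback (.of_hasPullback _ _) hf)
    rw [Q.cls_eq_add V, ← h1, ← h2]
    have hi : IsClosedImmersion (P.subι (pullback.fst f.left (Q.redι V.compl).left)).left :=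
      inferInstanceAs (IsClosedImmersion (pullback.fst f.left (Q.redι V.compl).left))
    refine cls_eq_add (P.subι (pullback.fst f.left (Q.redι V.compl).left))
      (P.subι (f.left ⁻¹ᵁ V).ι) ?_
    have hr : Set.range (pullback.fst f.left (Q.redι V.compl).left) =
        f.left ⁻¹' (V : Set Q.obj.left)ᶜ := by
      rw [Scheme.Pullback.range_fst, FTScheme.range_redι]; simp
    exact (Scheme.Opens.range_ι _).trans 
      ((compl_compl (f.left ⁻¹' (V : Set Q.obj.left))).symm.trans (congrArg compl hr.symm))

end

/-! ### Points and sections -/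

section Vanishing

variable {Z Q : Scheme.{u}}

/-- The prime ideal of the sections over `U` which vanish at the point `z` of `U`. -/
def vanishingAt (U : Z.Opens) (z : Z) (hz : z ∈ U) : Ideal Γ(Z, U) :=
  RingHom.ker (Z.evaluation U z hz).hom

theorem mem_vanishingAt {U : Z.Opens} {z : Z} {hz : z ∈ U} {s : Γ(Z, U)} :
    s ∈ vanishingAt U z hz ↔ z ∉ Z.basicOpen s :=
  Z.evaluation_eq_zero_iff_notMem_basicOpen z hz s

instance (U : Z.Opens) (z : Z) (hz : z ∈ U) : (vanishingAt U z hz).IsPrime :=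
  RingHom.ker_isPrime _

theorem appLE_mem_vanishingAt {f : Z ⟶ Q} {V : Q.Opens} {U : Z.Opens} {h : U ≤ f ⁻¹ᵁ V} {z : Z}
    {hz : z ∈ U} {s : Γ(Q, V)} :
    f.appLE V U h s ∈ vanishingAt U z hz ↔ s ∈ vanishingAt V (f z) (h hz) := by
  refine mem_vanishingAt.trans (Iff.trans ?_ mem_vanishingAt.symm)
  rw [Scheme.basicOpen_appLE]
  exact not_congr ⟨fun h => h.2, fun h => ⟨hz, h⟩⟩

theorem app_mem_vanishingAt {f : Z ⟶ Q} {V : Q.Opens} {z : Z}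
    {hz : f z ∈ V} {s : Γ(Q, V)} :
    f.app V s ∈ vanishingAt (f ⁻¹ᵁ V) z hz ↔ s ∈ vanishingAt V (f z) hz := by
  rw [Scheme.Hom.app_eq_appLE]
  exact appLE_mem_vanishingAt

theorem _root_.AlgebraicGeometry.IsAffineOpen.eq_of_vanishingAt_eq {U : Z.Opens}
    (hU : IsAffineOpen U) {z z' : Z}
    {hz : z ∈ U} {hz' : z' ∈ U} (h : vanishingAt U z hz = vanishingAt U z' hz') : z = z' := by
  by_contra hne
  obtain ⟨W, hW, hx⟩ := exists_isOpen_xor_mem hne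
  rcases hx with ⟨h1, h2⟩ | ⟨h1, h2⟩
  · obtain ⟨f, hf, hzf⟩ := hU.exists_basicOpen_le (V := ⟨W, hW⟩) ⟨z, h1⟩ hz
    have : f ∈ vanishingAt U z' hz' := mem_vanishingAt.mpr fun h => h2 (hf h)
    rw [← h, mem_vanishingAt] at this
    exact this hzf
  · obtain ⟨f, hf, hzf⟩ := hU.exists_basicOpen_le (V := ⟨W, hW⟩) ⟨z', h1⟩ hz'
    have : f ∈ vanishingAt U z hz := mem_vanishingAt.mpr fun h => h2 (hf h)
    rw [h, mem_vanishingAt] at this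
    exact this hzf

theorem _root_.AlgebraicGeometry.IsAffineOpen.exists_vanishingAt_eq {U : Z.Opens}
    (hU : IsAffineOpen U) (p : Ideal Γ(Z, U)) [hp : p.IsPrime] :
    ∃ (z : Z) (hz : z ∈ U), vanishingAt U z hz = p := by
  have hz : hU.fromSpec ⟨p, hp⟩ ∈ U := by
    have := Set.mem_range_self (f := hU.fromSpec) ⟨p, hp⟩
    rwa [hU.range_fromSpec] at this
  refine ⟨hU.fromSpec ⟨p, hp⟩, hz, Ideal.ext fun s => ?_⟩
  rw [mem_vanishingAt]
  have : hU.fromSpec ⟨p, hp⟩ ∈ Z.basicOpen s ↔ (⟨p, hp⟩ : PrimeSpectrum _) ∈ PrimeSpectrum.basicOpen s := by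
    rw [← hU.fromSpec_preimage_basicOpen s]; rfl
  rw [this]
  exact not_not

end Vanishing

/-! ### Quotients by finite groups -/

/-- `π : Z ⟶ Q` is a quotient by the group `G` acting on the scheme `Z` from the right through `ρ`
(so that `G` acts on functions from the left): it is affine and invariant, and
the functions on an open subset of `Q` are the invariant functions on its preimage. -/
structure IsGroupQuotient {G : Type*} [Group G] {Z Q : Scheme.{u}} (ρ : G → (Z ⟶ Z)) (π : Z ⟶ Q) :
    Prop where
  map_one : ρ 1 = 𝟙 Z
  map_mul : ∀ σ τ, ρ (σ * τ) = ρ σ ≫ ρ τ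
  isAffineHom : IsAffineHom π
  invariant : ∀ σ, ρ σ ≫ π = π
  functions : ∀ (V : Q.Opens) (f : Γ(Z, π ⁻¹ᵁ V)),
    (∀ (σ : G) (h : π ⁻¹ᵁ V ≤ ρ σ ⁻¹ᵁ (π ⁻¹ᵁ V)), (ρ σ).appLE (π ⁻¹ᵁ V) (π ⁻¹ᵁ V) h f = f) →
    ∃! g : Γ(Q, V), π.app V g = f

namespace IsGroupQuotient

variable {G : Type*} [Group G] {Z Q : Scheme.{u}} {ρ : G → (Z ⟶ Z)} {π : Z ⟶ Q}
  (h : IsGroupQuotient ρ π)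

include h

theorem apply_apply (σ : G) (z : Z) : π (ρ σ z) = π z := by
  rw [← Scheme.Hom.comp_apply, h.invariant]

theorem preimage_le (σ : G) (V : Q.Opens) : π ⁻¹ᵁ V ≤ ρ σ ⁻¹ᵁ (π ⁻¹ᵁ V) := fun z hz => by
  change π (ρ σ z) ∈ V
  rw [h.apply_apply]; exact hz

/-- The action on the functions over an open subset of the quotient. -/
@[reducible] def action (V : Q.Opens) : MulSemiringAction G Γ(Z, π ⁻¹ᵁ V) where
  smul σ f := (ρ σ).appLE (π ⁻¹ᵁ V) (π ⁻¹ᵁ V) (h.preimage_le σ V) f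
  one_smul f := by
    change (ρ 1).appLE (π ⁻¹ᵁ V) (π ⁻¹ᵁ V) _ f = f
    have : (𝟙 Z : Z ⟶ Z).appLE (π ⁻¹ᵁ V) (π ⁻¹ᵁ V) (le_refl (𝟙 Z ⁻¹ᵁ (π ⁻¹ᵁ V))) = 𝟙 _ :=
      (Scheme.Hom.appLE_eq_app (𝟙 Z)).trans (Scheme.Hom.id_app _)
    simp only [h.map_one]
    rw [this]; rfl
  mul_smul σ τ f := by
    change (ρ (σ * τ)).appLE (π ⁻¹ᵁ V) (π ⁻¹ᵁ V) _ f = (ρ σ).appLE (π ⁻¹ᵁ V) (π ⁻¹ᵁ V) _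
      ((ρ τ).appLE (π ⁻¹ᵁ V) (π ⁻¹ᵁ V) _ f)
    rw [← CommRingCat.comp_apply, Scheme.Hom.appLE_comp_appLE]
    simp only [h.map_mul]
  smul_zero σ := _root_.map_zero _
  smul_add σ := _root_.map_add _
  smul_one σ := _root_.map_one _
  smul_mul σ := _root_.map_mul _

theorem app_injective (V : Q.Opens) : Function.Injective (π.app V) := fun a b hab => by
  refine (h.functions V (π.app V a) fun σ hσ => ?_).unique rfl hab.symm
  rw [Scheme.Hom.app_eq_appLE, ← CommRingCat.comp_apply, Scheme.Hom.appLE_comp_appLE]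
  simp only [h.invariant]

theorem isInvariant (V : Q.Opens) :
    letI := h.action V
    letI := (π.app V).hom.toAlgebra
    Algebra.IsInvariant Γ(Q, V) Γ(Z, π ⁻¹ᵁ V) G := by
  let := h.action V
  let := (π.app V).hom.toAlgebra
  exact ⟨fun f hf => (h.functions V f fun σ _ => hf σ).exists⟩

theorem smul_app (V : Q.Opens) (σ : G) (a : Γ(Q, V)) :
    (ρ σ).appLE (π ⁻¹ᵁ V) (π ⁻¹ᵁ V) (h.preimage_le σ V) (π.app V a) = π.app V a := by
  rw [Scheme.Hom.app_eq_appLE, ← CommRingCat.comp_apply, Scheme.Hom.appLE_comp_appLE]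
  simp only [h.invariant]

section

open scoped Pointwise

theorem vanishingAt_apply (V : Q.Opens) (σ : G) (z : Z) (hz : z ∈ π ⁻¹ᵁ V) :
    letI := h.action V
    vanishingAt (π ⁻¹ᵁ V) (ρ σ z) (h.preimage_le σ V hz) = σ⁻¹ • vanishingAt (π ⁻¹ᵁ V) z hz := by
  let := h.action V
  ext f
  rw [Ideal.mem_inv_pointwise_smul_iff]
  exact appLE_mem_vanishingAt.symm

variable [Finite G]

theorem isIntegralHom : IsIntegralHom π := by
  have := h.isAffineHom
  refine ⟨fun V _ => ?_⟩
  let := h.action V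
  let := (π.app V).hom.toAlgebra
  have := h.isInvariant V
  have : Algebra.IsIntegral Γ(Q, V) Γ(Z, π ⁻¹ᵁ V) := Algebra.IsInvariant.isIntegral _ _ G
  exact fun x => this.isIntegral x

theorem surjective : Function.Surjective π := by
  intro q
  have := h.isAffineHom
  obtain ⟨V, hV, hqV, -⟩ := exists_isAffineOpen_mem_and_subset (x := q) (U := ⊤) trivial
  let := h.action V
  let := (π.app V).hom.toAlgebra
  have := h.isInvariant V
  have : Algebra.IsIntegral Γ(Q, V) Γ(Z, π ⁻¹ᵁ V) := Algebra.IsInvariant.isIntegral _ _ G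
  obtain ⟨p, -, hp, hpq⟩ := Ideal.exists_ideal_over_prime_of_isIntegral (S := Γ(Z, π ⁻¹ᵁ V))
    (vanishingAt V q hqV) ⊥
    (by rw [← RingHom.ker_eq_comap_bot]
        exact ((RingHom.injective_iff_ker_eq_bot (π.app V).hom).mp (h.app_injective V)).trans_le
          bot_le)
  obtain ⟨z, hz, rfl⟩ := (hV.preimage π).exists_vanishingAt_eq p
  refine ⟨z, hV.eq_of_vanishingAt_eq (hz := hz) (hz' := hqV) ?_⟩
  rw [← hpq]
  ext s
  exact app_mem_vanishingAt.symm

theorem exists_apply_eq {z z' : Z} (hzz' : π z = π z') : ∃ σ, ρ σ z = z' := by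
  have := h.isAffineHom
  obtain ⟨V, hV, hqV, -⟩ := exists_isAffineOpen_mem_and_subset (x := π z) (U := ⊤) trivial
  have hz : z ∈ π ⁻¹ᵁ V := hqV
  have hqV' : π z' ∈ V := hzz' ▸ hqV
  have hz' : z' ∈ π ⁻¹ᵁ V := hqV'
  let := h.action V
  let := (π.app V).hom.toAlgebra
  have := h.isInvariant V
  have : SMulCommClass G Γ(Q, V) Γ(Z, π ⁻¹ᵁ V) := ⟨fun σ a f => by
    rw [Algebra.smul_def, Algebra.smul_def, smul_mul']
    congr 1
    exact h.smul_app V σ a⟩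
  obtain ⟨σ, hσ⟩ := Algebra.IsInvariant.exists_smul_of_under_eq Γ(Q, V) Γ(Z, π ⁻¹ᵁ V) G
    (vanishingAt (π ⁻¹ᵁ V) z hz) (vanishingAt (π ⁻¹ᵁ V) z' hz') (by
      ext s
      refine Iff.trans (app_mem_vanishingAt (hz := hqV)) (Iff.trans ?_
        (app_mem_vanishingAt (hz := hqV')).symm)
      rw [mem_vanishingAt, mem_vanishingAt, hzz'])
  refine ⟨σ⁻¹, (hV.preimage π).eq_of_vanishingAt_eq (hz := h.preimage_le _ V hz) (hz' := hz') ?_⟩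
  rw [h.vanishingAt_apply, inv_inv, hσ]

end

end IsGroupQuotient

/-! ### Functions on quotients by finite groups -/

theorem appLE_appLE_apply {X Y Z : Scheme.{u}} {f : X ⟶ Y} {g : Y ⟶ Z} {U : Z.Opens} {V : Y.Opens}
    {W : X.Opens} {h₁ : V ≤ g ⁻¹ᵁ U} {h₂ : W ≤ f ⁻¹ᵁ V} (a : Γ(Z, U)) :
    f.appLE V W h₂ (g.appLE U V h₁ a) =
      (f ≫ g).appLE U W (h₂.trans ((TopologicalSpace.Opens.map f.base).map (homOfLE h₁)).le) a := by
  rw [← CommRingCat.comp_apply, Scheme.Hom.appLE_comp_appLE]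

theorem appLE_congr_hom {X Y : Scheme.{u}} {f g : X ⟶ Y} (h : f = g) {U : Y.Opens} {W : X.Opens}
    {h₁ : W ≤ f ⁻¹ᵁ U} (a : Γ(Y, U)) :
    f.appLE U W h₁ a = g.appLE U W (h ▸ h₁) a := by
  subst h; rfl

theorem id_appLE_apply {X : Scheme.{u}} {U : X.Opens} {h : U ≤ (𝟙 X : X ⟶ X) ⁻¹ᵁ U} (a : Γ(X, U)) :
    (𝟙 X : X ⟶ X).appLE U U h a = a := by
  have : (𝟙 X : X ⟶ X).appLE U U h = 𝟙 _ := by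
    rw [Scheme.Hom.appLE, Scheme.Hom.id_app]
    exact (Category.id_comp _).trans (X.presheaf.map_id _)
  rw [this]; rfl

theorem appLE_map_apply {X Y : Scheme.{u}} {f : X ⟶ Y} {U : Y.Opens} {V W : X.Opens}
    {h : V ≤ f ⁻¹ᵁ U} {h' : W ≤ V} (a : Γ(Y, U)) :
    X.presheaf.map (homOfLE h').op (f.appLE U V h a) = f.appLE U W (h'.trans h) a := by
  rw [← CommRingCat.comp_apply, Scheme.Hom.appLE_map]

theorem map_appLE_apply {X Y : Scheme.{u}} {f : X ⟶ Y} {U V : Y.Opens} {W : X.Opens}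
    {h : W ≤ f ⁻¹ᵁ V} {h' : V ≤ U} (a : Γ(Y, U)) :
    f.appLE V W h (Y.presheaf.map (homOfLE h').op a) =
      f.appLE U W (h.trans ((TopologicalSpace.Opens.map f.base).map (homOfLE h')).le) a := by
  rw [← CommRingCat.comp_apply, Scheme.Hom.map_appLE]

theorem map_mem_vanishingAt {Z : Scheme.{u}} {U W : Z.Opens} (h : W ≤ U) {z : Z} {hz : z ∈ W}
    {s : Γ(Z, U)} : Z.presheaf.map (homOfLE h).op s ∈ vanishingAt W z hz ↔
      s ∈ vanishingAt U z (h hz) := by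
  rw [mem_vanishingAt, mem_vanishingAt, Scheme.basicOpen_res]
  exact not_congr ⟨fun h => h.2, fun h => ⟨hz, h⟩⟩

namespace IsGroupQuotient

variable {G : Type*} [Group G] {Z Q : Scheme.{u}} {ρ : G → (Z ⟶ Z)} {π : Z ⟶ Q}
  (h : IsGroupQuotient ρ π)

include h

theorem isQuotientMap [Finite G] : IsQuotientMap π := by
  have := h.isIntegralHom
  exact π.isClosedMap.isQuotientMap π.continuous h.surjective

/-- The quotient is a categorical quotient. -/
theorem exists_desc [Finite G] {Q' : Scheme.{u}} (f : Z ⟶ Q') (hf : ∀ σ, ρ σ ≫ f = f) :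
    ∃ f' : Q ⟶ Q', π ≫ f' = f := by
  choose s hs using h.surjective
  let φ : Q → Q' := fun q => f (s q)
  have hφ (z : Z) : φ (π z) = f z := by
    obtain ⟨σ, hσ⟩ := h.exists_apply_eq (hs (π z))
    rw [← hσ, h.apply_apply]
    change f (s (π (s (π z)))) = (ρ σ ≫ f) (s (π z))
    rw [hf, hs]
  have hφc : Continuous φ := by
    rw [h.isQuotientMap.continuous_iff, show φ ∘ π = f from funext hφ]
    exact f.continuous
  let φ' : Q.toPresheafedSpace.carrier ⟶ Q'.toPresheafedSpace.carrier := TopCat.ofHom ⟨φ, hφc⟩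
  have hle (U : Q'.Opens) : π ⁻¹ᵁ ((TopologicalSpace.Opens.map φ').obj U) ≤ f ⁻¹ᵁ U := fun z hz => by
    change f z ∈ U
    rw [← hφ]; exact hz
  have key (U : Q'.Opens) (a : Γ(Q', U)) : ∃ b : Γ(Q, (TopologicalSpace.Opens.map φ').obj U),
      π.app _ b = f.appLE U _ (hle U) a := by
    refine (h.functions _ _ fun σ hσ => ?_).exists
    rw [← CommRingCat.comp_apply, Scheme.Hom.appLE_comp_appLE]
    simp only [hf]
  choose c hc using key
  let c' (U : Q'.Opens) : Γ(Q', U) ⟶ Γ(Q, (TopologicalSpace.Opens.map φ').obj U) := CommRingCat.ofHom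
    { toFun := c U
      map_one' := h.app_injective _ (by rw [hc, _root_.map_one, _root_.map_one])
      map_zero' := h.app_injective _ (by rw [hc, _root_.map_zero, _root_.map_zero])
      map_mul' a b := h.app_injective _ (by rw [hc, _root_.map_mul, _root_.map_mul, hc, hc])
      map_add' a b := h.app_injective _ (by rw [hc, _root_.map_add, _root_.map_add, hc, hc]) }
  have hc' (U : Q'.Opens) : c' U ≫ π.app _ = f.appLE U _ (hle U) := by
    ext a
    exact hc U a
  let F : Q.toPresheafedSpace.Hom Q'.toPresheafedSpace :=
    { base := φ'
      c :=
        { app U := c' U.unop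
          naturality U V i := by
            have hinj : Mono (π.app ((TopologicalSpace.Opens.map φ').obj V.unop)) :=
              ConcreteCategory.mono_of_injective _ (h.app_injective _)
            rw [← cancel_mono (π.app ((TopologicalSpace.Opens.map φ').obj V.unop))]
            calc (Q'.presheaf.map i ≫ c' V.unop) ≫ π.app _
                = Q'.presheaf.map i ≫ f.appLE V.unop _ (hle V.unop) := by
                  rw [Category.assoc, hc']
              _ = f.appLE U.unop _ (hle U.unop) ≫ Z.presheaf.map
                  ((TopologicalSpace.Opens.map π.base).map
                    ((TopologicalSpace.Opens.map φ').map i.unop)).op := by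
                  rw [Scheme.Hom.appLE_map]
                  exact Scheme.Hom.map_appLE f _ i
              _ = c' U.unop ≫ Q.presheaf.map ((TopologicalSpace.Opens.map φ').map i.unop).op ≫
                    π.app ((TopologicalSpace.Opens.map φ').obj V.unop) := by
                  rw [π.naturality, ← hc', Category.assoc]
                  rfl
              _ = _ := (Category.assoc _ _ _).symm } }
  have hloc (q : Q) : IsLocalHom (F.stalkMap q).hom := by
    refine ⟨fun a ha => ?_⟩
    obtain ⟨U, hU, a, rfl⟩ := TopCat.Presheaf.exists_germ_eq Q'.presheaf (x := φ q) a
    have h1 : (F.stalkMap q) (Q'.presheaf.germ U (φ q) hU a) =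
        Q.presheaf.germ ((TopologicalSpace.Opens.map φ').obj U) q hU (c' U a) :=
      congrArg (fun g => g.hom a) (PresheafedSpace.stalkMap_germ (show
        Q.toPresheafedSpace ⟶ Q'.toPresheafedSpace from F) U q hU)
    have h2 : q ∈ Q.basicOpen (c' U a) :=
      (Scheme.mem_basicOpen Q _ q (U := (TopologicalSpace.Opens.map φ').obj U) hU).mpr (h1 ▸ ha)
    obtain ⟨z, rfl⟩ := h.surjective q
    have h3 : z ∈ Z.basicOpen (π.app _ (c' U a)) := by
      rw [← Scheme.preimage_basicOpen]; exact h2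
    have h4 : π.app _ (c' U a) = f.appLE U _ (hle U) a := hc U a
    rw [h4, Scheme.basicOpen_appLE] at h3
    have h5 : φ (π z) ∈ Q'.basicOpen a := by rw [hφ]; exact h3.2
    exact (Scheme.mem_basicOpen _ _ _ hU).mp h5
  refine ⟨⟨⟨F, hloc⟩⟩, ?_⟩
  refine Scheme.Hom.ext ?_ fun U => ?_
  · ext z
    exact hφ z
  · change (c' U ≫ π.app _) ≫ Z.presheaf.map _ = _
    rw [hc']
    exact (Scheme.Hom.appLE_map f _ _).trans (Scheme.Hom.app_eq_appLE f).symm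

omit h in
theorem of_iso {Z' : Scheme.{u}} {ρ' : G → (Z' ⟶ Z')} (e : Z' ≅ Z)
    (he : ∀ σ, ρ' σ ≫ e.hom = e.hom ≫ ρ σ) (h : IsGroupQuotient ρ π) :
    IsGroupQuotient ρ' (e.hom ≫ π) where
  map_one := by rw [← cancel_mono e.hom, he, h.map_one, Category.comp_id, Category.id_comp]
  map_mul σ τ := by
    rw [← cancel_mono e.hom, he, h.map_mul, Category.assoc, he, reassoc_of% he]
  isAffineHom := have := h.isAffineHom; inferInstance
  invariant σ := by rw [reassoc_of% he, h.invariant]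
  functions V f hf := by
    have h1 : π ⁻¹ᵁ V ≤ e.inv ⁻¹ᵁ ((e.hom ≫ π) ⁻¹ᵁ V) := fun z hz => by
      change π ((e.inv ≫ e.hom) z) ∈ V
      rw [e.inv_hom_id]; exact hz
    have h2 : (e.hom ≫ π) ⁻¹ᵁ V ≤ e.hom ⁻¹ᵁ (π ⁻¹ᵁ V) := le_rfl
    have h3 (f) : e.hom.appLE _ _ h2 (e.inv.appLE _ _ h1 f) = f := by
      rw [appLE_appLE_apply, appLE_congr_hom e.hom_inv_id, id_appLE_apply]
    have h4 (g) : (e.hom ≫ π).app V g = e.hom.appLE _ _ h2 (π.app V g) := by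
      rw [Scheme.Hom.app_eq_appLE, Scheme.Hom.app_eq_appLE, appLE_appLE_apply]
    obtain ⟨g, hg, -⟩ := h.functions V (e.inv.appLE _ _ h1 f) fun σ hσ => by
      have he' : ρ σ ≫ e.inv = e.inv ≫ ρ' σ := by
        rw [Iso.comp_inv_eq, Category.assoc, he, Iso.inv_hom_id_assoc]
      have h5 : (e.hom ≫ π) ⁻¹ᵁ V ≤ ρ' σ ⁻¹ᵁ ((e.hom ≫ π) ⁻¹ᵁ V) := fun z hz => by
        change π ((ρ' σ ≫ e.hom) z) ∈ V
        rw [he]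
        exact hσ (show e.hom z ∈ π ⁻¹ᵁ V from hz)
      conv_rhs => rw [← hf σ h5]
      rw [appLE_appLE_apply, appLE_appLE_apply]
      exact appLE_congr_hom he' _
    refine ⟨g, (h4 g).trans ((congrArg _ hg).trans (h3 f)), fun g' hg' => ?_⟩
    refine h.app_injective V ?_
    refine Eq.trans ?_ hg.symm
    rw [← hg']
    change _ = e.inv.appLE _ _ h1 ((e.hom ≫ π).app V g')
    rw [h4, appLE_appLE_apply, appLE_congr_hom e.inv_hom_id, id_appLE_apply]

section

open scoped Pointwise

/-- Let `ψ` be a function on a neighbourhood `O` of `z`, invariant by a subgroup containing the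
stabilizer of `z`. The value of `ψ` at `z` is a fraction of values of functions on the quotient. -/
theorem exists_app_sub_mem [Finite G] {V : Q.Opens} (hV : IsAffineOpen V) {O : Z.Opens} (H : Subgroup G)
    (ψ : Γ(Z, O)) (hψ : ∀ σ ∈ H, ∃ hσ : O ≤ ρ σ ⁻¹ᵁ O, (ρ σ).appLE O O hσ ψ = ψ)
    {W : Z.Opens} (hWO : W ≤ O) (hWV : W ≤ π ⁻¹ᵁ V) (hW : π ⁻¹ᵁ V ⊓ O ≤ W)
    {z : Z} (hzW : z ∈ W) (hz : ∀ σ, ρ σ z = z → σ ∈ H) :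
    ∃ u v : Γ(Q, V), v ∉ vanishingAt V (π z) (hWV hzW) ∧
      π.appLE V W hWV u - Z.presheaf.map (homOfLE hWO).op ψ * π.appLE V W hWV v ∈
        vanishingAt W z hzW := by
  have := h.isAffineHom
  let := h.action V
  have hzV : z ∈ π ⁻¹ᵁ V := hWV hzW
  let p := vanishingAt (π ⁻¹ᵁ V) z hzV
  let J : Ideal Γ(Z, π ⁻¹ᵁ V) := ⨅ y : {y : Z // y ∈ π ⁻¹ᵁ V ∧ y ∉ O}, vanishingAt _ y.1 y.2.1
  have hJ {s : Γ(Z, π ⁻¹ᵁ V)} : s ∈ J ↔ Z.basicOpen s ≤ O := by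
    simp only [J, Ideal.mem_iInf, mem_vanishingAt]
    refine ⟨fun hs y hy => ?_, fun hs y hy => y.2.2 (hs hy)⟩
    by_contra hyO
    exact hs ⟨y, Z.basicOpen_le s hy, hyO⟩ hy
  -- `t` cuts out a neighbourhood of `z` within `O` and vanishes at the points of the orbit of `z`
  -- other than those of its `H`-orbit
  obtain ⟨t, htH, htJ, htp, htg⟩ := exists_invariant_separating H p (fun σ hσ => by
      refine (H.inv_mem_iff).mp (hz _ ((hV.preimage π).eq_of_vanishingAt_eq
        (hz := h.preimage_le _ V hzV) (hz' := hzV) ?_))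
      rw [h.vanishingAt_apply, inv_inv]
      exact hσ) J (fun σ hσ hle => by
    obtain ⟨hO, -⟩ := hψ σ⁻¹ (H.inv_mem hσ)
    obtain ⟨f, hf, hzf⟩ := (hV.preimage π).exists_basicOpen_le (V := O)
      ⟨ρ σ⁻¹ z, hO (hWO hzW)⟩ (h.preimage_le _ V hzV)
    have h1 := hle (hJ.mpr hf)
    have h2 := h.vanishingAt_apply V σ⁻¹ z hzV
    rw [inv_inv] at h2
    rw [← h2] at h1
    exact mem_vanishingAt.mp h1 hzf)
  let D := Z.basicOpen t
  have hDO : D ≤ O := hJ.mp htJ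
  have hDV : D ≤ π ⁻¹ᵁ V := Z.basicOpen_le t
  have hDW : D ≤ W := (le_inf hDV hDO).trans hW
  have hzD : z ∈ D := not_not.mp (fun h => htp (mem_vanishingAt.mpr h))
  have hloc : IsLocalization.Away t Γ(Z, D) := (hV.preimage π).isLocalization_basicOpen t
  have hres (a : Γ(Z, π ⁻¹ᵁ V)) : algebraMap _ Γ(Z, D) a = Z.presheaf.map (homOfLE hDV).op a := rfl
  obtain ⟨⟨y, ⟨_, N, rfl⟩⟩, hy⟩ := IsLocalization.surj (Submonoid.powers t)
    (Z.presheaf.map (homOfLE hDO).op ψ)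
  dsimp only at hy
  have hsmul (σ) (hσ : σ ∈ H) : algebraMap _ Γ(Z, D) (σ • y) = algebraMap _ Γ(Z, D) y := by
    have hD : D ≤ ρ σ ⁻¹ᵁ D := by
      have h1 : Z.basicOpen (σ • t) = π ⁻¹ᵁ V ⊓ ρ σ ⁻¹ᵁ D := Scheme.basicOpen_appLE _ _ _ _ _
      rw [htH σ hσ] at h1
      exact h1.trans_le inf_le_right
    have h1 (a : Γ(Z, π ⁻¹ᵁ V)) : algebraMap _ Γ(Z, D) (σ • a) =
        (ρ σ).appLE D D hD (algebraMap _ Γ(Z, D) a) := by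
      rw [hres, hres, map_appLE_apply]
      exact appLE_map_apply _
    obtain ⟨hO, hψσ⟩ := hψ σ hσ
    have h2 : (ρ σ).appLE D D hD (Z.presheaf.map (homOfLE hDO).op ψ) =
        Z.presheaf.map (homOfLE hDO).op ψ := by
      conv_rhs => rw [← hψσ]
      rw [map_appLE_apply]
      exact (appLE_map_apply _).symm
    rw [h1, ← hy, _root_.map_mul, h2, ← h1, smul_pow', htH σ hσ]
  have hM (σ : G) : ∃ M, σ ∈ H → t ^ M * (σ • y) = t ^ M * y := by
    by_cases hσ : σ ∈ H
    · obtain ⟨⟨_, M, rfl⟩, hM⟩ := (IsLocalization.eq_iff_exists (Submonoid.powers t) _).mp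
        (hsmul σ hσ)
      exact ⟨M, fun _ => hM⟩
    · exact ⟨0, fun h => absurd h hσ⟩
  choose M hM using hM
  have := Fintype.ofFinite G
  let M' := Finset.univ.sup M
  -- on `D`, `ψ = y / t ^ N`, and `w₁ / w₂ = ψ` with `w₁` and `w₂` invariant under `H`; the additional
  -- factor `t` makes the translates by elements outside `H` vanish at `z`, so that summing over
  -- cosets does not change the values at `z`
  let w₁ := t ^ M' * y * t
  let w₂ := t ^ (M' + N + 1)
  have hw₁ (σ) (hσ : σ ∈ H) : σ • w₁ = w₁ := by
    have h1 : M' = (M' - M σ) + M σ := by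
      have := Finset.le_sup (f := M) (Finset.mem_univ σ)
      omega
    have h2 : t ^ M' * (σ • y) = t ^ M' * y := by
      rw [h1, pow_add, mul_assoc, hM σ hσ, mul_assoc]
    simp only [w₁, smul_mul', smul_pow', htH σ hσ, h2]
  have hw₂ (σ) (hσ : σ ∈ H) : σ • w₂ = w₂ := by simp only [w₂, smul_pow', htH σ hσ]
  obtain ⟨v₁, hv₁, hv₁', -⟩ := exists_invariant_sub_mem H p.toAddSubgroup hw₁ fun σ hσ => by
    simp only [w₁, smul_mul']
    exact p.mul_mem_left _ (htg σ hσ)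
  obtain ⟨v₂, hv₂, hv₂', -⟩ := exists_invariant_sub_mem H p.toAddSubgroup hw₂ fun σ hσ => by
    simp only [w₂, smul_pow']
    exact p.pow_mem_of_mem (htg σ hσ) _ (Nat.succ_pos _)
  obtain ⟨u, hu⟩ := (h.functions V v₁ fun σ _ => hv₁ σ).exists
  obtain ⟨v, hv⟩ := (h.functions V v₂ fun σ _ => hv₂ σ).exists
  refine ⟨u, v, fun hvz => ?_, ?_⟩
  · have h1 : v₂ ∈ p := hv ▸ app_mem_vanishingAt.mpr hvz
    have h2 : w₂ ∈ p := by simpa using p.sub_mem h1 hv₂'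
    exact htp ((inferInstance : p.IsPrime).mem_of_pow_mem _ h2)
  · rw [← map_mem_vanishingAt hDW (hz := hzD), map_sub, _root_.map_mul, appLE_map_apply,
      appLE_map_apply, ← CommRingCat.comp_apply, ← Functor.map_comp]
    have h1 (a : Γ(Q, V)) : π.appLE V D (hDW.trans hWV) a = algebraMap _ Γ(Z, D) (π.app V a) := by
      rw [hres, Scheme.Hom.app_eq_appLE, appLE_map_apply]
    rw [h1, h1, hu, hv]
    change _ - (Z.presheaf.map (homOfLE hDO).op ψ) * _ ∈ _
    have h2 (a) (ha : a ∈ p) : algebraMap _ Γ(Z, D) a ∈ vanishingAt D z hzD :=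
      (map_mem_vanishingAt hDV).mpr ha
    have h3 : algebraMap _ Γ(Z, D) v₁ - Z.presheaf.map (homOfLE hDO).op ψ * algebraMap _ Γ(Z, D) v₂ =
        algebraMap _ Γ(Z, D) (v₁ - w₁) -
          Z.presheaf.map (homOfLE hDO).op ψ * algebraMap _ Γ(Z, D) (v₂ - w₂) := by
      simp only [w₁, w₂, map_sub, _root_.map_mul, map_pow, ← hy]
      ring
    rw [h3]
    exact sub_mem (h2 _ hv₁') (Ideal.mul_mem_left _ _ (h2 _ hv₂'))

end

end IsGroupQuotient

/-! ### Quotients of affine schemes by finite groups -/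

section AffineQuotient

variable {G : Type*} [Group G] [Finite G] {Z X : Scheme.{u}} [IsAffine Z] [IsAffine X]
  {ρ : G → (Z ⟶ Z)} {π : Z ⟶ X}

theorem app_injective_of_eq_basicOpen (hinj : Function.Injective (π.appTop)) (r : Γ(X, ⊤))
    {D : X.Opens} (hD : D = X.basicOpen r) : Function.Injective (π.app D) := by
  let i : D ⟶ ⊤ := homOfLE le_top
  let j : π ⁻¹ᵁ D ⟶ ⊤ := homOfLE le_top
  let := (X.presheaf.map i.op).hom.toAlgebra
  let := (Z.presheaf.map j.op).hom.toAlgebra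
  have h1 : IsLocalization.Away r Γ(X, D) :=
    (isAffineOpen_top X).isLocalization_of_eq_basicOpen r i hD
  have h2 : IsLocalization.Away (π.appTop r) Γ(Z, π ⁻¹ᵁ D) :=
    (isAffineOpen_top Z).isLocalization_of_eq_basicOpen _ j (by
      rw [hD, Scheme.preimage_basicOpen]; rfl)
  have hc (a : Γ(X, ⊤)) : π.app D (algebraMap _ Γ(X, D) a) = algebraMap _ Γ(Z, π ⁻¹ᵁ D) (π.appTop a) :=
    congrArg (fun g => g.hom a) (π.naturality i.op)
  rw [injective_iff_map_eq_zero]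
  intro g hg
  obtain ⟨⟨a, ⟨_, n, rfl⟩⟩, ha⟩ := IsLocalization.surj (Submonoid.powers r) g
  dsimp only at ha
  have h3 : algebraMap _ Γ(Z, π ⁻¹ᵁ D) (π.appTop a) = 0 := by
    rw [← hc, ← ha, map_mul, hg, zero_mul]
  obtain ⟨⟨_, m, rfl⟩, hm⟩ := (IsLocalization.map_eq_zero_iff (Submonoid.powers (π.appTop r)) _ _).mp h3
  have h4 : r ^ m * a = 0 := hinj (by simpa using hm)
  have hr : IsUnit (algebraMap _ Γ(X, D) r) := IsLocalization.Away.algebraMap_isUnit r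
  have h5 : algebraMap _ Γ(X, D) r ^ m * algebraMap _ Γ(X, D) a = 0 := by
    rw [← map_pow, ← map_mul, h4, map_zero]
  rw [(hr.pow m).mul_right_eq_zero, ← ha, map_pow, (hr.pow n).mul_left_eq_zero] at h5
  exact h5

omit [Group G] in
/-- Invariants commute with localization at an invariant element. -/
theorem exists_app_eq_of_eq_basicOpen (hπ : ∀ σ, ρ σ ≫ π = π)
    (htop : ∀ f : Γ(Z, ⊤), (∀ σ, (ρ σ).appTop f = f) → ∃ g, π.appTop g = f) (r : Γ(X, ⊤))
    {D : X.Opens} (hD : D = X.basicOpen r) (f : Γ(Z, π ⁻¹ᵁ D))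
    (hf : ∀ σ, ∀ h : π ⁻¹ᵁ D ≤ ρ σ ⁻¹ᵁ (π ⁻¹ᵁ D), (ρ σ).appLE _ _ h f = f) :
    ∃ g, π.app D g = f := by
  let i : D ⟶ ⊤ := homOfLE le_top
  let j : π ⁻¹ᵁ D ⟶ ⊤ := homOfLE le_top
  let := (X.presheaf.map i.op).hom.toAlgebra
  let := (Z.presheaf.map j.op).hom.toAlgebra
  have h1 : IsLocalization.Away r Γ(X, D) :=
    (isAffineOpen_top X).isLocalization_of_eq_basicOpen r i hD
  have h2 : IsLocalization.Away (π.appTop r) Γ(Z, π ⁻¹ᵁ D) :=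
    (isAffineOpen_top Z).isLocalization_of_eq_basicOpen _ j (by
      rw [hD, Scheme.preimage_basicOpen]; rfl)
  have hc (a : Γ(X, ⊤)) : π.app D (algebraMap _ Γ(X, D) a) = algebraMap _ Γ(Z, π ⁻¹ᵁ D) (π.appTop a) :=
    congrArg (fun g => g.hom a) (π.naturality i.op)
  have hρr (σ : G) : (ρ σ).appTop (π.appTop r) = π.appTop r := by
    have := congrArg (fun g => g.hom r) (Scheme.Hom.comp_app (ρ σ) π ⊤)
    refine Eq.trans this.symm ?_
    simp only [Scheme.Hom.app_eq_appLE]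
    exact appLE_congr_hom (hπ σ) r
  have hle (σ : G) : π ⁻¹ᵁ D ≤ ρ σ ⁻¹ᵁ (π ⁻¹ᵁ D) := fun z hz => by
    change (ρ σ ≫ π) z ∈ D
    rw [hπ]; exact hz
  have hcρ (σ : G) (a : Γ(Z, ⊤)) : (ρ σ).appLE _ _ (hle σ) (algebraMap _ Γ(Z, π ⁻¹ᵁ D) a) =
      algebraMap _ Γ(Z, π ⁻¹ᵁ D) ((ρ σ).appTop a) := by
    refine (map_appLE_apply (h' := le_top) a).trans ?_
    rw [Scheme.Hom.appTop, Scheme.Hom.app_eq_appLE]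
    exact (appLE_map_apply (h' := le_top) a).symm
  obtain ⟨⟨s, ⟨_, n, rfl⟩⟩, hs⟩ := IsLocalization.surj (Submonoid.powers (π.appTop r)) f
  dsimp only at hs
  have hM (σ : G) : ∃ M : ℕ, π.appTop r ^ M * (ρ σ).appTop s = π.appTop r ^ M * s := by
    have h3 : algebraMap _ Γ(Z, π ⁻¹ᵁ D) ((ρ σ).appTop s) = algebraMap _ Γ(Z, π ⁻¹ᵁ D) s := by
      rw [← hcρ, ← hs, map_mul, hf, hcρ, map_pow ((ρ σ).appTop).hom]
      erw [hρr]
    obtain ⟨⟨_, M, rfl⟩, hM⟩ := (IsLocalization.eq_iff_exists (Submonoid.powers (π.appTop r)) _).mp h3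
    exact ⟨M, hM⟩
  choose M hM using hM
  have := Fintype.ofFinite G
  let M' := Finset.univ.sup M
  obtain ⟨g, hg⟩ := htop (π.appTop r ^ M' * s) fun σ => by
    have h1 : M' = (M' - M σ) + M σ := by
      have := Finset.le_sup (f := M) (Finset.mem_univ σ)
      omega
    rw [map_mul, map_pow ((ρ σ).appTop).hom]
    erw [hρr]
    rw [h1, pow_add, mul_assoc, hM σ, mul_assoc]
  have hr : IsUnit (algebraMap _ Γ(X, D) r) := IsLocalization.Away.algebraMap_isUnit r
  obtain ⟨w, hw⟩ := (hr.pow (n + M')).exists_left_inv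
  refine ⟨w * algebraMap _ Γ(X, D) g, ?_⟩
  have h3 := congrArg (π.app D) hw
  rw [map_mul, map_pow, map_one, hc] at h3
  rw [map_mul, hc, hg, map_mul, ← hs, map_pow, map_pow]
  linear_combination f * h3

/-- An invariant morphism of affine schemes is a quotient if this is so on the level of global
sections. -/
theorem IsGroupQuotient.of_isAffine (map_one : ρ 1 = 𝟙 Z) (map_mul : ∀ σ τ, ρ (σ * τ) = ρ σ ≫ ρ τ)
    (hπ : ∀ σ, ρ σ ≫ π = π) (hinj : Function.Injective (π.appTop))
    (htop : ∀ f : Γ(Z, ⊤), (∀ σ, (ρ σ).appTop f = f) → ∃ g, π.appTop g = f) :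
    IsGroupQuotient ρ π where
  map_one := map_one
  map_mul := map_mul
  isAffineHom := inferInstance
  invariant := hπ
  functions V f hf := by
    let ι := {r : Γ(X, ⊤) // X.basicOpen r ≤ V}
    let U (r : ι) : X.Opens := X.basicOpen r.1
    have hcov : V ≤ iSup U := fun x hx => by
      obtain ⟨r, hr, hxr⟩ := (isAffineOpen_top X).exists_basicOpen_le ⟨x, hx⟩ trivial
      exact TopologicalSpace.Opens.mem_iSup.mpr ⟨⟨r, hr⟩, hxr⟩
    have hres {W : X.Opens} (hW : W ≤ V) (g : Γ(X, V)) : π.app W (X.presheaf.map (homOfLE hW).op g) =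
        Z.presheaf.map (homOfLE (show π ⁻¹ᵁ W ≤ π ⁻¹ᵁ V from fun z hz => hW hz)).op (π.app V g) :=
      congrArg (fun e => e.hom g) (π.naturality (homOfLE hW).op)
    have hinjV : Function.Injective (π.app V) := fun a b hab => by
      refine TopCat.Sheaf.eq_of_locally_eq' X.sheaf U V (fun r => homOfLE r.2) hcov a b fun r => ?_
      refine app_injective_of_eq_basicOpen hinj r.1 rfl ?_
      exact (hres r.2 a).trans (Eq.trans (by rw [hab]) (hres r.2 b).symm)
    let f' (r : ι) : Γ(Z, π ⁻¹ᵁ (U r)) :=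
      Z.presheaf.map (homOfLE (show π ⁻¹ᵁ U r ≤ π ⁻¹ᵁ V from fun z hz => r.2 hz)).op f
    have hlocal (r : ι) : ∃ g : Γ(X, U r), π.app _ g = f' r := by
      refine exists_app_eq_of_eq_basicOpen hπ htop r.1 rfl _ fun σ hσ => ?_
      have hσV : π ⁻¹ᵁ V ≤ ρ σ ⁻¹ᵁ (π ⁻¹ᵁ V) := fun z hz => by
        change (ρ σ ≫ π) z ∈ V
        rw [hπ]; exact hz
      simp only [f']
      conv_rhs => rw [← hf σ hσV]
      rw [map_appLE_apply, appLE_map_apply]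
    choose g hg using hlocal
    obtain ⟨g', hg', -⟩ := TopCat.Sheaf.existsUnique_gluing' X.sheaf U V (fun r => homOfLE r.2) hcov g
      (fun r s => by
        refine app_injective_of_eq_basicOpen hinj (r.1 * s.1) (X.basicOpen_mul _ _).symm ?_
        have h1 := congrArg (fun e => e.hom (g r)) (π.naturality (homOfLE (inf_le_left : U r ⊓ U s ≤ U r)).op)
        have h2 := congrArg (fun e => e.hom (g s)) (π.naturality (homOfLE (inf_le_right : U r ⊓ U s ≤ U s)).op)
        refine h1.trans (Eq.trans ?_ h2.symm)
        change Z.presheaf.map _ (π.app _ (g r)) = Z.presheaf.map _ (π.app _ (g s))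
        rw [hg, hg]
        simp only [f', ← CommRingCat.comp_apply, ← Functor.map_comp]
        rfl)
    have hfg : π.app V g' = f := by
      refine TopCat.Sheaf.eq_of_locally_eq' Z.sheaf (fun r => π ⁻¹ᵁ (U r)) (π ⁻¹ᵁ V)
        (fun r => homOfLE fun z hz => r.2 hz) (fun z hz => ?_) _ _ fun r => ?_
      · obtain ⟨r, hr⟩ := TopologicalSpace.Opens.mem_iSup.mp (hcov hz)
        exact TopologicalSpace.Opens.mem_iSup.mpr ⟨r, hr⟩
      · refine (hres r.2 g').symm.trans ?_
        exact (congrArg _ (hg' r)).trans (hg r)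
    exact ⟨g', hfg, fun g'' hg'' => hinjV (hg''.trans hfg.symm)⟩

/-- The spectrum of the ring of invariants of a finite group is the quotient of the spectrum. -/
theorem IsGroupQuotient.spec {R S : Type u} [CommRing R] [CommRing S] [Algebra R S]
    [MulSemiringAction G S] [SMulCommClass G R S] [Algebra.IsInvariant R S G]
    (hinj : Function.Injective (algebraMap R S)) :
    IsGroupQuotient
      (fun σ : G => Spec.map (CommRingCat.ofHom (MulSemiringAction.toRingHom G S σ)))
      (Spec.map (CommRingCat.ofHom (algebraMap R S))) := by
  have key {A B : Type u} [CommRing A] [CommRing B] (φ : A →+* B) (a : A) :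
      (Spec.map (CommRingCat.ofHom φ)).appTop ((Scheme.ΓSpecIso (.of A)).inv a) =
        (Scheme.ΓSpecIso (.of B)).inv (φ a) :=
    congrArg (fun g => g.hom a) (Scheme.ΓSpecIso_inv_naturality (CommRingCat.ofHom φ)).symm
  have hR := ConcreteCategory.bijective_of_isIso (Scheme.ΓSpecIso (.of R)).inv
  have hS := ConcreteCategory.bijective_of_isIso (Scheme.ΓSpecIso (.of S)).inv
  refine .of_isAffine ?_ (fun σ τ => ?_) (fun σ => ?_) (fun a b hab => ?_) fun f hf => ?_
  · rw [← Spec.map_id]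
    congr 1
    ext x
    exact one_smul G x
  · rw [← Spec.map_comp]
    congr 1
    ext x
    exact mul_smul σ τ x
  · rw [← Spec.map_comp]
    congr 1
    ext x
    exact smul_algebraMap σ x
  · obtain ⟨a, rfl⟩ := hR.2 a
    obtain ⟨b, rfl⟩ := hR.2 b
    rw [key, key] at hab
    rw [hinj (hS.1 hab)]
  · obtain ⟨f, rfl⟩ := hS.2 f
    obtain ⟨a, ha⟩ := Algebra.IsInvariant.isInvariant (A := R) (G := G) f fun σ => hS.1 (by
      rw [← hf σ, key]; rfl)
    exact ⟨(Scheme.ΓSpecIso (.of R)).inv a, by rw [key, ha]⟩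

end AffineQuotient

/-! ### Symmetric powers of affine schemes -/

section AffineSymPower

variable {k : Type u} [CommRing k] {ι : Type} {B C : Type u} [CommRing B] [Algebra k B]
  [CommRing C] [Algebra k C]

/-- The algebra map from a tensor power given by a family of algebra maps. -/
def TPow.lift [Fintype ι] (φ : ι → B →ₐ[k] C) : TPow k ι B →ₐ[k] C :=
  PiTensorProduct.liftAlgHom
    ((MultilinearMap.mkPiAlgebra k ι C).compLinearMap fun i => (φ i).toLinearMap)
    (by simp) (fun x y => by simp [Finset.prod_mul_distrib])

theorem TPow.lift_single [Fintype ι] [DecidableEq ι] (φ : ι → B →ₐ[k] C) (i : ι) (b : B) :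
    TPow.lift φ (PiTensorProduct.singleAlgHom (R := k) (A := fun _ : ι => B) i b) = φ i b := by
  refine (PiTensorProduct.lift.tprod (φ := (MultilinearMap.mkPiAlgebra k ι C).compLinearMap
    fun i => (φ i).toLinearMap) _).trans ?_
  simp only [MultilinearMap.compLinearMap_apply, MultilinearMap.mkPiAlgebra_apply,
    MonoidHom.mulSingle_apply, AlgHom.toLinearMap_apply]
  rw [Finset.prod_eq_single i (fun j _ hj => by simp [Pi.mulSingle_eq_of_ne hj]) (by simp)]
  simp

variable (k B) in
/-- The `k`-scheme `Spec B`. -/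
abbrev specOver : Over (Spec (.of k)) := Over.mk (Spec.map (CommRingCat.ofHom (algebraMap k B)))

/-- The morphism of `k`-schemes given by a map of `k`-algebras. -/
def specOverMap (f : B →ₐ[k] C) : specOver k C ⟶ specOver k B :=
  Over.homMk (Spec.map (CommRingCat.ofHom f.toRingHom)) (by
    change Spec.map _ ≫ Spec.map _ = Spec.map _
    rw [← Spec.map_comp, ← CommRingCat.ofHom_comp]
    exact congrArg (fun g => Spec.map (CommRingCat.ofHom g)) f.comp_algebraMap)

variable (k B) in
/-- `Spec` of a tensor power is a fibre power. -/
def isLimitSpecTPow (n : ℕ) : IsLimit (Fan.mk (specOver k (TPow k (Fin n) B)) fun i : Fin n =>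
    specOverMap (PiTensorProduct.singleAlgHom (R := k) (A := fun _ : Fin n => B) i)) := 
  have : PreservesLimit (Discrete.functor fun _ : Fin n =>
      (.op (CommAlgCat.of (CommRingCat.of k) B) : (CommAlgCat (CommRingCat.of k))ᵒᵖ))
      (algSpec (CommRingCat.of k)) :=
    (preservesLimitsOfSize_algSpec.{0, 0} (R := CommRingCat.of k)).preservesLimitsOfShape.preservesLimit
  isLimitFanMkObjOfIsLimit (algSpec (.of k)) (fun _ : Fin n => .op (CommAlgCat.of (CommRingCat.of k) B))
    (P := .op (CommAlgCat.of (CommRingCat.of k) (TPow k (Fin n) B)))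
    (fun i => (CommAlgCat.ofHom
      (PiTensorProduct.singleAlgHom (R := k) (A := fun _ : Fin n => B) i)).op)
    (Fan.IsLimit.mk _ (fun s => (CommAlgCat.ofHom (TPow.lift fun i => (s.proj i).unop.hom)).op)
      (fun s i => by
        refine Quiver.Hom.unop_inj ?_
        ext b
        exact TPow.lift_single (fun i => (s.proj i).unop.hom) i b)
      (fun s m hm => by
        refine Quiver.Hom.unop_inj ?_
        refine CommAlgCat.hom_ext (PiTensorProduct.algHom_ext fun i => ?_)
        ext b
        refine Eq.trans ?_ (TPow.lift_single (fun i => (s.proj i).unop.hom) i b).symm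
        exact congrArg (fun g => g.unop.hom b) (hm i)))

end AffineSymPower

section

variable {k : Type u} [Field k] {B C D : Type u} [CommRing B] [Algebra k B] [CommRing C] [Algebra k C]
  [CommRing D] [Algebra k D]

variable (k B) in
/-- `Spec` of a `k`-algebra of finite type. -/
abbrev FTScheme.spec [Algebra.FiniteType k B] : FTScheme k where
  obj := specOver k B
  lft := by
    dsimp
    rw [HasRingHomProperty.Spec_iff (P := @LocallyOfFiniteType)]
    exact (RingHom.finiteType_algebraMap (A := k) (B := B)).mpr inferInstance
  qc := by dsimp; infer_instance

theorem specOverMap_comp (f : B →ₐ[k] C) (g : C →ₐ[k] D) :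
    specOverMap g ≫ specOverMap f = specOverMap (g.comp f) := by
  ext1
  exact (Spec.map_comp _ _).symm

theorem permute_π (X : Over (Spec (.of k))) {n : ℕ} (σ : Equiv.Perm (Fin n)) (i : Fin n) :
    permute X σ ≫ Pi.π _ i = Pi.π (fun _ : Fin n => X) (σ i) :=
  Pi.lift_π _ _

variable (k B) in
/-- The fibre power of `Spec B` is `Spec` of the tensor power. -/
def fibrePowerSpecIso (n : ℕ) : fibrePower (specOver k B) n ≅ specOver k (TPow k (Fin n) B) :=
  (productIsProduct _).conePointUniqueUpToIso (isLimitSpecTPow k B n)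

theorem fibrePowerSpecIso_hom_comp (n : ℕ) (i : Fin n) : (fibrePowerSpecIso k B n).hom ≫
    specOverMap (PiTensorProduct.singleAlgHom (R := k) (A := fun _ : Fin n => B) i) = Pi.π _ i :=
  (productIsProduct _).conePointUniqueUpToIso_hom_comp (isLimitSpecTPow k B n) ⟨i⟩

theorem permute_comp_fibrePowerSpecIso {n : ℕ} (σ : Equiv.Perm (Fin n)) :
    permute (specOver k B) σ ≫ (fibrePowerSpecIso k B n).hom =
      (fibrePowerSpecIso k B n).hom ≫ specOverMap (MulSemiringAction.toAlgHom k _ σ) := by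
  refine (isLimitSpecTPow k B n).hom_ext fun ⟨i⟩ => ?_
  change (_ ≫ _) ≫ specOverMap _ = (_ ≫ _) ≫ specOverMap _
  rw [Category.assoc, fibrePowerSpecIso_hom_comp, permute_π, Category.assoc, specOverMap_comp]
  rw [← fibrePowerSpecIso_hom_comp]
  congr 2
  ext b
  exact (TPow.smul_single k σ i b).symm

variable (k B) in
/-- The projection from the fibre power of `Spec B` to the spectrum of the symmetric tensors. -/
def symSpecπ (n : ℕ) : fibrePower (specOver k B) n ⟶ specOver k (SymTensor k (Fin n) B) :=
  (fibrePowerSpecIso k B n).hom ≫ specOverMap (SymTensor k (Fin n) B).val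

/-- The quotients which define symmetric powers are the quotients in the sense of `IsGroupQuotient`,
for the action of the symmetric group on the fibre power. -/
theorem isSymQuotient_iff {X Q : Over (Spec (.of k))} {n : ℕ} {π : fibrePower X n ⟶ Q} :
    IsSymQuotient X n π ↔
      IsGroupQuotient (fun σ : Equiv.Perm (Fin n) => (permute X σ).left) π.left := by
  refine ⟨fun h => ⟨?_, fun σ τ => ?_, h.1, fun σ => ?_, h.3⟩, fun h => ⟨h.3, fun σ => ?_, h.5⟩⟩
  · rw [← Over.id_left]
    congr 1
    refine Pi.hom_ext _ _ fun i => ?_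
    rw [permute_π, Category.id_comp]; rfl
  · rw [← Over.comp_left]
    congr 1
    refine Pi.hom_ext _ _ fun i => ?_
    rw [Category.assoc, permute_π, permute_π, permute_π]; rfl
  · rw [← Over.comp_left, h.2]
  · ext1
    exact h.4 σ

theorem isSymQuotient_symSpecπ (n : ℕ) : IsSymQuotient (specOver k B) n (symSpecπ k B n) := by
  rw [isSymQuotient_iff]
  refine IsGroupQuotient.of_iso ((Over.forget _).mapIso (fibrePowerSpecIso k B n)) (fun σ => ?_)
    (IsGroupQuotient.spec (R := SymTensor k (Fin n) B) (S := TPow k (Fin n) B)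
      (G := Equiv.Perm (Fin n)) Subtype.val_injective)
  exact congrArg (fun f => f.left) (permute_comp_fibrePowerSpecIso (k := k) (B := B) σ)

variable (k B) in
/-- The symmetric power of `Spec B`. -/
abbrev FTScheme.symSpec [Algebra.FiniteType k B] (n : ℕ) : FTScheme k :=
  FTScheme.spec k (SymTensor k (Fin n) B)

theorem isSymPower_symSpec [Algebra.FiniteType k B] (n : ℕ) :
    IsSymPower (specOver k B) n (FTScheme.symSpec k B n).obj :=
  ⟨_, isSymQuotient_symSpecπ n⟩

end

/-! ### Piecewise isomorphisms from affine schemes -/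

/-- A bijective morphism which is an immersion locally on the source: it presents the target
as the union of finitely many subschemes. -/
structure IsPiecewise {Z X : Scheme.{u}} (g : Z ⟶ X) : Prop where
  bijective : Function.Bijective g
  exists_isImmersion : ∀ z, ∃ N : Z.Opens, z ∈ N ∧ IsImmersion (N.ι ≫ g)

theorem residueFieldMap_surjective {Z X : Scheme.{u}} {g : Z ⟶ X} {z : Z}
    (h : Function.Surjective (g.stalkMap z)) : Function.Surjective (g.residueFieldMap z) := by
  have h1 : Function.Surjective (g.stalkMap z ≫ Z.residue z) := by
    have := (Z.residue_surjective z).comp h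
    exact this
  rw [← Scheme.residue_residueFieldMap] at h1
  exact Function.Surjective.of_comp (f := g.residueFieldMap z) (g := X.residue (g z)) h1

namespace IsPiecewise

variable {X Y Z : Scheme.{u}} {g : Z ⟶ X}

theorem stalkMap_surjective (hg : IsPiecewise g) (z : Z) : Function.Surjective (g.stalkMap z) := by
  obtain ⟨N, hz, hN⟩ := hg.exists_isImmersion z
  let w : N.toScheme := ⟨z, hz⟩
  have h1 : Function.Surjective ((N.ι ≫ g).stalkMap w) :=
    SurjectiveOnStalks.stalkMap_surjective (N.ι ≫ g) _
  have h2 : Function.Injective (N.ι.stalkMap w) :=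
    (ConcreteCategory.bijective_of_isIso (N.ι.stalkMap w)).1
  intro a
  obtain ⟨b, hb⟩ := h1 (N.ι.stalkMap w a)
  rw [Scheme.Hom.stalkMap_comp] at hb
  exact ⟨b, h2 hb⟩

theorem fieldBijective (hg : IsPiecewise g) : FieldBijective g :=
  .of_bijective hg.bijective fun z => residueFieldMap_surjective (hg.stalkMap_surjective z)

theorem comp {f : Y ⟶ Z} (hf : IsPiecewise f) (hg : IsPiecewise g) : IsPiecewise (f ≫ g) where
  bijective := hg.bijective.comp hf.bijective
  exists_isImmersion y := by
    obtain ⟨N, hy, hN⟩ := hf.exists_isImmersion y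
    obtain ⟨M, hz, hM⟩ := hg.exists_isImmersion (f y)
    refine ⟨N ⊓ f ⁻¹ᵁ M, ⟨hy, hz⟩, ?_⟩
    have h1 : IsImmersion (f.resLE M (N ⊓ f ⁻¹ᵁ M) inf_le_right ≫ M.ι) := by
      rw [Scheme.Hom.resLE_comp_ι, ← Scheme.homOfLE_ι _ (inf_le_left : N ⊓ f ⁻¹ᵁ M ≤ N),
        Category.assoc]
      infer_instance
    have h2 : IsImmersion (f.resLE M (N ⊓ f ⁻¹ᵁ M) inf_le_right) := .of_comp _ M.ι
    rw [← Category.assoc, ← Scheme.Hom.resLE_comp_ι _ (inf_le_right : N ⊓ f ⁻¹ᵁ M ≤ _), Category.assoc]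
    infer_instance

theorem of_isPullback {Z' X' : Scheme.{u}} {p : Z' ⟶ Z} {g' : Z' ⟶ X'} {q : X' ⟶ X}
    (h : IsPullback p g' g q) (hg : IsPiecewise g) : IsPiecewise g' where
  bijective := (FieldBijective.of_isPullback h hg.fieldBijective).bijective
  exists_isImmersion z := by
    obtain ⟨N, hz, hN⟩ := hg.exists_isImmersion (p z)
    refine ⟨p ⁻¹ᵁ N, hz, ?_⟩
    have h1 : IsPullback (p ∣_ N) ((p ⁻¹ᵁ N).ι ≫ g') (N.ι ≫ g) q :=
      IsPullback.paste_vert (isPullback_morphismRestrict p N) h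
    exact MorphismProperty.of_isPullback (P := @IsImmersion) h1 hN

/-- Locally, a piecewise isomorphism is a closed immersion of affine schemes. -/
theorem exists_appLE_surjective (hg : IsPiecewise g) (z : Z) : ∃ (U : X.Opens) (N : Z.Opens)
    (h : N ≤ g ⁻¹ᵁ U), z ∈ N ∧ Function.Surjective (g.appLE U N h) := by
  obtain ⟨N, hz, hN⟩ := hg.exists_isImmersion z
  let i := N.ι ≫ g
  let w : N.toScheme := ⟨z, hz⟩
  obtain ⟨V, hV, hzV, -⟩ := exists_isAffineOpen_mem_and_subset (x := i.liftCoborder w) (U := ⊤) trivial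
  have h1 := i.liftCoborder.app_surjective V hV
  let U : X.Opens := i.coborderRange.ι ''ᵁ V
  let N' : Z.Opens := N.ι ''ᵁ (i.liftCoborder ⁻¹ᵁ V)
  have hle : N' ≤ g ⁻¹ᵁ U := by
    rintro _ ⟨y, hy, rfl⟩
    refine ⟨i.liftCoborder y, hy, ?_⟩
    exact congrArg (fun f : N.toScheme ⟶ X => f y) i.liftCoborder_ι
  refine ⟨U, N', hle, ⟨w, hzV, rfl⟩, fun b => ?_⟩
  have hN1 : i.liftCoborder ⁻¹ᵁ V ≤ N.ι ⁻¹ᵁ N' := (N.ι.preimage_image_eq _).ge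
  have hW1 : V ≤ i.coborderRange.ι ⁻¹ᵁ U := (i.coborderRange.ι.preimage_image_eq _).ge
  have hN2 : Function.Injective (N.ι.appLE N' (i.liftCoborder ⁻¹ᵁ V) hN1) := by
    rw [← Scheme.Hom.appIso_hom' N.ι]
    exact (ConcreteCategory.bijective_of_isIso _).1
  have hW2 : Function.Surjective (i.coborderRange.ι.appLE U V hW1) := by
    rw [← Scheme.Hom.appIso_hom' i.coborderRange.ι]
    exact (ConcreteCategory.bijective_of_isIso _).2
  obtain ⟨a', ha'⟩ := h1 (N.ι.appLE _ _ hN1 b)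
  obtain ⟨a, rfl⟩ := hW2 a'
  refine ⟨a, hN2 (Eq.trans ?_ ha')⟩
  rw [appLE_appLE_apply, Scheme.Hom.app_eq_appLE, appLE_appLE_apply]
  exact appLE_congr_hom i.liftCoborder_ι.symm _

end IsPiecewise

/-! ### Lifting symmetric tensors along piecewise isomorphisms -/

section Lifting

variable {k : Type u} [Field k]

/-- The structure of a `k`-algebra on the functions on an open subset of a `k`-scheme. -/
@[reducible] def sectionAlgebra (Y : Over (Spec (.of k))) (U : Y.left.Opens) : Algebra k Γ(Y.left, U) :=
  ((Y.hom.appLE ⊤ U le_top).hom.comp (Scheme.ΓSpecIso (.of k)).inv.hom).toAlgebra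

attribute [local instance] sectionAlgebra

/-- Pullback of functions along a morphism of `k`-schemes. -/
def overAppLE {Y Z : Over (Spec (.of k))} (f : Y ⟶ Z) (U : Z.left.Opens) (V : Y.left.Opens)
    (h : V ≤ f.left ⁻¹ᵁ U) : Γ(Z.left, U) →ₐ[k] Γ(Y.left, V) where
  __ := (f.left.appLE U V h).hom
  commutes' c := by
    change f.left.appLE U V h (Z.hom.appLE ⊤ U le_top ((Scheme.ΓSpecIso (.of k)).inv c)) =
      Y.hom.appLE ⊤ V le_top ((Scheme.ΓSpecIso (.of k)).inv c)
    exact (appLE_appLE_apply (h₁ := le_top) _).trans (appLE_congr_hom (Over.w f) _)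

/-- The functions on an open subset of `Spec B` given by the elements of `B`. -/
def specSection (B : Type u) [CommRing B] [Algebra k B] (U : (specOver k B).left.Opens) :
    B →ₐ[k] Γ((specOver k B).left, U) where
  __ := ((Spec (.of B)).presheaf.map (homOfLE (le_top : U ≤ ⊤)).op).hom.comp
    (Scheme.ΓSpecIso (.of B)).inv.hom
  commutes' c := by
    change (Spec (.of B)).presheaf.map (homOfLE (le_top : U ≤ ⊤)).op ((Scheme.ΓSpecIso (.of B)).inv
      (algebraMap k B c)) = (Spec.map (CommRingCat.ofHom (algebraMap k B))).appLE ⊤ U le_top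
        ((Scheme.ΓSpecIso (.of k)).inv c)
    have h := congrArg (fun g => g.hom c)
      (Scheme.ΓSpecIso_inv_naturality (CommRingCat.ofHom (algebraMap k B)))
    refine (congrArg _ h).trans ?_
    change (Spec (.of B)).presheaf.map (homOfLE (le_top : U ≤ ⊤)).op
      ((Spec.map (CommRingCat.ofHom (algebraMap k B))).app ⊤ ((Scheme.ΓSpecIso (.of k)).inv c)) = _
    rw [Scheme.Hom.app_eq_appLE]
    exact appLE_map_apply _

theorem specSection_top {B : Type u} [CommRing B] [Algebra k B] (b : B) :
    specSection (k := k) B ⊤ b = (Scheme.ΓSpecIso (.of B)).inv b :=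
  congrArg (fun g => g.hom ((Scheme.ΓSpecIso (.of B)).inv b)) ((Spec (.of B)).presheaf.map_id _)

theorem appLE_specSection {B : Type u} [CommRing B] [Algebra k B] {Y : Over (Spec (.of k))}
    (f : Y ⟶ specOver k B) (U : (specOver k B).left.Opens) (V : Y.left.Opens)
    (h : V ≤ f.left ⁻¹ᵁ U) (b : B) :
    f.left.appLE U V h (specSection B U b) = f.left.appLE ⊤ V le_top (specSection B ⊤ b) := by
  rw [specSection_top]
  exact map_appLE_apply (h' := le_top) _

theorem appLE_specOverMap {B C : Type u} [CommRing B] [Algebra k B] [CommRing C] [Algebra k C]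
    (f : B →ₐ[k] C) (b : B) (V : (specOver k C).left.Opens) :
    (specOverMap f).left.appLE ⊤ V le_top (specSection B ⊤ b) = specSection C V (f b) := by
  rw [specSection_top]
  have h := congrArg (fun g => g.hom b)
    (Scheme.ΓSpecIso_inv_naturality (CommRingCat.ofHom f.toRingHom))
  refine Eq.trans ?_ (congrArg ((Spec (.of C)).presheaf.map (homOfLE (le_top : V ≤ ⊤)).op) h).symm
  change _ = (Spec (.of C)).presheaf.map (homOfLE (le_top : V ≤ ⊤)).op
      ((Spec.map (CommRingCat.ofHom f.toRingHom)).app ⊤ ((Scheme.ΓSpecIso (.of B)).inv b))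
  rw [Scheme.Hom.app_eq_appLE]
  exact (appLE_map_apply _).symm

/-- The map of fibre powers induced by a morphism. -/
def fibrePowerMap {Y Z : Over (Spec (.of k))} (g : Y ⟶ Z) (n : ℕ) : fibrePower Y n ⟶ fibrePower Z n :=
  Limits.Pi.map fun _ => g

theorem fibrePowerMap_π {Y Z : Over (Spec (.of k))} (g : Y ⟶ Z) (n : ℕ) (i : Fin n) :
    fibrePowerMap g n ≫ Pi.π _ i = Pi.π _ i ≫ g :=
  Pi.map_π _ _

theorem permute_fibrePowerMap {Y Z : Over (Spec (.of k))} (g : Y ⟶ Z) {n : ℕ}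
    (σ : Equiv.Perm (Fin n)) :
    permute Y σ ≫ fibrePowerMap g n = fibrePowerMap g n ≫ permute Z σ := by
  refine Pi.hom_ext _ _ fun i => ?_
  rw [Category.assoc, Category.assoc, fibrePowerMap_π, permute_π, fibrePowerMap_π, ← Category.assoc,
    permute_π]

theorem left_appLE_comm {W Y Z T : Over (Spec (.of k))} {f : W ⟶ Y} {p : Y ⟶ Z} {p' : W ⟶ T}
    {g : T ⟶ Z} (h : f ≫ p = p' ≫ g) {U : Z.left.Opens} {V : Y.left.Opens} {V' : T.left.Opens}
    {O : W.left.Opens} {h₁ : O ≤ f.left ⁻¹ᵁ V} {h₂ : V ≤ p.left ⁻¹ᵁ U} {h₃ : O ≤ p'.left ⁻¹ᵁ V'}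
    {h₄ : V' ≤ g.left ⁻¹ᵁ U} (a : Γ(Z.left, U)) :
    f.left.appLE V O h₁ (p.left.appLE U V h₂ a) = p'.left.appLE V' O h₃ (g.left.appLE U V' h₄ a) := by
  have h' : f.left ≫ p.left = p'.left ≫ g.left := by rw [← Over.comp_left, h, Over.comp_left]
  rw [appLE_appLE_apply, appLE_appLE_apply]
  exact appLE_congr_hom h' a

theorem left_appLE_comp {W Y Z : Over (Spec (.of k))} {f : W ⟶ Y} {p : Y ⟶ Z} {p' : W ⟶ Z}
    (h : f ≫ p = p') {U : Z.left.Opens} {V : Y.left.Opens}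
    {O : W.left.Opens} {h₁ : O ≤ f.left ⁻¹ᵁ V} {h₂ : V ≤ p.left ⁻¹ᵁ U} {h₃ : O ≤ p'.left ⁻¹ᵁ U}
    (a : Γ(Z.left, U)) :
    f.left.appLE V O h₁ (p.left.appLE U V h₂ a) = p'.left.appLE U O h₃ a := by
  have h' : f.left ≫ p.left = p'.left := by rw [← Over.comp_left, h]
  rw [appLE_appLE_apply]
  exact appLE_congr_hom h' a

theorem TPow.map_single {ι : Type} [Fintype ι] [DecidableEq ι] {B C : Type u} [CommRing B] [Algebra k B] [CommRing C] [Algebra k C]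
    (f : B →ₐ[k] C) (i : ι) (b : B) :
    TPow.map k f (PiTensorProduct.singleAlgHom (R := k) (A := fun _ : ι => B) i b) =
      PiTensorProduct.singleAlgHom (R := k) (A := fun _ : ι => C) i (f b) := by
  simp only [PiTensorProduct.singleAlgHom_apply, TPow.map_tprod]
  congr 1
  ext j
  simp only [MonoidHom.mulSingle_apply]
  exact Pi.apply_mulSingle (fun _ => f) (fun _ => map_one f) i b j

set_option maxHeartbeats 800000 in
/-- Let `z` be a point of the fibre power of `Spec B`. A symmetric tensor, restricted to a
neighbourhood of `z`, comes from a function on the fibre power of `X` near the image of `z`, which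
is invariant under the stabilizer of this image. -/
theorem exists_invariant_lift {X : Over (Spec (.of k))} {B : Type u} [CommRing B] [Algebra k B]
    (g : specOver k B ⟶ X) (hg : IsPiecewise g.left) (n : ℕ) (φ : SymTensor k (Fin n) B)
    (z : (fibrePower (specOver k B) n).left) :
    ∃ (O : (fibrePower X n).left.Opens) (H : Subgroup (Equiv.Perm (Fin n)))
      (ψ : Γ((fibrePower X n).left, O)) (O' : (fibrePower (specOver k B) n).left.Opens)
      (h : O' ≤ (fibrePowerMap g n).left ⁻¹ᵁ O),
      (∀ σ ∈ H, ∃ hσ : O ≤ (permute X σ).left ⁻¹ᵁ O, (permute X σ).left.appLE O O hσ ψ = ψ) ∧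
      (∀ σ, (permute X σ).left ((fibrePowerMap g n).left z) = (fibrePowerMap g n).left z → σ ∈ H) ∧
      z ∈ O' ∧ (fibrePowerMap g n).left.appLE O O' h ψ =
        (symSpecπ k B n).left.appLE ⊤ O' le_top (specSection (SymTensor k (Fin n) B) ⊤ φ) := by
  choose U N hNU hN hs using hg.exists_appLE_surjective
  let x (j : Fin n) : (specOver k B).left := (Pi.π (fun _ : Fin n => specOver k B) j).left z
  -- `a : A → C` is surjective, so that symmetric tensors lift along it; working with the products
  -- over all points of `Spec B` accounts for the charts at all the `x j` at once
  let A := ∀ x, Γ(X.left, U x)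
  let C := ∀ x, Γ((specOver k B).left, N x)
  let a : A →ₐ[k] C := AlgHom.pi fun x => (overAppLE g (U x) (N x) (hNU x)).comp (Pi.evalAlgHom k _ x)
  have ha : Function.Surjective a := fun c => by
    choose y hy using fun x => hs x (c x)
    exact ⟨y, funext hy⟩
  let b : B →ₐ[k] C := AlgHom.pi fun x => specSection B (N x)
  obtain ⟨ψ', hψ', hψφ⟩ := SymTensor.exists_map_eq a ha (y := TPow.map k b φ.1) (fun σ => by
    rw [← TPow.map_smul, φ.2 σ])
  -- the product of the charts at the `x j` is stable under the permutations in the subgroup `H`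
  -- preserving the family `x`, though not under all permutations
  let O : (fibrePower X n).left.Opens :=
    ⟨⋂ j, (Pi.π (fun _ : Fin n => X) j).left ⁻¹ᵁ (U (x j)),
      isOpen_iInter_of_finite fun j => ((Pi.π (fun _ : Fin n => X) j).left ⁻¹ᵁ (U (x j))).2⟩
  have hO (j) : O ≤ (Pi.π (fun _ : Fin n => X) j).left ⁻¹ᵁ (U (x j)) := fun y hy => Set.mem_iInter.mp hy j
  let O' : (fibrePower (specOver k B) n).left.Opens :=
    ⟨⋂ j, (Pi.π (fun _ : Fin n => specOver k B) j).left ⁻¹ᵁ (N (x j)),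
      isOpen_iInter_of_finite fun j => ((Pi.π (fun _ : Fin n => specOver k B) j).left ⁻¹ᵁ (N (x j))).2⟩
  have hO' (j) : O' ≤ (Pi.π (fun _ : Fin n => specOver k B) j).left ⁻¹ᵁ (N (x j)) :=
    fun y hy => Set.mem_iInter.mp hy j
  have hπ (j) (y) : (Pi.π (fun _ : Fin n => X) j).left ((fibrePowerMap g n).left y) =
      g.left ((Pi.π (fun _ : Fin n => specOver k B) j).left y) :=
    congrArg (fun f => f.left y) (fibrePowerMap_π g n j)
  have hπσ (σ) (j) (y) : (Pi.π (fun _ : Fin n => X) j).left ((permute X σ).left y) =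
      (Pi.π (fun _ : Fin n => X) (σ j)).left y :=
    congrArg (fun f => f.left y) (permute_π X σ j)
  have hOO' : O' ≤ (fibrePowerMap g n).left ⁻¹ᵁ O := fun y hy => Set.mem_iInter.mpr fun j => by
    change (Pi.π (fun _ : Fin n => X) j).left ((fibrePowerMap g n).left y) ∈ U (x j)
    rw [hπ]
    exact hNU _ (hO' j hy)
  let H : Subgroup (Equiv.Perm (Fin n)) :=
    { carrier := {σ | ∀ j, x (σ j) = x j}
      one_mem' := fun j => rfl
      mul_mem' := fun {σ τ} hσ hτ j => (hσ (τ j)).trans (hτ j)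
      inv_mem' := fun {σ} hσ j => (hσ (σ⁻¹ j)).symm.trans (congrArg x (σ.apply_symm_apply j)) }
  let θ : TPow k (Fin n) A →ₐ[k] Γ((fibrePower X n).left, O) := TPow.lift fun j =>
    (overAppLE (Pi.π (fun _ : Fin n => X) j) (U (x j)) O (hO j)).comp (Pi.evalAlgHom k _ (x j))
  let χ : TPow k (Fin n) C →ₐ[k] Γ((fibrePower (specOver k B) n).left, O') := TPow.lift fun j =>
    (overAppLE (Pi.π (fun _ : Fin n => specOver k B) j) (N (x j)) O' (hO' j)).comp
      (Pi.evalAlgHom k _ (x j))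
  have hθ (j) (c : A) : θ (PiTensorProduct.singleAlgHom (R := k) (A := fun _ : Fin n => A) j c) =
      (Pi.π (fun _ : Fin n => X) j).left.appLE (U (x j)) O (hO j) (c (x j)) := TPow.lift_single _ j c
  have hχ (j) (c : C) : χ (PiTensorProduct.singleAlgHom (R := k) (A := fun _ : Fin n => C) j c) =
      (Pi.π (fun _ : Fin n => specOver k B) j).left.appLE (N (x j)) O' (hO' j) (c (x j)) :=
    TPow.lift_single _ j c
  have h1 : (overAppLE (fibrePowerMap g n) O O' hOO').comp θ = χ.comp (TPow.map k a) := by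
    refine PiTensorProduct.algHom_ext fun j => AlgHom.ext fun c => ?_
    change (fibrePowerMap g n).left.appLE O O' hOO' (θ (PiTensorProduct.singleAlgHom (R := k) (A := fun _ : Fin n => A) j c)) =
      χ (TPow.map k a (PiTensorProduct.singleAlgHom (R := k) (A := fun _ : Fin n => A) j c))
    have hac : (a c) (x j) = g.left.appLE (U (x j)) (N (x j)) (hNU (x j)) (c (x j)) := rfl
    rw [hθ, TPow.map_single, hχ, hac]
    exact left_appLE_comm (fibrePowerMap_π g n j) _
  have h2 : χ.comp (TPow.map k b) = (overAppLE (fibrePowerSpecIso k B n).hom ⊤ O' le_top).comp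
      (specSection (TPow k (Fin n) B) ⊤) := by
    refine PiTensorProduct.algHom_ext fun j => AlgHom.ext fun c => ?_
    change χ (TPow.map k b (PiTensorProduct.singleAlgHom (R := k) (A := fun _ : Fin n => B) j c)) =
      (fibrePowerSpecIso k B n).hom.left.appLE ⊤ O' le_top
      (specSection (TPow k (Fin n) B) ⊤
        (PiTensorProduct.singleAlgHom (R := k) (A := fun _ : Fin n => B) j c))
    have hbc : (b c) (x j) = specSection B (N (x j)) c := rfl
    rw [TPow.map_single, hχ, hbc]
    refine (appLE_specSection _ _ _ _ _).trans ?_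
    rw [← appLE_specOverMap]
    exact (left_appLE_comp (fibrePowerSpecIso_hom_comp n j) _).symm
  refine ⟨O, H, θ ψ', O', hOO', fun σ hσ => ?_, fun σ hσ j => hg.bijective.1 ?_,
    Set.mem_iInter.mpr fun j => hN _, ?_⟩
  · have hσO : O ≤ (permute X σ).left ⁻¹ᵁ O := fun y hy => Set.mem_iInter.mpr fun j => by
      change (Pi.π (fun _ : Fin n => X) j).left ((permute X σ).left y) ∈ U (x j)
      rw [hπσ, ← hσ j]
      exact hO _ hy
    refine ⟨hσO, ?_⟩
    have h3 : (overAppLE (permute X σ) O O hσO).comp θ =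
        θ.comp (MulSemiringAction.toAlgHom k (TPow k (Fin n) A) σ) := by
      refine PiTensorProduct.algHom_ext fun j => AlgHom.ext fun c => ?_
      change (permute X σ).left.appLE O O hσO (θ (PiTensorProduct.singleAlgHom (R := k) (A := fun _ : Fin n => A) j c)) =
        θ (σ • (PiTensorProduct.singleAlgHom (R := k) (A := fun _ : Fin n => A) j c))
      rw [TPow.smul_single, hθ, hθ]
      have key {y y' : (specOver k B).left} (h : y = y')
          (h₁ : O ≤ (Pi.π (fun _ : Fin n => X) (σ j)).left ⁻¹ᵁ U y)
          (h₂ : O ≤ (Pi.π (fun _ : Fin n => X) (σ j)).left ⁻¹ᵁ U y') :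
          (Pi.π (fun _ : Fin n => X) (σ j)).left.appLE (U y) O h₁ (c y) =
            (Pi.π (fun _ : Fin n => X) (σ j)).left.appLE (U y') O h₂ (c y') := by
        subst h; rfl
      refine (left_appLE_comp (permute_π X σ j) _ (h₃ := ?_)).trans (key (hσ j).symm _ _)
      rw [← hσ j]
      exact hO _
    refine (DFunLike.congr_fun h3 ψ').trans ?_
    exact congrArg θ (hψ' σ)
  · change g.left ((Pi.π (fun _ : Fin n => specOver k B) (σ j)).left z) =
      g.left ((Pi.π (fun _ : Fin n => specOver k B) j).left z)
    rw [← hπ, ← hπ, ← hπσ, hσ]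
  · refine (DFunLike.congr_fun h1 ψ').trans ((congrArg χ hψφ).trans ((DFunLike.congr_fun h2 φ.1).trans ?_))
    refine Eq.trans ?_ (left_appLE_comp (f := (fibrePowerSpecIso k B n).hom)
      (p := specOverMap (SymTensor k (Fin n) B).val) (V := ⊤) (h₁ := le_top) (h₂ := le_top) rfl _)
    exact congrArg ((fibrePowerSpecIso k B n).hom.left.appLE ⊤ O' le_top)
      (appLE_specOverMap (SymTensor k (Fin n) B).val φ ⊤).symm

end Lifting

/-! ### Symmetric powers and piecewise isomorphisms -/

section SymPowerPiecewise

variable {k : Type u} [Field k]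

theorem FieldBijective.fibrePowerMap {Y Z : Over (Spec (.of k))} {g : Y ⟶ Z}
    (hg : FieldBijective g.left) (n : ℕ) : FieldBijective (fibrePowerMap g n).left := by
  intro K _
  constructor
  · intro x y hxy
    have hw : x ≫ (fibrePower Y n).hom = y ≫ (fibrePower Y n).hom := by
      rw [← Over.w (Motivic.fibrePowerMap g n), ← Category.assoc, ← Category.assoc]
      exact congrArg (· ≫ (fibrePower Z n).hom) hxy
    let x' : Over.mk (x ≫ (fibrePower Y n).hom) ⟶ fibrePower Y n := Over.homMk x rfl
    let y' : Over.mk (x ≫ (fibrePower Y n).hom) ⟶ fibrePower Y n := Over.homMk y hw.symm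
    suffices x' = y' from congrArg (fun f => f.left) this
    refine Pi.hom_ext _ _ fun i => ?_
    ext1
    refine (hg K).1 ?_
    have h1 : x' ≫ Motivic.fibrePowerMap g n = y' ≫ Motivic.fibrePowerMap g n := by
      exact Over.OverMorphism.ext hxy
    have h2 : x' ≫ Pi.π _ i ≫ g = y' ≫ Pi.π _ i ≫ g := by
      rw [← fibrePowerMap_π, reassoc_of% h1]
    exact congrArg (fun f => f.left) h2
  · intro y
    let y' : Over.mk (y ≫ (fibrePower Z n).hom) ⟶ fibrePower Z n := Over.homMk y rfl
    choose x hx using fun i => (hg K).2 (y' ≫ Pi.π _ i).left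
    let x' : Over.mk (y ≫ (fibrePower Z n).hom) ⟶ fibrePower Y n := Pi.lift fun i =>
      Over.homMk (x i) (by
        rw [← Over.w g, ← Category.assoc]
        exact (congrArg (· ≫ Z.hom) (hx i)).trans (Over.w (y' ≫ Pi.π _ i)))
    refine ⟨x'.left, ?_⟩
    suffices x' ≫ Motivic.fibrePowerMap g n = y' from congrArg (fun f => f.left) this
    refine Pi.hom_ext _ _ fun i => ?_
    rw [Category.assoc, fibrePowerMap_π, Pi.lift_π_assoc]
    ext1
    exact hx i

theorem IsGroupQuotient.hom_ext {G : Type*} [Group G] [Finite G] {Z Q Q' : Scheme.{u}} {ρ : G → (Z ⟶ Z)}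
    {π : Z ⟶ Q} (h : IsGroupQuotient ρ π) {a b : Q ⟶ Q'} (hab : π ≫ a = π ≫ b) : a = b := by
  have hbase : a.base = b.base := by
    ext q
    obtain ⟨z, rfl⟩ := h.surjective q
    exact congrArg (fun f => f z) hab
  refine Scheme.Hom.ext hbase fun U => ?_
  ext s
  refine h.app_injective _ ?_
  have key (f g : Q ⟶ Q') (hfg : π ≫ f = π ≫ g) (V : Q.Opens) (h₁ : V ≤ f ⁻¹ᵁ U) (h₂ : V ≤ g ⁻¹ᵁ U) :
      π.app V (f.appLE U V h₁ s) = π.app V (g.appLE U V h₂ s) := by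
    rw [Scheme.Hom.app_eq_appLE, appLE_appLE_apply, appLE_appLE_apply]
    exact appLE_congr_hom hfg s
  have h2 := key a b hab (b ⁻¹ᵁ U) (fun q hq => by
    change a.base q ∈ U
    rw [hbase]; exact hq) le_rfl
  rw [Scheme.Hom.appLE_eq_app] at h2
  exact h2

theorem evaluation_map {P : Scheme.{u}} {U V : P.Opens} (h : V ≤ U) {p : P} (hp : p ∈ V) (s : Γ(P, U)) :
    P.evaluation V p hp (P.presheaf.map (homOfLE h).op s) = P.evaluation U p (h hp) s := by
  refine congrArg (P.residue p) ?_
  exact TopCat.Presheaf.germ_res_apply P.presheaf (homOfLE h) p hp s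

/-- On an affine scheme, the residue fields consist of fractions of values of global functions. -/
theorem exists_evaluation_mul_eq {P : Scheme.{u}} [IsAffine P] (p : P) (c : P.residueField p) :
    ∃ a b : Γ(P, ⊤), P.evaluation ⊤ p trivial b ≠ 0 ∧
      c * P.evaluation ⊤ p trivial b = P.evaluation ⊤ p trivial a := by
  obtain ⟨s, rfl⟩ := P.residue_surjective p c
  obtain ⟨U, hU, s, rfl⟩ := TopCat.Presheaf.exists_germ_eq P.presheaf s
  obtain ⟨r, hr, hpr⟩ := (isAffineOpen_top P).exists_basicOpen_le ⟨p, hU⟩ trivial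
  have hloc : IsLocalization.Away r Γ(P, P.basicOpen r) := (isAffineOpen_top P).isLocalization_basicOpen r
  obtain ⟨⟨a, ⟨_, n, rfl⟩⟩, ha⟩ := IsLocalization.surj (Submonoid.powers r)
    (P.presheaf.map (homOfLE hr).op s)
  have hr0 : P.evaluation ⊤ p trivial r ≠ 0 := 
    (P.evaluation_ne_zero_iff_mem_basicOpen p (U := ⊤) trivial r).mpr hpr
  refine ⟨a, r ^ n, by rw [map_pow]; exact pow_ne_zero _ hr0, ?_⟩
  have h1 := congrArg (P.evaluation _ p hpr) ha
  rw [map_mul, evaluation_map hr] at h1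
  have h2 (x : Γ(P, ⊤)) : P.evaluation _ p hpr (algebraMap _ Γ(P, P.basicOpen r) x) =
    P.evaluation ⊤ p trivial x := evaluation_map le_top hpr x
  rw [h2, h2] at h1
  exact h1

/-- A function `φ` on `P` agrees near `z` with a function `ψ` on `Z`. If the value of `ψ` at `g z` is
a fraction of values of functions on `Q`, the value of `φ` lies in the residue field of `Q`. -/
theorem exists_residueFieldMap_eq {Z Z' P Q : Scheme.{u}} {g : Z' ⟶ Z} {π : Z ⟶ Q} {π' : Z' ⟶ P}
    {f : P ⟶ Q} (hf : π' ≫ f = g ≫ π) {z : Z'} {O : Z.Opens} {O' : Z'.Opens} (hz : z ∈ O')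
    {h : O' ≤ g ⁻¹ᵁ O} {ψ : Γ(Z, O)} {φ : Γ(P, ⊤)} (hφ : g.appLE O O' h ψ = π'.appLE ⊤ O' le_top φ)
    {V : Q.Opens} {W : Z.Opens} {hWO : W ≤ O} {hWV : W ≤ π ⁻¹ᵁ V} {hzW : g z ∈ W} {a b : Γ(Q, V)}
    (hb : b ∉ vanishingAt V (π (g z)) (hWV hzW))
    (hab : π.appLE V W hWV a - Z.presheaf.map (homOfLE hWO).op ψ * π.appLE V W hWV b ∈
      vanishingAt W (g z) hzW) :
    ∃ d, f.residueFieldMap (π' z) d = P.evaluation ⊤ (π' z) trivial φ := by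
  have hfz : f (π' z) = π (g z) := congrArg (fun e => e z) hf
  have hV : f (π' z) ∈ V := hfz ▸ hWV hzW
  have hV' : π' z ∈ f ⁻¹ᵁ V := hV
  let W' : Z'.Opens := g ⁻¹ᵁ W ⊓ O'
  have hzW' : z ∈ W' := ⟨hzW, hz⟩
  have hW'V : W' ≤ π' ⁻¹ᵁ (f ⁻¹ᵁ V) := fun y hy => by
    change (π' ≫ f) y ∈ V
    rw [hf]
    exact hWV hy.1
  have h1 (s : Γ(Q, V)) : π'.appLE _ W' hW'V (f.app V s) = g.appLE W W' inf_le_left (π.appLE V W hWV s) := by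
    rw [Scheme.Hom.app_eq_appLE, appLE_appLE_apply, appLE_appLE_apply]
    exact appLE_congr_hom hf s
  have h2 : π'.appLE _ W' hW'V (P.presheaf.map (homOfLE (le_top : f ⁻¹ᵁ V ≤ ⊤)).op φ) =
      g.appLE W W' inf_le_left (Z.presheaf.map (homOfLE hWO).op ψ) := by
    rw [map_appLE_apply, map_appLE_apply, ← appLE_map_apply (h := h) (h' := (inf_le_right : W' ≤ O')),
      hφ]
    exact (appLE_map_apply (h := le_top) (h' := (inf_le_right : W' ≤ O')) φ).symm
  have h3 : f.app V a - P.presheaf.map (homOfLE (le_top : f ⁻¹ᵁ V ≤ ⊤)).op φ * f.app V b ∈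
      vanishingAt (f ⁻¹ᵁ V) (π' z) hV' := by
    refine (appLE_mem_vanishingAt (h := hW'V) (hz := hzW')).mp ?_
    rw [map_sub, map_mul, h1, h1, h2, ← map_mul, ← map_sub]
    exact appLE_mem_vanishingAt.mpr hab
  have h4 : P.evaluation _ _ hV' (f.app V a) - P.evaluation _ _ hV'
      (P.presheaf.map (homOfLE (le_top : f ⁻¹ᵁ V ≤ ⊤)).op φ) * P.evaluation _ _ hV' (f.app V b) = 0 := by
    rw [← map_mul, ← map_sub]
    exact h3
  rw [evaluation_map] at h4
  have h5 (s : Γ(Q, V)) : f.residueFieldMap (π' z) (Q.evaluation V _ hV s) =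
      P.evaluation _ _ hV' (f.app V s) := Scheme.evaluation_naturality_apply f (π' z) hV s
  have hb' : Q.evaluation V _ hV b ≠ 0 := fun h0 => hb (by
    have h6 : b ∈ vanishingAt V (f (π' z)) hV := h0
    refine mem_vanishingAt.mpr fun h7 => mem_vanishingAt.mp h6 ?_
    rwa [hfz])
  refine ⟨Q.evaluation V _ hV a * (Q.evaluation V _ hV b)⁻¹, ?_⟩
  rw [map_mul, map_inv₀, h5, h5]
  have hb'' : P.evaluation _ _ hV' (f.app V b) ≠ 0 := by
    rw [← h5]
    exact (map_ne_zero _).mpr hb'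
  rw [mul_inv_eq_iff_eq_mul₀ hb'']
  exact sub_eq_zero.mp h4

/-- The value of a symmetric tensor at a point of the symmetric power of `Spec B` lies in the residue
field of the image in the symmetric power of `X`. -/
theorem exists_residueFieldMap_symSpec {X Q : Over (Spec (.of k))} {n : ℕ} {π : fibrePower X n ⟶ Q}
    (hπ : IsGroupQuotient (fun σ : Equiv.Perm (Fin n) => (permute X σ).left) π.left)
    {B : Type u} [CommRing B] [Algebra k B] (g : specOver k B ⟶ X) (hg : IsPiecewise g.left)
    {f : (specOver k (SymTensor k (Fin n) B)).left ⟶ Q.left}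
    (hf : (symSpecπ k B n).left ≫ f = (fibrePowerMap g n).left ≫ π.left)
    (z : (fibrePower (specOver k B) n).left) (φ : Γ((specOver k (SymTensor k (Fin n) B)).left, ⊤)) :
    ∃ d, f.residueFieldMap ((symSpecπ k B n).left z) d =
      (specOver k (SymTensor k (Fin n) B)).left.evaluation ⊤ ((symSpecπ k B n).left z) trivial φ := by
  obtain ⟨φ, rfl⟩ := (ConcreteCategory.bijective_of_isIso
    (Scheme.ΓSpecIso (.of (SymTensor k (Fin n) B))).inv).2 φ
  obtain ⟨O, H, ψ, O', h, hψ, hst, hz, heq⟩ := exists_invariant_lift g hg n φ z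
  generalize fibrePowerMap g n = gn at *
  obtain ⟨V, hV, hzV, -⟩ := exists_isAffineOpen_mem_and_subset (x := π.left (gn.left z)) (U := ⊤) trivial
  have hzW : gn.left z ∈ π.left ⁻¹ᵁ V ⊓ O := ⟨hzV, h hz⟩
  obtain ⟨u, v, hv, huv⟩ := hπ.exists_app_sub_mem hV H ψ hψ inf_le_right inf_le_left le_rfl hzW hst
  rw [specSection_top] at heq
  exact exists_residueFieldMap_eq hf hz heq hv huv

/-- A piecewise isomorphism from `Spec B` to `X` induces an equality of the classes of the symmetric
powers, since the induced morphism is a field bijection: orbits correspond to orbits, and the values of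
symmetric tensors lie in the residue fields of the target. -/
theorem symSpec_cls_eq {X : Over (Spec (.of k))} {n : ℕ} {Q : FTScheme k} (hQ : IsSymPower X n Q.obj)
    {B : Type u} [CommRing B] [Algebra k B] [Algebra.FiniteType k B] (g : specOver k B ⟶ X)
    (hg : IsPiecewise g.left) : cls (FTScheme.symSpec k B n) = cls Q := by
  obtain ⟨π, hπ⟩ := hQ
  rw [isSymQuotient_iff] at hπ
  have hπ' := isSymQuotient_iff.mp (isSymQuotient_symSpecπ (k := k) (B := B) n)
  let gn := fibrePowerMap g n
  let P := specOver k (SymTensor k (Fin n) B)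
  have hρ (σ) (z) : (permute X σ).left (gn.left z) = gn.left ((permute (specOver k B) σ).left z) :=
    congrArg (fun f => f.left z) (permute_fibrePowerMap g σ).symm
  obtain ⟨f, hf⟩ := hπ'.exists_desc (gn.left ≫ π.left) fun σ => by
    have h1 := congrArg (fun f => f.left) (permute_fibrePowerMap g σ)
    have h2 : (permute (specOver k B) σ).left ≫ gn.left = gn.left ≫ (permute X σ).left := h1
    rw [reassoc_of% h2, hπ.invariant]
  have hfover : f ≫ Q.obj.hom = P.hom := by
    refine hπ'.hom_ext ?_
    rw [reassoc_of% hf, Over.w π, Over.w gn, Over.w (symSpecπ k B n)]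
  let f' : (FTScheme.symSpec k B n).obj ⟶ Q.obj := Over.homMk f hfover
  have hgn := (hg.fieldBijective.fibrePowerMap n).bijective
  have hf1 (z) : f ((symSpecπ k B n).left z) = π.left (gn.left z) := congrArg (fun e => e z) hf
  refine FieldBijective.cls_eq f' (.of_bijective (f := f) ⟨fun p p' hpp => ?_, fun q => ?_⟩
    fun p c => ?_)
  · obtain ⟨z, rfl⟩ := hπ'.surjective p
    obtain ⟨z', rfl⟩ := hπ'.surjective p'
    rw [hf1, hf1] at hpp
    obtain ⟨σ, hσ⟩ := hπ.exists_apply_eq hpp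
    rw [hρ] at hσ
    rw [← hgn.1 hσ, hπ'.apply_apply]
  · obtain ⟨y, rfl⟩ := hπ.surjective q
    obtain ⟨z, rfl⟩ := hgn.2 y
    exact ⟨_, hf1 z⟩
  obtain ⟨z, rfl⟩ := hπ'.surjective p
  have key := exists_residueFieldMap_symSpec hπ g hg hf z
  have : IsAffine (specOver k (SymTensor k (Fin n) B)).left :=
    inferInstanceAs (IsAffine (Spec (.of (SymTensor k (Fin n) B))))
  obtain ⟨a, b, hb, hab⟩ := exists_evaluation_mul_eq ((symSpecπ k B n).left z) c
  obtain ⟨da, hda⟩ := key a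
  obtain ⟨db, hdb⟩ := key b
  refine ⟨da * db⁻¹, ?_⟩
  rw [map_mul, map_inv₀, hda, hdb, ← hab]
  exact mul_inv_cancel_right₀ hb c

end SymPowerPiecewise

/-! ### The zeta function of an algebra -/

section SpecClasses

variable {k : Type u} [Field k] {B C : Type u} [CommRing B] [CommRing C] [Algebra k B] [Algebra k C]
  [Algebra.FiniteType k B] [Algebra.FiniteType k C]

omit [Algebra.FiniteType k B] in
theorem specOverMap_id : specOverMap (AlgHom.id k B) = 𝟙 (specOver k B) := by
  ext1
  exact Spec.map_id _

/-- Isomorphic algebras have isomorphic spectra. -/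
def specOverIso (e : B ≃ₐ[k] C) : specOver k B ≅ specOver k C where
  hom := specOverMap e.symm.toAlgHom
  inv := specOverMap e.toAlgHom
  hom_inv_id := by
    rw [specOverMap_comp, ← specOverMap_id]
    congr 1
    ext; simp
  inv_hom_id := by
    rw [specOverMap_comp, ← specOverMap_id]
    congr 1
    ext; simp

theorem cls_spec_congr (e : B ≃ₐ[k] C) : cls (FTScheme.spec k B) = cls (FTScheme.spec k C) :=
  cls_eq_of_iso (specOverIso e)

theorem cls_spec_of_subsingleton [Subsingleton B] : cls (FTScheme.spec k B) = 0 := by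
  have : IsEmpty (FTScheme.spec k B).obj.left := inferInstanceAs (IsEmpty (PrimeSpectrum B))
  exact cls_eq_zero _

instance isOpenImmersion_specOverMap_fst : IsOpenImmersion (specOverMap (AlgHom.fst k B C)).left := by
  let := (RingHom.fst B C).toAlgebra
  have : IsOpenImmersion (Spec.map (CommRingCat.ofHom (RingHom.fst B C))) :=
    IsOpenImmersion.of_isLocalization (1, 0)
  exact this

instance isClosedImmersion_specOverMap_snd :
    IsClosedImmersion (specOverMap (AlgHom.snd k B C)).left :=
  IsClosedImmersion.spec_of_surjective (CommRingCat.ofHom (AlgHom.snd k B C).toRingHom)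
    Prod.snd_surjective

instance isOpenImmersion_specOverMap_snd : IsOpenImmersion (specOverMap (AlgHom.snd k B C)).left := by
  let := (RingHom.snd B C).toAlgebra
  have : IsOpenImmersion (Spec.map (CommRingCat.ofHom (RingHom.snd B C))) :=
    IsOpenImmersion.of_isLocalization (0, 1)
  exact this

omit [Algebra.FiniteType k B] [Algebra.FiniteType k C] in
theorem range_specOverMap_fst : Set.range (specOverMap (AlgHom.fst k B C)).left =
    (Set.range (specOverMap (AlgHom.snd k B C)).left)ᶜ := by
  have h1 : Set.range (specOverMap (AlgHom.fst k B C)).left =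
      coprodSpec B C '' Set.range (coprod.inl : Spec (.of B) ⟶ Spec (.of B) ⨿ Spec (.of C)) := by
    rw [← Set.range_comp]
    exact congrArg (fun f : Spec (.of B) ⟶ Spec (.of (B × C)) => Set.range f)
      (coprodSpec_inl B C).symm
  have h2 : Set.range (specOverMap (AlgHom.snd k B C)).left =
      coprodSpec B C '' Set.range (coprod.inr : Spec (.of C) ⟶ Spec (.of B) ⨿ Spec (.of C)) := by
    rw [← Set.range_comp]
    exact congrArg (fun f : Spec (.of C) ⟶ Spec (.of (B × C)) => Set.range f)
      (coprodSpec_inr B C).symm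
  rw [h1, h2, ← Set.image_compl_eq (f := coprodSpec B C) (coprodSpec B C).homeomorph.bijective,
    (isCompl_range_inl_inr (Spec (.of B)) (Spec (.of C))).symm.compl_eq]

theorem cls_spec_prod : cls (FTScheme.spec k (B × C)) =
    cls (FTScheme.spec k B) + cls (FTScheme.spec k C) :=
  cls_eq_add (X := FTScheme.spec k (B × C)) (U := FTScheme.spec k B) (Y := FTScheme.spec k C)
    (specOverMap (AlgHom.snd k B C)) (specOverMap (AlgHom.fst k B C)) range_specOverMap_fst

theorem cls_spec_pi {ι : Type} [Fintype ι] (A : ι → Type u) [∀ i, CommRing (A i)]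
    [∀ i, Algebra k (A i)] [∀ i, Algebra.FiniteType k (A i)] (e : B ≃ₐ[k] ∀ i, A i) :
    cls (FTScheme.spec k B) = ∑ i, cls (FTScheme.spec k (A i)) := by
  revert A B
  refine Fintype.induction_empty_option (P := fun ι _ => ∀ {B : Type u} [CommRing B] [Algebra k B]
    [Algebra.FiniteType k B] (A : ι → Type u) [∀ i, CommRing (A i)] [∀ i, Algebra k (A i)]
    [∀ i, Algebra.FiniteType k (A i)] (e : B ≃ₐ[k] ∀ i, A i),
    cls (FTScheme.spec k B) = ∑ i, cls (FTScheme.spec k (A i))) ?_ ?_ ?_ ι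
  · intro α β _ f ih B _ _ _ A _ _ _ e
    let := Fintype.ofEquiv β f.symm
    rw [ih (fun i => A (f i)) (e.trans (AlgEquiv.piCongrLeft k A f).symm)]
    exact f.sum_comp fun i => cls (FTScheme.spec k (A i))
  · intro B _ _ _ A _ _ _ e
    have : Subsingleton B := e.injective.subsingleton
    rw [cls_spec_of_subsingleton]
    rfl
  · intro α _ ih B _ _ _ A _ _ _ e
    let e' : B ≃ₐ[k] A none × ∀ i, A (some i) := e.trans
      (AlgEquiv.ofRingEquiv (f := RingEquiv.piOptionEquivProd) fun c => rfl)
    have : Algebra.FiniteType k (∀ i, A (some i)) :=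
      .of_surjective ((AlgHom.snd k _ _).comp e'.toAlgHom) (Prod.snd_surjective.comp e'.surjective)
    rw [cls_spec_congr e', cls_spec_prod, ih (fun i => A (some i)) AlgEquiv.refl,
      Fintype.sum_option]

instance finiteType_tensorProduct : Algebra.FiniteType k (B ⊗[k] C) :=
  have : Algebra.FiniteType B (B ⊗[k] C) := .baseChange B
  .trans (S := B) inferInstance inferInstance

theorem cls_spec_tensor : cls (FTScheme.spec k (B ⊗[k] C)) =
    cls (FTScheme.spec k B) * cls (FTScheme.spec k C) := by
  rw [← cls_prod]
  refine cls_eq_of_iso (Over.isoMk (pullbackSpecIso k B C).symm ?_)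
  change (pullbackSpecIso k B C).inv ≫ pullback.fst _ _ ≫ Spec.map _ = Spec.map _
  rw [pullbackSpecIso_inv_fst_assoc, ← Spec.map_comp, ← CommRingCat.ofHom_comp]

variable (k B) in
/-- The motivic zeta function of the spectrum of an algebra. -/
def specZeta : PowerSeries (K0 k) := PowerSeries.mk fun n => cls (FTScheme.symSpec k B n)

theorem specZeta_prod : specZeta k (B × C) = specZeta k B * specZeta k C := by
  ext n
  obtain ⟨e⟩ := SymTensor.nonempty_algEquiv_prod k B C n
  have h := cls_spec_pi (fun p : Finset.HasAntidiagonal.antidiagonal n =>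
    SymTensor k (Fin p.1.1) B ⊗[k] SymTensor k (Fin p.1.2) C) e
  simp only [cls_spec_tensor] at h
  rw [PowerSeries.coeff_mul, ← Finset.sum_coe_sort]
  simp only [specZeta, PowerSeries.coeff_mk]
  exact h

variable (k B) in
theorem coeff_zero_specZeta : PowerSeries.coeff 0 (specZeta k B) = 1 := by
  let e := PiTensorProduct.isEmptyEquiv (R := k) (s := fun _ : Fin 0 => B) (Fin 0)
  have : Nontrivial (TPow k (Fin 0) B) := e.toEquiv.nontrivial
  have hi : Function.Bijective (Algebra.ofId k (SymTensor k (Fin 0) B)) := by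
    refine ⟨(Algebra.ofId k (SymTensor k (Fin 0) B)).toRingHom.injective, fun x => ?_⟩
    refine ⟨e x.1, Subtype.ext (e.injective ?_)⟩
    change e (algebraMap k (TPow k (Fin 0) B) _) = _
    rw [Algebra.algebraMap_eq_smul_one, map_smul, PiTensorProduct.one_def]
    simp [e]
  have h1 : cls (FTScheme.symSpec k B 0) = cls (FTScheme.spec k k) :=
    (cls_spec_congr (AlgEquiv.ofBijective _ hi)).symm
  rw [specZeta, PowerSeries.coeff_mk, h1]
  have h2 : cls (FTScheme.spec k k) = cls (FTScheme.point k) :=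
    cls_eq_of_iso (Over.isoMk (Iso.refl (Spec (.of k))) (by
      change 𝟙 _ ≫ 𝟙 _ = Spec.map (𝟙 (CommRingCat.of k))
      rw [Spec.map_id, Category.comp_id]))
  exact h2

theorem specZeta_of_subsingleton [Subsingleton B] : specZeta k B = 1 := by
  ext n
  rw [PowerSeries.coeff_one]
  split_ifs with h
  · rw [h, coeff_zero_specZeta]
  · have h1 : Subsingleton (TPow k (Fin n) B) :=
      (PiTensorProduct.singleAlgHom (R := k) (A := fun _ : Fin n => B)
        ⟨0, Nat.pos_of_ne_zero h⟩).toRingHom.codomain_trivial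
    have h2 : Subsingleton (SymTensor k (Fin n) B) := Subtype.val_injective.subsingleton
    rw [specZeta, PowerSeries.coeff_mk, FTScheme.symSpec, cls_spec_of_subsingleton]

end SpecClasses

/-! ### Zeta functions of schemes by affine pieces -/

section PiecewiseZeta

variable {k : Type u} [Field k] {X Y : Over (Spec (.of k))}

/-- `F` is the zeta function of an affine scheme mapping bijectively onto the subset `S` of `X`
by a morphism which is an immersion locally on the source. -/
def HasPiecewiseZeta (X : Over (Spec (.of k))) (S : Set X.left) (F : PowerSeries (K0 k)) : Prop :=
  ∃ (B : Type u) (_ : CommRing B) (_ : Algebra k B) (_ : Algebra.FiniteType k B)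
    (g : specOver k B ⟶ X), Function.Injective g.left ∧ Set.range g.left = S ∧
    (∀ z, ∃ N : (specOver k B).left.Opens, z ∈ N ∧ IsImmersion (N.ι ≫ g.left)) ∧ specZeta k B = F

theorem IsPiecewise.of_isIso {Z X : Scheme.{u}} (f : Z ⟶ X) [IsIso f] : IsPiecewise f where
  bijective := f.homeomorph.bijective
  exists_isImmersion _ := ⟨⊤, trivial, inferInstance⟩

namespace HasPiecewiseZeta

theorem empty : HasPiecewiseZeta X ∅ 1 := by
  have : Algebra.FiniteType k PUnit.{u+1} :=
    .of_surjective (Algebra.ofId k PUnit.{u+1}) fun x => ⟨0, Subsingleton.elim _ _⟩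
  have : IsEmpty (specOver k PUnit.{u+1}).left := inferInstanceAs (IsEmpty (PrimeSpectrum PUnit))
  refine ⟨PUnit, inferInstance, inferInstance, inferInstance,
    Over.homMk (isInitialOfIsEmpty.to _) (isInitialOfIsEmpty.hom_ext _ _),
    Function.injective_of_subsingleton _, Set.range_eq_empty _, fun z => (this.false z).elim,
    specZeta_of_subsingleton⟩

/-- Zeta functions of disjoint subsets multiply, as the disjoint union of `Spec B` and `Spec C` is
`Spec (B × C)`. -/
theorem union {S T : Set X.left} {F G : PowerSeries (K0 k)} (hS : HasPiecewiseZeta X S F)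
    (hT : HasPiecewiseZeta X T G) (h : Disjoint S T) : HasPiecewiseZeta X (S ∪ T) (F * G) := by
  obtain ⟨B, _, _, _, g, hg, rfl, hg', rfl⟩ := hS
  obtain ⟨C, _, _, _, f, hf, rfl, hf', rfl⟩ := hT
  let q : Spec (.of (B × C)) ⟶ X.left :=
    inv (coprodSpec B C) ≫ coprod.desc (show Spec (.of B) ⟶ _ from g.left)
      (show Spec (.of C) ⟶ _ from f.left)
  have h1 : (specOverMap (AlgHom.fst k B C)).left ≫ q = g.left := by
    change Spec.map (CommRingCat.ofHom (RingHom.fst B C)) ≫ q = g.left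
    rw [← coprodSpec_inl, Category.assoc, IsIso.hom_inv_id_assoc]
    exact coprod.inl_desc _ _
  have h2 : (specOverMap (AlgHom.snd k B C)).left ≫ q = f.left := by
    change Spec.map (CommRingCat.ofHom (RingHom.snd B C)) ≫ q = f.left
    rw [← coprodSpec_inr, Category.assoc, IsIso.hom_inv_id_assoc]
    exact coprod.inr_desc _ _
  have hq : q ≫ X.hom = (specOver k (B × C)).hom := by
    rw [← cancel_epi (coprodSpec B C)]
    refine coprod.hom_ext ?_ ?_
    · rw [coprodSpec_inl_assoc, coprodSpec_inl_assoc]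
      exact ((Category.assoc _ _ _).symm.trans (congrArg (· ≫ X.hom) h1)).trans
        ((Over.w g).trans (Over.w (specOverMap (AlgHom.fst k B C))).symm)
    · rw [coprodSpec_inr_assoc, coprodSpec_inr_assoc]
      exact ((Category.assoc _ _ _).symm.trans (congrArg (· ≫ X.hom) h2)).trans
        ((Over.w f).trans (Over.w (specOverMap (AlgHom.snd k B C))).symm)
  have hcover (z : (specOver k (B × C)).left) :
      z ∈ Set.range (specOverMap (AlgHom.fst k B C)).left ∨
        z ∈ Set.range (specOverMap (AlgHom.snd k B C)).left := by
    rw [range_specOverMap_fst, or_comm]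
    exact Classical.em _
  have e1 (z) : q ((specOverMap (AlgHom.fst k B C)).left z) = g.left z :=
    congrArg (fun f => f z) h1
  have e2 (z) : q ((specOverMap (AlgHom.snd k B C)).left z) = f.left z :=
    congrArg (fun f => f z) h2
  -- a neighbourhood in one of the two open and closed parts is a neighbourhood in the union
  have himm {D : Over (Spec (.of k))} (p : D ⟶ specOver k (B × C)) [IsOpenImmersion p.left]
      (r : D ⟶ X) (hr : p.left ≫ q = r.left) (N : D.left.Opens) (hN : IsImmersion (N.ι ≫ r.left)) :
      IsImmersion ((p.left ''ᵁ N).ι ≫ q) := by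
    rw [← hr, ← Category.assoc, ← Scheme.Hom.isoImage_hom_ι, Category.assoc] at hN
    rw [← (p.left.isoImage N).inv_hom_id_assoc ((p.left ''ᵁ N).ι ≫ q)]
    infer_instance
  refine ⟨B × C, inferInstance, inferInstance, inferInstance, Over.homMk q hq, fun z z' hz => ?_,
    ?_, fun z => ?_, specZeta_prod⟩
  · change q z = q z' at hz
    rw [Set.disjoint_iff_forall_ne] at h
    obtain ⟨b, rfl⟩ | ⟨c, rfl⟩ := hcover z <;> obtain ⟨b', rfl⟩ | ⟨c', rfl⟩ := hcover z'
    · rw [e1, e1] at hz; rw [hg hz]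
    · rw [e1, e2] at hz; exact (h ⟨b, rfl⟩ ⟨c', rfl⟩ hz).elim
    · rw [e1, e2] at hz; exact (h ⟨b', rfl⟩ ⟨c, rfl⟩ hz.symm).elim
    · rw [e2, e2] at hz; rw [hf hz]
  · refine Set.Subset.antisymm ?_ (Set.union_subset ?_ ?_)
    · rintro _ ⟨z, rfl⟩
      change q z ∈ _
      obtain ⟨b, rfl⟩ | ⟨c, rfl⟩ := hcover z
      · exact .inl ⟨b, (e1 b).symm⟩
      · exact .inr ⟨c, (e2 c).symm⟩
    · rintro _ ⟨b, rfl⟩; exact ⟨_, e1 b⟩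
    · rintro _ ⟨c, rfl⟩; exact ⟨_, e2 c⟩
  · obtain ⟨b, rfl⟩ | ⟨c, rfl⟩ := hcover z
    · obtain ⟨N, hN, hN'⟩ := hg' b
      exact ⟨(specOverMap (AlgHom.fst k B C)).left ''ᵁ N, ⟨b, hN, rfl⟩, himm _ g h1 N hN'⟩
    · obtain ⟨N, hN, hN'⟩ := hf' c
      exact ⟨(specOverMap (AlgHom.snd k B C)).left ''ᵁ N, ⟨c, hN, rfl⟩, himm _ f h2 N hN'⟩

theorem image {S : Set X.left} {F : PowerSeries (K0 k)} (h : HasPiecewiseZeta X S F) (j : X ⟶ Y)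
    [IsImmersion j.left] : HasPiecewiseZeta Y (j.left '' S) F := by
  obtain ⟨B, _, _, _, g, hg, rfl, hg', rfl⟩ := h
  refine ⟨B, inferInstance, inferInstance, inferInstance, g ≫ j,
    j.left.isEmbedding.injective.comp hg, Set.range_comp j.left g.left, fun z => ?_, rfl⟩
  obtain ⟨N, hz, hN⟩ := hg' z
  refine ⟨N, hz, ?_⟩
  rw [Over.comp_left, ← Category.assoc]
  infer_instance

theorem specOver (B : Type u) [CommRing B] [Algebra k B] [Algebra.FiniteType k B] :
    HasPiecewiseZeta (Motivic.specOver k B) Set.univ (specZeta k B) :=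
  ⟨B, inferInstance, inferInstance, inferInstance, 𝟙 _, fun _ _ h => h, Set.range_id,
    fun z => ⟨⊤, trivial, by rw [Over.id_left]; infer_instance⟩, rfl⟩

theorem biUnion {ι : Type*} (s : Finset ι) {S : ι → Set X.left} {F : ι → PowerSeries (K0 k)}
    (h : ∀ i, HasPiecewiseZeta X (S i) (F i)) (hd : Pairwise (Function.onFun Disjoint S)) :
    HasPiecewiseZeta X (⋃ i ∈ s, S i) (∏ i ∈ s, F i) := by
  classical
  induction s using Finset.induction_on with
  | empty => simpa using empty
  | insert i s hi ih =>
    rw [Finset.prod_insert hi, Finset.set_biUnion_insert]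
    refine (h i).union ih ?_
    rw [Set.disjoint_iUnion₂_right]
    exact fun j hj => hd fun e => hi (e ▸ hj)

theorem exists_isPiecewise {F : PowerSeries (K0 k)} (h : HasPiecewiseZeta X Set.univ F) :
    ∃ (B : Type u) (_ : CommRing B) (_ : Algebra k B) (_ : Algebra.FiniteType k B)
      (g : Motivic.specOver k B ⟶ X), IsPiecewise g.left ∧ specZeta k B = F := by
  obtain ⟨B, _, _, _, g, hg, hr, hg', rfl⟩ := h
  exact ⟨B, inferInstance, inferInstance, inferInstance, g,
    ⟨⟨hg, Set.range_eq_univ.mp hr⟩, hg'⟩, rfl⟩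

/-- Where a symmetric power exists as a scheme, its class is a coefficient of the zeta function
computed by affine pieces. -/
theorem coeff_eq {F : PowerSeries (K0 k)} (h : HasPiecewiseZeta X Set.univ F) {n : ℕ}
    {Q : FTScheme k} (hQ : IsSymPower X n Q.obj) : PowerSeries.coeff n F = cls Q := by
  obtain ⟨B, _, _, _, g, hg, rfl⟩ := h.exists_isPiecewise
  rw [specZeta, PowerSeries.coeff_mk, symSpec_cls_eq hQ g hg]

theorem coeff_zero {S : Set X.left} {F : PowerSeries (K0 k)} (h : HasPiecewiseZeta X S F) :
    PowerSeries.coeff 0 F = 1 := by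
  obtain ⟨B, _, _, _, g, hg, rfl, hg', rfl⟩ := h
  exact coeff_zero_specZeta k B

end HasPiecewiseZeta

/-- A morphism locally of finite type from an affine scheme comes from an algebra of finite type. -/
theorem exists_specOver_hom (X : FTScheme k) {A : CommRingCat.{u}} (f : Spec A ⟶ X.obj.left)
    [LocallyOfFiniteType f] : ∃ (_ : Algebra k A) (_ : Algebra.FiniteType k A)
      (g : specOver k A ⟶ X.obj), g.left = f := by
  let φ : CommRingCat.of k ⟶ A := Spec.preimage (f ≫ X.obj.hom)
  have hφ : Spec.map φ = f ≫ X.obj.hom := Spec.map_preimage _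
  have : LocallyOfFiniteType (Spec.map φ) := by rw [hφ]; infer_instance
  let := φ.hom.toAlgebra
  exact ⟨inferInstance, finiteType_of_locallyOfFiniteType φ, Over.homMk f hφ.symm, rfl⟩

namespace HasPiecewiseZeta

/-- The zeta function computed by affine pieces is independent of the choice of the pieces. By
separatedness, the fibre product of two affine schemes over `X` is affine, and it refines both. -/
theorem unique {X : FTScheme k} [IsSeparated X.obj.hom] {F G : PowerSeries (K0 k)}
    (hF : HasPiecewiseZeta X.obj Set.univ F) (hG : HasPiecewiseZeta X.obj Set.univ G) : F = G := by
  obtain ⟨B, _, _, _, g, hg, rfl⟩ := hF.exists_isPiecewise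
  obtain ⟨C, _, _, _, f, hf, rfl⟩ := hG.exists_isPiecewise
  have hB : IsAffine (Motivic.specOver k B).left := inferInstanceAs (IsAffine (Spec (.of B)))
  have hC : IsAffine (Motivic.specOver k C).left := inferInstanceAs (IsAffine (Spec (.of C)))
  have : IsAffineHom (g.left ≫ X.obj.hom) := by
    rw [Over.w g]
    exact inferInstanceAs (IsAffineHom (Spec.map _))
  have : IsAffineHom g.left := .of_comp g.left X.obj.hom
  let P := pullback g.left f.left
  have : IsAffine P := isAffine_of_isAffineHom (pullback.snd g.left f.left)
  have hlft (Y : FTScheme k) (r : Y.obj ⟶ X.obj) : LocallyOfFiniteType r.left := inferInstance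
  have : LocallyOfFiniteType g.left := hlft (FTScheme.spec k B) g
  obtain ⟨_, _, q, hq⟩ := exists_specOver_hom (FTScheme.spec k C) (A := Γ(P, ⊤))
    (P.isoSpec.inv ≫ pullback.snd g.left f.left)
  let p : Motivic.specOver k Γ(P, ⊤) ⟶ Motivic.specOver k B :=
    Over.homMk (P.isoSpec.inv ≫ pullback.fst g.left f.left) (by
      rw [← Over.w q, hq, ← Over.w g, ← Over.w f, Category.assoc, Category.assoc,
        pullback.condition_assoc])
  have hp : IsPiecewise p.left :=
    (IsPiecewise.of_isIso P.isoSpec.inv).comp (hf.of_isPullback (IsPullback.of_hasPullback _ _).flip)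
  have hq : IsPiecewise q.left := by
    rw [hq]
    exact (IsPiecewise.of_isIso P.isoSpec.inv).comp
      (hg.of_isPullback (IsPullback.of_hasPullback _ _))
  ext n
  simp only [specZeta, PowerSeries.coeff_mk]
  rw [← symSpec_cls_eq (isSymPower_symSpec n) p hp, symSpec_cls_eq (isSymPower_symSpec n) q hq]

end HasPiecewiseZeta

end PiecewiseZeta

/-! ### Classes of symmetric powers through affine pieces -/

section SymClass

variable {k : Type u} [Field k]

/-- A decomposition into finitely many affine locally closed subschemes. -/
theorem exists_affine_stratification (X : FTScheme k) :
    ∃ (r : ℕ) (s : Fin r → Σ B : CommAlgCat.{u} k, (specOver k B ⟶ X.obj)),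
      (∀ i, Algebra.FiniteType k (s i).1 ∧ IsImmersion (s i).2.left) ∧
      ∀ x, ∃! i, x ∈ Set.range (s i).2.left := by
  induction X using FTScheme.induction with
  | red X ih =>
    obtain ⟨r, s, hs, hx⟩ := ih
    refine ⟨r, fun i => ⟨(s i).1, (s i).2 ≫ X.redι ⊤⟩, fun i => ⟨(hs i).1, ?_⟩, fun x => ?_⟩
    · have := (hs i).2
      rw [Over.comp_left]
      infer_instance
    · have hx' : x ∈ Set.range (X.redι ⊤).left := by rw [X.range_redι]; trivial
      obtain ⟨x, rfl⟩ := hx'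
      have key (i) : (X.redι ⊤).left x ∈ Set.range ((s i).2 ≫ X.redι ⊤).left ↔
          x ∈ Set.range (s i).2.left :=
        ⟨fun ⟨y, hy⟩ => ⟨y, (X.redι ⊤).left.isClosedEmbedding.injective hy⟩,
          fun ⟨y, hy⟩ => ⟨y, congrArg (X.redι ⊤).left hy⟩⟩
      simpa only [key] using hx x
  | closed X _ ih =>
    cases isEmpty_or_nonempty X.obj.left
    · exact ⟨0, Fin.elim0, fun i => i.elim0, fun x => isEmptyElim x⟩
    obtain ⟨x₀⟩ := ‹Nonempty X.obj.left›
    obtain ⟨A, f, hf, y₀, hy₀⟩ : ∃ (A : CommRingCat.{u}) (f : Spec A ⟶ X.obj.left),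
        IsOpenImmersion f ∧ x₀ ∈ Set.range f :=
      ⟨_, X.obj.left.affineCover.f (X.obj.left.affineCover.idx x₀),
        X.obj.left.affineCover.map_prop _, X.obj.left.affineCover.covers x₀⟩
    obtain ⟨_, hft, g, hg⟩ := exists_specOver_hom X f
    let W : X.obj.left.Opens := f.opensRange
    have hW : W.compl ≠ ⊤ := fun h => by
      have : x₀ ∈ W.compl := by rw [h]; trivial
      exact this ⟨y₀, hy₀⟩
    obtain ⟨r, s, hs, hx⟩ := ih W.compl hW
    have hgr : Set.range g.left = W := by
      rw [hg]; rfl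
    have hgi : IsOpenImmersion g.left := by
      rw [hg]; infer_instance
    refine ⟨r + 1, Fin.cons ⟨.of k _, g⟩ fun i => ⟨(s i).1, (s i).2 ≫ X.redι W.compl⟩, ?_, fun x => ?_⟩
    · refine Fin.cases ⟨hft, (inferInstance : IsImmersion g.left)⟩ fun i => ⟨(hs i).1, ?_⟩
      have := (hs i).2
      change IsImmersion (((s i).2 ≫ X.redι W.compl).left)
      rw [Over.comp_left]
      infer_instance
    · have hr := X.range_redι W.compl
      have hsub (i) : Set.range ((s i).2 ≫ X.redι W.compl).left ⊆ (W : Set X.obj.left)ᶜ := by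
        rintro _ ⟨y, rfl⟩
        have : (X.redι W.compl).left ((s i).2.left y) ∈ Set.range (X.redι W.compl).left := ⟨_, rfl⟩
        rw [hr] at this
        exact this
      by_cases hxW : x ∈ W
      · refine ⟨0, by rw [← SetLike.mem_coe, ← hgr] at hxW; exact hxW, ?_⟩
        refine Fin.cases (fun _ => rfl) fun i hi => ?_
        exact (hsub i hi hxW).elim
      · have hx' : x ∈ Set.range (X.redι W.compl).left := by rw [hr]; exact hxW
        obtain ⟨x, rfl⟩ := hx'
        have key (i) : (X.redι W.compl).left x ∈ Set.range ((s i).2 ≫ X.redι W.compl).left ↔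
            x ∈ Set.range (s i).2.left :=
          ⟨fun ⟨y, hy⟩ => ⟨y, (X.redι W.compl).left.isClosedEmbedding.injective hy⟩,
            fun ⟨y, hy⟩ => ⟨y, congrArg (X.redι W.compl).left hy⟩⟩
        obtain ⟨i, hi, hi'⟩ := hx x
        refine ⟨i.succ, (key i).mpr hi, ?_⟩
        refine Fin.cases (fun h => ?_) fun j hj => ?_
        · refine (hxW ?_).elim
          rw [← SetLike.mem_coe, ← hgr]
          exact h
        · rw [hi' j ((key j).mp hj)]

theorem pairwise_disjoint_of_existsUnique {ι α : Type*} {S : ι → Set α} (h : ∀ x, ∃! i, x ∈ S i) :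
    Pairwise (Function.onFun Disjoint S) := fun _ _ hij =>
  Set.disjoint_left.mpr fun x hi hj => hij ((h x).unique hi hj)

/-- Every scheme of finite type has an affine scheme mapping to it by a piecewise isomorphism. -/
theorem exists_hasPiecewiseZeta (X : FTScheme k) : ∃ F, HasPiecewiseZeta X.obj Set.univ F := by
  obtain ⟨r, s, hs, hx⟩ := exists_affine_stratification X
  have := fun i => (hs i).1
  have := fun i => (hs i).2
  refine ⟨∏ i, specZeta k (s i).1, ?_⟩
  have h := HasPiecewiseZeta.biUnion Finset.univ
    (fun i => (HasPiecewiseZeta.specOver (s i).1).image (s i).2)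
    (by simpa only [Set.image_univ] using pairwise_disjoint_of_existsUnique hx)
  convert h
  symm
  rw [Set.eq_univ_iff_forall]
  intro x
  obtain ⟨i, hi, -⟩ := hx x
  simp only [Set.mem_iUnion, Set.image_univ]
  exact ⟨i, Finset.mem_univ i, hi⟩

/-- The class computed by any admissible decomposition is a coefficient of the zeta function computed
by affine pieces. -/
theorem IsStratifiedSymClass.eq_coeff {X : FTScheme k} [IsSeparated X.obj.hom]
    {F : PowerSeries (K0 k)} (hF : HasPiecewiseZeta X.obj Set.univ F) {n : ℕ} {c : K0 k}
    (h : IsStratifiedSymClass X.obj n c) : c = PowerSeries.coeff n F := by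
  obtain ⟨r, Z, j, Q, hj, hx, hQ, rfl⟩ := h
  have hG (i) : ∃ G, HasPiecewiseZeta (Z i) Set.univ G := by
    have h1 : TopologicalSpace.NoetherianSpace (Z i).left :=
      (j i).left.isEmbedding.isInducing.noetherianSpace
    have h3 : QuasiCompact (Z i).hom :=
      { isCompact_preimage := fun _ _ _ => TopologicalSpace.NoetherianSpace.isCompact _ }
    have h2 : LocallyOfFiniteType (Z i).hom := by
      rw [← Over.w (j i)]; infer_instance
    exact exists_hasPiecewiseZeta { obj := Z i }
  choose G hG using hG
  have h := HasPiecewiseZeta.biUnion Finset.univ (fun i => (hG i).image (j i))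
    (by simpa only [Set.image_univ] using pairwise_disjoint_of_existsUnique hx)
  have hu : ⋃ i ∈ Finset.univ, (j i).left '' Set.univ = Set.univ := by
    rw [Set.eq_univ_iff_forall]
    intro x
    obtain ⟨i, hi, -⟩ := hx x
    simp only [Set.mem_iUnion, Set.image_univ]
    exact ⟨i, Finset.mem_univ i, hi⟩
  rw [hu] at h
  rw [hF.unique h, PowerSeries.coeff_prod]
  simp only [fun i m => ((hG i).coeff_eq (hQ i m)).symm]
  symm
  -- the coefficient of a product is indexed by finitely supported functions, the class of a
  -- decomposition by functions
  refine Finset.sum_nbij (fun l => ⇑l) (fun l hl => ?_) DFunLike.coe_injective.injOn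
    (fun a ha => ?_) fun _ _ => rfl
  · rw [Finset.mem_finsuppAntidiag] at hl
    exact Finset.mem_piAntidiag.mpr ⟨hl.1, fun i _ => Finset.mem_univ i⟩
  · rw [Finset.mem_coe, Finset.mem_piAntidiag] at ha
    exact ⟨Finsupp.equivFunOnFinite.symm a, Finset.mem_coe.mpr (Finset.mem_finsuppAntidiag.mpr
      ⟨ha.1, Finset.subset_univ _⟩), rfl⟩

theorem exists_isStratifiedSymClass (X : FTScheme k) (n : ℕ) :
    ∃ c, IsStratifiedSymClass X.obj n c := by
  obtain ⟨r, s, hs, hx⟩ := exists_affine_stratification X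
  have := fun i => (hs i).1
  exact ⟨_, r, fun i => specOver k (s i).1, fun i => (s i).2, fun i => FTScheme.symSpec k (s i).1,
    fun i => (hs i).2, hx, fun i => isSymPower_symSpec, rfl⟩

/-- The motivic zeta function is computed by affine pieces, whether or not the symmetric powers of `X`
are schemes. -/
theorem motivicZeta_eq {X : FTScheme k} [IsSeparated X.obj.hom]
    {F : PowerSeries (K0 k)} (hF : HasPiecewiseZeta X.obj Set.univ F) : motivicZeta X.obj = F := by
  ext n
  rw [motivicZeta, PowerSeries.coeff_mk, symClass]
  split_ifs with h1 h2
  · exact (hF.coeff_eq h1.choose_spec).symm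
  · exact h2.choose_spec.eq_coeff hF
  · exact (h2 (exists_isStratifiedSymClass X n)).elim

end SymClass

/-! ### Dimensions of open and closed subsets -/

section Dimension

/-- By Noether normalization, the dimension of a finitely generated domain over a field is its
transcendence degree. -/
theorem exists_ringKrullDim_eq_trdeg (k A : Type u) [Field k] [CommRing A] [IsDomain A] [Algebra k A]
    [Algebra.FiniteType k A] : ∃ s : ℕ, ringKrullDim A = s ∧ Algebra.trdeg k A = s := by
  obtain ⟨s, f, hf, hf'⟩ := exists_integral_inj_algHom_of_fg k A
  refine ⟨s, ?_, ?_⟩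
  · rw [← le_antisymm (ringKrullDim_ge_of_isIntegral' f.toRingHom hf' hf)
      (ringKrullDim_le_of_isIntegral' f.toRingHom hf')]
    simp
  · algebraize [f.toRingHom]
    have : IsScalarTower k (MvPolynomial (Fin s) k) A := .of_algebraMap_eq' f.comp_algebraMap.symm
    have : FaithfulSMul (MvPolynomial (Fin s) k) A := (faithfulSMul_iff_algebraMap_injective _ _).mpr hf
    have : Algebra.IsAlgebraic (MvPolynomial (Fin s) k) A := Algebra.IsIntegral.isAlgebraic
    rw [← trdeg_add_eq k (MvPolynomial (Fin s) k) (A := A), trdeg_eq_zero (R := MvPolynomial (Fin s) k) (A := A), add_zero,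
      MvPolynomial.trdeg_of_isDomain]
    simp

/-- Localizing a finitely generated domain at one element does not change the dimension, as
the transcendence degree does not change. -/
theorem ringKrullDim_eq_of_isLocalizationAway (k : Type u) {A B : Type u} [Field k] [CommRing A]
    [CommRing B] [IsDomain A] [IsDomain B] [Algebra k A] [Algebra k B] [Algebra A B] [IsScalarTower k A B]
    [Algebra.FiniteType k A] [Algebra.FiniteType k B] (f : A) (hf : f ≠ 0) [IsLocalization.Away f B] :
    ringKrullDim B = ringKrullDim A := by
  obtain ⟨s, hs, hs'⟩ := exists_ringKrullDim_eq_trdeg k A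
  obtain ⟨t, ht, ht'⟩ := exists_ringKrullDim_eq_trdeg k B
  have : FaithfulSMul A B := (faithfulSMul_iff_algebraMap_injective _ _).mpr
    (IsLocalization.injective B (powers_le_nonZeroDivisors_of_noZeroDivisors hf))
  have : Algebra.IsAlgebraic A B := IsLocalization.isAlgebraic B (Submonoid.powers f)
  have h := trdeg_add_eq k A (A := B)
  rw [trdeg_eq_zero (R := A) (A := B), add_zero, hs', ht'] at h
  rw [hs, ht, Nat.cast_injective h]

variable {k : Type u} [Field k]

attribute [local instance] sectionAlgebra in
theorem ringKrullDim_section_basicOpen (X : FTScheme k) [IsIntegral X.obj.left]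
    {V : X.obj.left.Opens} (hV : IsAffineOpen V) (f : Γ(X.obj.left, V))
    (hf : Nonempty (X.obj.left.basicOpen f)) :
    ringKrullDim Γ(X.obj.left, X.obj.left.basicOpen f) = ringKrullDim Γ(X.obj.left, V) := by
  have hft {W : X.obj.left.Opens} (hW : IsAffineOpen W) : Algebra.FiniteType k Γ(X.obj.left, W) := by
    have h1 := X.obj.hom.finiteType_appLE (isAffineOpen_top (Spec (.of k))) hW le_top
    exact h1.comp (RingHom.FiniteType.of_surjective _
      (ConcreteCategory.bijective_of_isIso (Scheme.ΓSpecIso (.of k)).inv).2)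
  have h1 := hft hV
  have h2 := hft (hV.basicOpen f)
  have : Nonempty V := hf.map fun x => ⟨x.1, X.obj.left.basicOpen_le f x.2⟩
  have : IsScalarTower k Γ(X.obj.left, V) Γ(X.obj.left, X.obj.left.basicOpen f) := by
    refine .of_algebraMap_eq' (RingHom.ext fun c => ?_)
    exact (appLE_map_apply (f := X.obj.hom) (U := ⊤) (V := V) (h := le_top)
      (h' := X.obj.left.basicOpen_le f) ((Scheme.ΓSpecIso (.of k)).inv c)).symm
  have := hV.isLocalization_basicOpen f
  refine ringKrullDim_eq_of_isLocalizationAway k f ?_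
  rintro rfl
  obtain ⟨x, hx⟩ := hf
  simp at hx

theorem _root_.AlgebraicGeometry.IsAffineOpen.topologicalKrullDim_eq {X : Scheme.{u}} {V : X.Opens}
    (hV : IsAffineOpen V) : topologicalKrullDim V = ringKrullDim Γ(X, V) :=
  hV.isoSpec.hom.homeomorph.isHomeomorph.topologicalKrullDim_eq.trans
    (PrimeSpectrum.topologicalKrullDim_eq_ringKrullDim _)

/-- A nonempty open subset of an integral scheme of finite type over a field has the same dimension:
two affine open subsets have a common basic open subset. -/
theorem topologicalKrullDim_opens (X : FTScheme k) [IsIntegral X.obj.left] (U : X.obj.left.Opens)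
    (hU : (U : Set X.obj.left).Nonempty) :
    topologicalKrullDim U = topologicalKrullDim X.obj.left := by
  have key {V W : X.obj.left.Opens} (hV : IsAffineOpen V) (hW : IsAffineOpen W)
      (hVn : (V : Set X.obj.left).Nonempty) (hWn : (W : Set X.obj.left).Nonempty) :
      topologicalKrullDim V = topologicalKrullDim W := by
    obtain ⟨x, hxV, hxW⟩ := nonempty_preirreducible_inter V.2 W.2 hVn hWn
    obtain ⟨f, g, hfg, hx⟩ := exists_basicOpen_le_affine_inter hV hW x ⟨hxV, hxW⟩
    rw [hV.topologicalKrullDim_eq, hW.topologicalKrullDim_eq,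
      ← ringKrullDim_section_basicOpen X hV f ⟨x, hx⟩,
      ← ringKrullDim_section_basicOpen X hW g ⟨x, hfg ▸ hx⟩, hfg]
  refine le_antisymm U.isOpenEmbedding'.isInducing.topologicalKrullDim_le ?_
  obtain ⟨x, hx⟩ := hU
  obtain ⟨V, hV, hxV, hVU⟩ := exists_isAffineOpen_mem_and_subset hx
  refine topologicalKrullDim_le_of_cover (ι := {W : X.obj.left.affineOpens // (W.1 : Set X.obj.left).Nonempty})
    (Y := fun W => W.1.1) (fun W => Subtype.val) (fun W => W.1.1.isOpenEmbedding') (fun y => ?_) _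
    fun W => ?_
  · obtain ⟨W, hW, hyW, -⟩ := exists_isAffineOpen_mem_and_subset (U := ⊤) (TopologicalSpace.Opens.mem_top y)
    exact ⟨⟨⟨W, hW⟩, ⟨y, hyW⟩⟩, ⟨y, hyW⟩, rfl⟩
  · rw [key W.1.2 hV W.2 ⟨x, hxV⟩]
    exact (Topology.IsInducing.of_comp (continuous_inclusion hVU) continuous_subtype_val
      .subtypeVal).topologicalKrullDim_le

theorem topologicalKrullDim_lt_of_isClosedEmbedding {X Y : Type*} [TopologicalSpace X]
    [TopologicalSpace Y] [IrreducibleSpace X] {f : Y → X} (hf : IsClosedEmbedding f)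
    (hs : ¬ Function.Surjective f) {d : ℕ} (hd : topologicalKrullDim X ≤ d) :
    topologicalKrullDim Y < d := by
  let T : TopologicalSpace.IrreducibleCloseds X := ⟨Set.univ, IrreducibleSpace.isIrreducible_univ X, isClosed_univ⟩
  refine Order.krullDim_lt_coe_iff.mpr fun p => ?_
  let q := p.map _ (TopologicalSpace.IrreducibleCloseds.map_strictMono_of_isInducing hf.isInducing)
  have hq : q.last < T := by
    refine lt_of_le_of_ne (fun _ _ => trivial) fun h => hs (Set.range_eq_univ.mp ?_)
    have h1 : closure (f '' p.last) = Set.univ := congrArg SetLike.coe h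
    rw [← Set.univ_subset_iff, ← h1]
    exact closure_minimal (Set.image_subset_range _ _) hf.isClosed_range
  have := (Order.LTSeries.length_le_krullDim (q.snoc T hq)).trans hd
  have h2 : q.length + 1 ≤ d := by exact_mod_cast this
  exact h2

end Dimension

/-! ### Convolutions in a filtered ring -/

/-- An exhaustive filtration of a topological ring which defines its topology. -/
structure IsRingFiltration {R : Type*} [CommRing R] [TopologicalSpace R] (F : ℤ → AddSubgroup R) :
    Prop where
  mono : Monotone F
  mul_mem : ∀ {m n x y}, x ∈ F m → y ∈ F n → x * y ∈ F (m + n)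
  exists_mem : ∀ x, ∃ m, x ∈ F m
  hasBasis : (𝓝 (0 : R)).HasBasis (fun _ : ℤ => True) fun m => (F m : Set R)

namespace IsRingFiltration

variable {R : Type*} [CommRing R] {F : ℤ → AddSubgroup R}

theorem tendsto_zero [TopologicalSpace R] (hF : IsRingFiltration F) {b : ℕ → R}
    (hb : ∀ n : ℕ, b n ∈ F (-n)) : Tendsto b atTop (𝓝 0) := by
  rw [hF.hasBasis.tendsto_right_iff]
  intro m _
  filter_upwards [eventually_ge_atTop m.natAbs] with n hn
  exact hF.mono (by omega) (hb n)

theorem summable [UniformSpace R] [IsUniformAddGroup R] [CompleteSpace R] (hF : IsRingFiltration F)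
    {b : ℕ → R} (hb : ∀ n : ℕ, b n ∈ F (-n)) : Summable b := by
  have : NonarchimedeanAddGroup R :=
    { is_nonarchimedean := fun U hU => by
        obtain ⟨m, -, hm⟩ := hF.hasBasis.mem_iff.mp hU
        exact ⟨⟨F m, (F m).isOpen_of_mem_nhds (hF.hasBasis.mem_of_mem trivial)⟩, hm⟩ }
  refine NonarchimedeanAddGroup.summable_of_tendsto_cofinite_zero ?_
  rw [Nat.cofinite_eq_atTop]
  exact hF.tendsto_zero hb

/-- The convolution of a null sequence with a rapidly decreasing sequence is a null sequence. -/
theorem tendsto_convolution_zero [TopologicalSpace R] (hF : IsRingFiltration F) {b a : ℕ → R}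
    (hb : ∀ n : ℕ, b n ∈ F (-n)) (ha : Tendsto a atTop (𝓝 0)) :
    Tendsto (fun n => ∑ p ∈ Finset.HasAntidiagonal.antidiagonal n, b p.1 * a p.2) atTop (𝓝 0) := by
  have hbound : ∃ M, ∀ n, a n ∈ F M := by
    obtain ⟨N, hN⟩ := eventually_atTop.mp (hF.hasBasis.tendsto_right_iff.mp ha 0 trivial)
    choose m hm using fun n => hF.exists_mem (a n)
    refine ⟨((Finset.range N).sup fun n => (m n).toNat : ℕ), fun n => ?_⟩
    rcases lt_or_ge n N with h | h
    · have := Finset.le_sup (f := fun n => (m n).toNat) (Finset.mem_range.mpr h)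
      exact hF.mono (by have := (m n).self_le_toNat; omega) (hm n)
    · exact hF.mono (by omega) (hN n h)
  -- when `n` is large, either `p.2` is large and `a p.2` is small, or `p.1` is large and `b p.1` is
  -- small enough to compensate the bound for `a`
  obtain ⟨M, hM⟩ := hbound
  rw [hF.hasBasis.tendsto_right_iff] at ha ⊢
  intro m _
  obtain ⟨N, hN⟩ := eventually_atTop.mp (ha m trivial)
  filter_upwards [eventually_ge_atTop (N + (M - m).toNat)] with n hn
  refine sum_mem fun p hp => ?_
  rw [Finset.HasAntidiagonal.mem_antidiagonal] at hp
  obtain h | h := lt_or_ge p.2 N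
  · refine hF.mono ?_ (hF.mul_mem (hb p.1) (hM p.2))
    have := (M - m).self_le_toNat
    omega
  · exact hF.mono (by omega) (hF.mul_mem (hb p.1) (hN p.2 h))

/-- Write `a` as the sum of a null sequence and the constant `ℓ`, whose convolution with `b` has the
partial sums of `b` times `ℓ` as terms. -/
theorem tendsto_convolution [UniformSpace R] [IsUniformAddGroup R] [IsTopologicalRing R]
    [CompleteSpace R] (hF : IsRingFiltration F) {b a : ℕ → R} (hb : ∀ n : ℕ, b n ∈ F (-n)) {ℓ : R}
    (ha : Tendsto a atTop (𝓝 ℓ)) :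
    Tendsto (fun n => ∑ p ∈ Finset.HasAntidiagonal.antidiagonal n, b p.1 * a p.2) atTop
      (𝓝 ((∑' n, b n) * ℓ)) := by
  have h1 := hF.tendsto_convolution_zero hb (a := fun n => a n - ℓ) (by simpa using ha.sub_const ℓ)
  have h2 := ((hF.summable hb).hasSum.tendsto_sum_nat.comp (tendsto_add_atTop_nat 1)).mul_const ℓ
  refine (by simpa using h1.add h2 : Tendsto _ _ _).congr fun n => ?_
  simp only [mul_sub, Finset.sum_sub_distrib, ← Finset.sum_mul]
  rw [Finset.Nat.sum_antidiagonal_eq_sum_range_succ_mk (fun p : ℕ × ℕ => b p.1)]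
  abel

/-- The inverse of a power series with constant coefficient `1` and rapidly decreasing coefficients
has rapidly decreasing coefficients. -/
theorem coeff_mem_of_mul_eq_one [TopologicalSpace R] (hF : IsRingFiltration F) {f g : PowerSeries R}
    (hfg : f * g = 1) (hf0 : PowerSeries.coeff 0 f = 1)
    (hf : ∀ n : ℕ, PowerSeries.coeff n f ∈ F (-n)) (n : ℕ) : PowerSeries.coeff n g ∈ F (-n) := by
  induction n using Nat.strong_induction_on with
  | _ n ih =>
    have h := congrArg (PowerSeries.coeff n) hfg
    rw [PowerSeries.coeff_mul, ← Finset.add_sum_erase _ _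
      (Finset.HasAntidiagonal.mem_antidiagonal.mpr (zero_add n) : (0, n) ∈ _), hf0, one_mul] at h
    rw [eq_sub_of_add_eq h]
    refine sub_mem ?_ (sum_mem fun p hp => ?_)
    · rw [PowerSeries.coeff_one]
      split_ifs with h0
      · rw [h0, ← hf0]; exact hf 0
      · exact zero_mem _
    · rw [Finset.mem_erase, Finset.HasAntidiagonal.mem_antidiagonal] at hp
      have h1 : p.1 ≠ 0 := fun h0 => hp.1 (Prod.ext h0 (by simpa [h0] using hp.2))
      have := hF.mul_mem (hf p.1) (ih p.2 (by omega))
      rwa [show (-(p.1 : ℤ) + -(p.2 : ℤ)) = -n by omega] at this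

/-- Multiplication by a power series with rapidly decreasing coefficients preserves the convergence
of the coefficients. -/
theorem tendsto_coeff_mul [UniformSpace R] [IsUniformAddGroup R] [IsTopologicalRing R]
    [CompleteSpace R] (hF : IsRingFiltration F) {f g : PowerSeries R}
    (hf : ∀ n : ℕ, PowerSeries.coeff n f ∈ F (-n)) {ℓ : R}
    (hg : Tendsto (fun n => PowerSeries.coeff n g) atTop (𝓝 ℓ)) :
    Tendsto (fun n => PowerSeries.coeff n (f * g)) atTop
      (𝓝 ((∑' n, PowerSeries.coeff n f) * ℓ)) := by
  simpa only [PowerSeries.coeff_mul] using hF.tendsto_convolution hf hg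

/-- The converse to `tendsto_coeff_mul` holds for an invertible factor, multiplying by the inverse. -/
theorem exists_tendsto_coeff_mul_iff [UniformSpace R] [IsUniformAddGroup R] [IsTopologicalRing R]
    [CompleteSpace R] (hF : IsRingFiltration F) {f g : PowerSeries R}
    (hf0 : PowerSeries.coeff 0 f = 1) (hf : ∀ n : ℕ, PowerSeries.coeff n f ∈ F (-n)) :
    (∃ ℓ, Tendsto (fun n => PowerSeries.coeff n (f * g)) atTop (𝓝 ℓ)) ↔
      ∃ ℓ, Tendsto (fun n => PowerSeries.coeff n g) atTop (𝓝 ℓ) := by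
  refine ⟨fun ⟨ℓ, h⟩ => ?_, fun ⟨ℓ, h⟩ => ⟨_, hF.tendsto_coeff_mul hf h⟩⟩
  have h1 : f * f.invOfUnit 1 = 1 := f.mul_invOfUnit 1 (by simpa using hf0)
  have h2 := hF.tendsto_coeff_mul (hF.coeff_mem_of_mul_eq_one h1 hf0 hf) h
  rw [← mul_assoc, mul_comm _ f, h1, one_mul] at h2
  exact ⟨_, h2⟩

end IsRingFiltration

section Completion

variable {k : Type u} [Field k]

variable (k) in
/-- The dimensional filtration of the completion: the closures of the steps of the
dimensional filtration. -/
def dimFilHat (m : ℤ) : AddSubgroup (K0Hat k) :=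
  ((dimFil k m).map (UniformSpace.Completion.coeRingHom : K0Loc k →+* K0Hat k).toAddMonoidHom).topologicalClosure

theorem coe_mem_dimFilHat {m : ℤ} {x : K0Loc k} (hx : x ∈ dimFil k m) : (x : K0Hat k) ∈ dimFilHat k m :=
  subset_closure ⟨x, hx, rfl⟩

variable (k) in
theorem isRingFiltration_dimFilHat : IsRingFiltration (dimFilHat k) := by
  have hbasis : (𝓝 (0 : K0Hat k)).HasBasis (fun _ : ℤ => True) fun m => (dimFilHat k m : Set (K0Hat k)) :=
    (dimFil_basis k).hasBasis_nhds_zero.hasBasis_of_isDenseInducing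
      (UniformSpace.Completion.isDenseInducing_coe (α := K0Loc k))
  have hmono : Monotone (dimFilHat k) := fun m n h =>
    closure_mono (Set.image_mono (dimFil_mono h))
  refine ⟨hmono, fun hx hy => ?_, fun x => ?_, hbasis⟩
  · refine map_mem_closure₂ continuous_mul hx hy ?_
    rintro _ ⟨x, hx, rfl⟩ _ ⟨y, hy, rfl⟩
    exact ⟨x * y, dimFil_mul hx hy, UniformSpace.Completion.coe_mul x y⟩
  · have hU : {y | x - y ∈ dimFilHat k 0} ∈ 𝓝 x :=
      (continuous_const.sub continuous_id).continuousAt.preimage_mem_nhds (by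
        simpa using hbasis.mem_of_mem (i := 0) trivial)
    obtain ⟨y, hy⟩ := UniformSpace.Completion.denseRange_coe.mem_nhds hU
    obtain ⟨m, hm⟩ := exists_mem_dimFil y
    refine ⟨max m 0, ?_⟩
    rw [← sub_add_cancel x (y : K0Hat k)]
    exact add_mem (hmono (le_max_right _ _) hy) (hmono (le_max_left _ _) (coe_mem_dimFilHat hm))

variable (k) in
/-- The substitution `t ↦ 𝐋⁻ᵈ t`, from power series over the Grothendieck ring to power series
over its completion. -/
def scaleL (d : ℕ) : PowerSeries (K0 k) →+* PowerSeries (K0Hat k) :=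
  (PowerSeries.rescale (invLHat k ^ d)).comp (PowerSeries.map toHat)

theorem coeff_scaleL (d n : ℕ) (F : PowerSeries (K0 k)) :
    PowerSeries.coeff n (scaleL k d F) = zetaTerm F d n := by
  rw [scaleL, RingHom.comp_apply, PowerSeries.coeff_rescale, PowerSeries.coeff_map, zetaTerm, mul_comm]

theorem symRatio_eq (X : Over (Spec (.of k))) (d n : ℕ) :
    symRatio X d n = PowerSeries.coeff n (scaleL k d (motivicZeta X)) := by
  rw [coeff_scaleL, zetaTerm, motivicZeta, PowerSeries.coeff_mk, symRatio, pow_mul]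

end Completion

/-! ### Motivic zeta functions -/

section MotivicZeta

variable {k : Type u} [Field k]

instance isSeparated_sub (X : FTScheme k) [IsSeparated X.obj.hom] {Z : Scheme.{u}}
    (f : Z ⟶ X.obj.left) [LocallyOfFiniteType f] [QuasiCompact f] [IsSeparated f] :
    IsSeparated (X.sub f).obj.hom :=
  inferInstanceAs (IsSeparated (f ≫ X.obj.hom))

theorem exists_topologicalKrullDim_eq {X : Type*} [TopologicalSpace X] [Nonempty X] {d : ℕ}
    (hd : topologicalKrullDim X ≤ d) : ∃ e : ℕ, topologicalKrullDim X = e := by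
  obtain ⟨x⟩ := ‹Nonempty X›
  have : Nonempty (TopologicalSpace.IrreducibleCloseds X) :=
    ⟨⟨closure {x}, isIrreducible_singleton.closure, isClosed_closure⟩⟩
  have h0 : 0 ≤ topologicalKrullDim X := Order.krullDim_nonneg
  generalize topologicalKrullDim X = e at hd h0
  induction e with
  | bot => simp at h0
  | coe e =>
    have : e ≤ d := by exact_mod_cast hd
    lift e to ℕ using ne_top_of_le_ne_top (ENat.natCast_ne_top d) this
    exact ⟨e, rfl⟩

/-- The zeta function is multiplicative for decompositions into a locally closed subset and its
complement. -/
theorem motivicZeta_eq_mul {X U Y : FTScheme k} [IsSeparated X.obj.hom] [IsSeparated U.obj.hom]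
    [IsSeparated Y.obj.hom] (i : Y.obj ⟶ X.obj) (j : U.obj ⟶ X.obj) [IsImmersion i.left]
    [IsImmersion j.left] (h : Set.range i.left = (Set.range j.left)ᶜ) :
    motivicZeta X.obj = motivicZeta Y.obj * motivicZeta U.obj := by
  obtain ⟨F, hF⟩ := exists_hasPiecewiseZeta Y
  obtain ⟨G, hG⟩ := exists_hasPiecewiseZeta U
  rw [motivicZeta_eq hF, motivicZeta_eq hG]
  refine motivicZeta_eq ?_
  have := (hF.image i).union (hG.image j) (by
    rw [Set.image_univ, Set.image_univ, h]
    exact disjoint_compl_left)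
  rwa [Set.image_univ, Set.image_univ, h, Set.compl_union_self] at this

theorem motivicZeta_congr {X Y : FTScheme k} [IsSeparated X.obj.hom] [IsSeparated Y.obj.hom]
    (e : X.obj ≅ Y.obj) : motivicZeta X.obj = motivicZeta Y.obj := by
  obtain ⟨F, hF⟩ := exists_hasPiecewiseZeta X
  rw [motivicZeta_eq hF]
  have : IsIso e.hom.left := inferInstanceAs (IsIso ((Over.forget _).map e.hom))
  have h := hF.image e.hom
  rw [Set.image_univ, e.hom.left.surjective.range_eq] at h
  exact (motivicZeta_eq h).symm

theorem coeff_zero_motivicZeta (X : FTScheme k) [IsSeparated X.obj.hom] :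
    PowerSeries.coeff 0 (motivicZeta X.obj) = 1 := by
  obtain ⟨F, hF⟩ := exists_hasPiecewiseZeta X
  rw [motivicZeta_eq hF, hF.coeff_zero]

theorem motivicZeta_of_isEmpty (X : FTScheme k) [IsSeparated X.obj.hom] [IsEmpty X.obj.left] :
    motivicZeta X.obj = 1 :=
  motivicZeta_eq (by simpa only [Set.univ_eq_empty_iff.mpr ‹_›] using HasPiecewiseZeta.empty)

theorem IsPiecewise.topologicalKrullDim_le {Z X : Scheme.{u}} {g : Z ⟶ X} (hg : IsPiecewise g) :
    topologicalKrullDim Z ≤ topologicalKrullDim X := by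
  choose N hz hN using hg.exists_isImmersion
  exact topologicalKrullDim_le_of_cover (fun z => (N z).ι) (fun z => (N z).ι.isOpenEmbedding)
    (fun z => ⟨z, ⟨z, hz z⟩, rfl⟩) _
    fun z => ((N z).ι ≫ g).isEmbedding.isInducing.topologicalKrullDim_le

/-- The coefficients of the zeta function are classes of schemes of the expected dimension, namely
symmetric powers of an affine scheme of the same dimension. -/
theorem exists_coeff_motivicZeta_eq (X : FTScheme k) [IsSeparated X.obj.hom] [Nonempty X.obj.left]
    {d : ℕ} (hd : topologicalKrullDim X.obj.left ≤ d) (n : ℕ) : ∃ Z : FTScheme k,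
      topologicalKrullDim Z.obj.left ≤ (n * d : ℕ) ∧
        PowerSeries.coeff n (motivicZeta X.obj) = cls Z := by
  obtain ⟨F, hF⟩ := exists_hasPiecewiseZeta X
  rw [motivicZeta_eq hF]
  obtain ⟨B, _, _, _, g, hg, rfl⟩ := hF.exists_isPiecewise
  have : Nonempty (PrimeSpectrum B) := (hg.bijective.2 (Classical.arbitrary _)).nonempty
  have : Nontrivial B := PrimeSpectrum.nonempty_iff_nontrivial.mp this
  have hB : ringKrullDim B ≤ d :=
    (PrimeSpectrum.topologicalKrullDim_eq_ringKrullDim B).symm.trans_le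
      (hg.topologicalKrullDim_le.trans hd)
  refine ⟨FTScheme.symSpec k B n, ?_, by rw [specZeta, PowerSeries.coeff_mk]⟩
  exact (PrimeSpectrum.topologicalKrullDim_eq_ringKrullDim _).trans_le (ringKrullDim_symTensor_le hB n)

/-- If `dim X < d`, the `n`-th term of `𝐙_X(𝐋⁻ᵈ)` has dimension at most
`n (d - 1) - n d = - n`. -/
theorem zetaTerm_mem_dimFilHat (X : FTScheme k) [IsSeparated X.obj.hom] {d : ℕ}
    (hd : topologicalKrullDim X.obj.left < d) (n : ℕ) :
    zetaTerm (motivicZeta X.obj) d n ∈ dimFilHat k (-n) := by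
  have h1 : zetaTerm (motivicZeta X.obj) d n =
      ((algebraMap _ (K0Loc k) (PowerSeries.coeff n (motivicZeta X.obj)) * (invL k ^ d) ^ n :
        K0Loc k) : K0Hat k) := by
    rw [zetaTerm, UniformSpace.Completion.coe_mul]
    congr 1
    exact ((map_pow UniformSpace.Completion.coeRingHom (invL k ^ d) n).trans
      (congrArg (· ^ n) (map_pow UniformSpace.Completion.coeRingHom (invL k) d))).symm
  rw [h1]
  refine coe_mem_dimFilHat ?_
  rw [← pow_mul]
  cases isEmpty_or_nonempty X.obj.left
  · rw [motivicZeta_of_isEmpty, PowerSeries.coeff_one]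
    split_ifs with hn
    · subst hn
      refine AddSubgroup.subset_closure ⟨FTScheme.point k, 0, 0, ?_, by simp, ?_⟩
      · exact (PrimeSpectrum.topologicalKrullDim_eq_ringKrullDim k).trans_le (by simp)
      · rw [mul_zero]
        have hp : cls (FTScheme.point k) = 1 := rfl
        rw [hp]
    · rw [map_zero, zero_mul]
      exact zero_mem _
  · obtain ⟨e, he⟩ := exists_topologicalKrullDim_eq hd.le
    have hed : e < d := by rw [he] at hd; exact_mod_cast hd
    obtain ⟨Z, hZ, hZ'⟩ := exists_coeff_motivicZeta_eq X he.le n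
    rw [hZ']
    refine AddSubgroup.subset_closure ⟨Z, n * e, d * n, hZ, ?_, rfl⟩
    have : (n : ℤ) * (e + 1) ≤ n * d := mul_le_mul_of_nonneg_left (by omega) (by omega)
    push_cast
    linarith

end MotivicZeta

/-! ### Stabilization -/

section Stabilization

variable {k : Type u} [Field k]

theorem mssp_iff {X : Over (Spec (.of k))} {d : ℕ} (hd : topologicalKrullDim X.left = d) :
    MSSP X ↔ ∃ ℓ, Tendsto (symRatio X d) atTop (𝓝 ℓ) := by
  refine ⟨fun ⟨e, he, h⟩ => ?_, fun h => ⟨d, hd, h⟩⟩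
  obtain rfl : d = e := by
    rw [hd] at he
    exact_mod_cast he
  exact h

theorem IsVariety.isIntegral (X : Over (Spec (.of k))) [IsVariety X]
    [GeometricallyIrreducible X.hom] : IsIntegral X.left := by
  have := IsVariety.reduced (X := X)
  have := GeometricallyIrreducible.irreducibleSpace_of_subsingleton X.hom
  exact isIntegral_of_irreducibleSpace_of_isReduced X.left

theorem mssp_congr {X Y : FTScheme k} [IsSeparated X.obj.hom] [IsSeparated Y.obj.hom]
    (e : X.obj ≅ Y.obj) : MSSP X.obj ↔ MSSP Y.obj := by
  have : IsIso e.hom.left := inferInstanceAs (IsIso ((Over.forget _).map e.hom))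
  have h1 := e.hom.left.homeomorph.isHomeomorph.topologicalKrullDim_eq
  have h2 (d n) : symRatio X.obj d n = symRatio Y.obj d n := by
    rw [symRatio_eq, symRatio_eq, motivicZeta_congr e]
  simp only [MSSP, h1, funext (h2 _)]

/-- The comparison of an integral scheme with an open subscheme. -/
theorem stabilization_openSub (X : FTScheme k) [IsIntegral X.obj.left] [IsSeparated X.obj.hom] {d : ℕ}
    (hd : topologicalKrullDim X.obj.left = d) (U : X.obj.left.Opens)
    (hU : (U : Set X.obj.left).Nonempty) (Y : FTScheme k) [IsSeparated Y.obj.hom] (i : Y.obj ⟶ X.obj)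
    [IsClosedImmersion i.left] (hi : Set.range i.left = (U : Set X.obj.left)ᶜ) :
    Summable (zetaTerm (motivicZeta Y.obj) d) ∧ (MSSP X.obj ↔ MSSP (openSub X.obj U)) ∧
    ((∃ ℓ, Tendsto (symRatio X.obj d) atTop (𝓝 ℓ)) ↔
      ∃ ℓ, Tendsto (symRatio (openSub X.obj U) d) atTop (𝓝 ℓ)) ∧
    (∀ ℓX ℓU, Tendsto (symRatio X.obj d) atTop (𝓝 ℓX) →
      Tendsto (symRatio (openSub X.obj U) d) atTop (𝓝 ℓU) →
      ℓX = zetaValue (motivicZeta Y.obj) d * ℓU) := by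
  have hdY : topologicalKrullDim Y.obj.left < d := by
    refine topologicalKrullDim_lt_of_isClosedEmbedding i.left.isClosedEmbedding (fun h => ?_) hd.le
    obtain ⟨x, hx⟩ := hU
    have h2 : x ∈ Set.range i.left := h x
    rw [hi] at h2
    exact h2 hx
  have hmem := zetaTerm_mem_dimFilHat Y hdY
  have hF := isRingFiltration_dimFilHat k
  have hmul : motivicZeta X.obj = motivicZeta Y.obj * motivicZeta (openSub X.obj U) :=
    motivicZeta_eq_mul (U := X.sub U.ι) i (X.subι U.ι) (by
      rw [hi]
      exact congrArg _ (Scheme.Opens.range_ι U).symm)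
  have hX : symRatio X.obj d = fun n => PowerSeries.coeff n
      (scaleL k d (motivicZeta Y.obj) * scaleL k d (motivicZeta (openSub X.obj U))) := by
    ext n
    rw [symRatio_eq, hmul, map_mul]
  have hU' : symRatio (openSub X.obj U) d = fun n => PowerSeries.coeff n
      (scaleL k d (motivicZeta (openSub X.obj U))) := funext (symRatio_eq _ d)
  have hY : ∀ n : ℕ, PowerSeries.coeff n (scaleL k d (motivicZeta Y.obj)) ∈ dimFilHat k (-n) := by
    intro n
    rw [coeff_scaleL]
    exact hmem n
  have hY0 : PowerSeries.coeff 0 (scaleL k d (motivicZeta Y.obj)) = 1 := by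
    rw [coeff_scaleL, zetaTerm, coeff_zero_motivicZeta, map_one, pow_zero, one_mul]
  have hiff : (∃ ℓ, Tendsto (symRatio X.obj d) atTop (𝓝 ℓ)) ↔
      ∃ ℓ, Tendsto (symRatio (openSub X.obj U) d) atTop (𝓝 ℓ) := by
    rw [hX, hU']
    exact hF.exists_tendsto_coeff_mul_iff hY0 hY
  refine ⟨hF.summable hmem, ?_, hiff, fun ℓX ℓU h1 h2 => ?_⟩
  · rw [mssp_iff hd, mssp_iff ((topologicalKrullDim_opens X U hU).trans hd), hiff]
  · rw [hU'] at h2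
    have h3 := hF.tendsto_coeff_mul hY h2
    rw [hX] at h1
    simp only [coeff_scaleL] at h3
    exact tendsto_nhds_unique h1 h3

theorem mssp_openSub_iff (X : FTScheme k) [IsIntegral X.obj.left] [IsSeparated X.obj.hom]
    (U : X.obj.left.Opens) (hU : (U : Set X.obj.left).Nonempty) :
    MSSP (openSub X.obj U) ↔ MSSP X.obj := by
  obtain ⟨e, he⟩ := exists_dim_le X.obj.hom
  obtain ⟨d, hd⟩ := exists_topologicalKrullDim_eq he
  exact (stabilization_openSub X hd U hU (X.red U.compl) (X.redι U.compl)
    (X.range_redι U.compl)).2.1.symm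

/-- A birational map is an isomorphism of dense open subschemes. -/
theorem mssp_iff_of_partialIso (X Y : FTScheme k) [IsIntegral X.obj.left] [IsSeparated X.obj.hom]
    [IsIntegral Y.obj.left] [IsSeparated Y.obj.hom] (f : X.obj.left.PartialIso Y.obj.left)
    (hf : f.IsOver X.obj.hom Y.obj.hom) : MSSP X.obj ↔ MSSP Y.obj :=
  (mssp_openSub_iff X f.source f.dense_source.nonempty).symm.trans
    ((mssp_congr (X := X.sub f.source.ι) (Y := Y.sub f.target.ι) (Over.isoMk f.iso hf)).trans
      (mssp_openSub_iff Y f.target f.dense_target.nonempty))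

end Stabilization

end Motivic

end

open Motivic
theorem proposition4p2 {k : Type u} [Field k] :
    -- comparison of a variety `X` with a dense open subset `U`, with complement `Y`
    (∀ (X : Over (Spec (.of k))) [IsVariety X] [GeometricallyIrreducible X.hom]
      (d : ℕ) (_ : topologicalKrullDim X.left = d)
      (U : X.left.Opens) (_ : Dense (U : Set X.left))
      (Y : Over (Spec (.of k))) [IsVariety Y] (i : Y ⟶ X) [IsClosedImmersion i.left]
      (_ : Set.range i.left = (U : Set X.left)ᶜ),
      -- the series `𝐙_Y(𝐋⁻ᵈ)` converges in the completion
      Summable (zetaTerm (motivicZeta Y) d) ∧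
      -- motivic stabilization holds for `X` if and only if it holds for `U`
      (MSSP X ↔ MSSP (openSub X U)) ∧
      -- one limit exists if and only if the other does
      ((∃ ℓ, Tendsto (symRatio X d) atTop (𝓝 ℓ)) ↔
        ∃ ℓ, Tendsto (symRatio (openSub X U) d) atTop (𝓝 ℓ)) ∧
      -- and then the limits differ by the factor `𝐙_Y(𝐋⁻ᵈ)`
      (∀ ℓX ℓU, Tendsto (symRatio X d) atTop (𝓝 ℓX) →
        Tendsto (symRatio (openSub X U) d) atTop (𝓝 ℓU) →
        ℓX = zetaValue (motivicZeta Y) d * ℓU)) ∧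
    -- birational invariance
    (∀ (X₁ X₂ : Over (Spec (.of k))) [IsVariety X₁] [IsVariety X₂]
      [GeometricallyIrreducible X₁.hom] [GeometricallyIrreducible X₂.hom],
      Scheme.BirationalOver X₁.hom X₂.hom → (MSSP X₁ ↔ MSSP X₂)) := by
  refine ⟨fun X _ _ d hd U hU Y _ i _ hi => ?_, fun X₁ X₂ _ _ _ _ ⟨f, hf⟩ => ?_⟩
  · have := IsVariety.isIntegral X
    have := IsVariety.separated (X := X)
    have := IsVariety.locallyOfFiniteType (X := X)
    have := IsVariety.quasiCompact (X := X)
    have := IsVariety.separated (X := Y)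
    have := IsVariety.locallyOfFiniteType (X := Y)
    have := IsVariety.quasiCompact (X := Y)
    exact stabilization_openSub { obj := X } hd U hU.nonempty { obj := Y } i hi
  · have := IsVariety.isIntegral X₁
    have := IsVariety.separated (X := X₁)
    have := IsVariety.locallyOfFiniteType (X := X₁)
    have := IsVariety.quasiCompact (X := X₁)
    have := IsVariety.isIntegral X₂
    have := IsVariety.separated (X := X₂)
    have := IsVariety.locallyOfFiniteType (X := X₂)
    have := IsVariety.quasiCompact (X := X₂)
    exact mssp_iff_of_partialIso { obj := X₁ } { obj := X₂ } f hf
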